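/- **Conventions.** All compositions are written in diagrammatic order ($fg$ means first $f$, then $g$). For 2-morphisms, $\alpha\cdot\beta$ is vertical and $\alpha\circ\beta$ horizontal composition; a 1-morphism written in a composite of 2-morphisms stands for its identity. For vector spaces $P$ is the transposition $x\otimes y\mapsto y\otimes x$, and canonical associativity isomorphisms are suppressed. **Spherical 2-categories.** A *semi-strict monoidal 2-category* is a strict 2-category $C$ with a unit object $I$ and a tensor product which is strict (strictly associative and unital on objects, 1- and 2-morphisms, $A\otimes -$ and $-\otimes A$ being strict 2-functors), except that for $f:A\to A'$, $g:B\to B'$ the two composites are related by an invertible tensorator $$\otimes_{f,g}:(f\otimes B)(A'\otimes g)\Rightarrow (A\otimes g)(f\otimes B'),$$ natural in $f,g$, compatible with composition in each variable, with identities, and with tensoring by objects. It has *duals* if there are strict involutions $*$ on objects, on 1-morphisms ($f^*:B\to A$ for $f:A\to B$) and on 2-morphisms ($\alpha^*:g\Rightarrow f$ for $\alpha:f\Rightarrow g$), with $(A\otimes B)^*=B^*\otimes A^*$, $(fg)^*=g^*f^*$, $(\alpha\cdot\beta)^*=\beta^*\cdot\alpha^*$, $(\alpha\circ\beta)^*=\alpha^*\circ\beta^*$,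 $1_f^*=1_f$, $1_A^*=1_A$, $(A\otimes f)^*=A\otimes f^*$, $(f\otimes A)^*=f^*\otimes A$ and likewise for 2-morphisms, together with 1-morphisms $i_A:I\to A\otimes A^*$, $e_A:A^*\otimes A\to I$, 2-morphisms $i_f:1_A\Rightarrow ff^*$, $e_f:f^*f\Rightarrow 1_B$ (for $f:A\to B$) and triangulators $T_A:(i_A\otimes A)(A\otimes e_A)\Rightarrow 1_A$ such that: $\otimes_{f,g}$ and $T_A$ are unitary ($\alpha$ is unitary when $\alpha^*=\alpha^{-1}$); $i_{A^*}=e_A^*$, $e_{A^*}=i_A^*$, $i_{f^*}=e_f^*$, $e_{f^*}=i_f^*$; $T_I=1$; $i_{A\otimes f}=A\otimes i_f$, $i_{f\otimes A}=i_f\otimes A$, $e_{A\otimes f}=A\otimes e_f$, $e_{f\otimes A}=e_f\otimes A$; $i_{fg}=i_f\cdot(f\circ i_g\circ f^*)$, $e_{fg}=(g^*\circ e_f\circ g)\cdot e_g$; $i_{A\otimes B}=i_A(A\otimes i_B\otimes A^*)$, $e_{A\otimes B}=(B^*\otimes e_A\otimes B)e_B$; $T_{A\otimes B}=\big[(i_A\otimes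 A\otimes B)\circ(A\otimes\otimes_{i_B,e_A}\otimes B)\circ(A\otimes B\otimes e_B)\big]\cdot\big[(T_A\otimes B)\circ(A\otimes T_B)\big]$; $(i_f\circ f)\cdot(f\circ e_f)=1_f$ and $(f^*\circ i_f)\cdot(e_f\circ f^*)=1_{f^*}$; $(\alpha^*)^\dagger=(\alpha^\dagger)^*$, where $\alpha^\dagger=(g^*\circ i_f)\cdot(g^*\circ\alpha\circ f^*)\cdot(e_g\circ f^*)$ for $\alpha:f\Rightarrow g$; and $\big[i_A\circ(A\otimes T_{A^*}^\dagger)\big]\cdot\big[\otimes_{i_A,i_A}\circ(A\otimes e_A\otimes A^*)\big]\cdot\big[i_A\circ(T_A\otimes A^*)\big]=1_{i_A}$. For $f:A\to B$ put ${}^\#f=(i_{A^*}\otimes B^*)(A^*\otimes f\otimes B^*)(A^*\otimes e_{B^*})$ and $f^\#=(B^*\otimes i_A)(B^*\otimes f\otimes A^*)(e_B\otimes A^*)$, both $B^*\to A^*$; define ${}^\#\alpha$, $\alpha^\#$ by the same formulas, and put ${}^\dagger\alpha=(i_{f^*}\circ g^*)\cdot(f^*\circ\alpha\circ g^*)\cdot(f^*\circ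 e_{g^*})$ for $\alpha:f\Rightarrow g$. A *pivotal structure* is a family of unitary 2-morphisms $\phi_f:{}^\#f\Rightarrow f^\#$, natural in $f$, compatible with composition (through the canonical 2-isomorphisms ${}^\#(fg)\Rightarrow{}^\#g\,{}^\#f$, $(fg)^\#\Rightarrow g^\#f^\#$ built from tensorators and triangulators), with $\phi_f^\dagger=\phi_{f^*}$, where moreover ${}^\#(\alpha^\dagger)={}^\dagger(\alpha^\#)$ and $({}^\#\alpha)^\dagger=({}^\dagger\alpha)^\#$ for all 2-morphisms $\alpha$. Here, for $f:A\to B$, $g:B\to C$, the isomorphism $(fg)^\#\Rightarrow g^\#f^\#$ is the vertical composite of $(C^*\otimes i_A)(C^*\otimes f\otimes A^*)\circ(C^*\otimes T_B^{-1}\otimes A^*)\circ(C^*\otimes g\otimes A^*)(e_C\otimes A^*)$, then $(C^*\otimes i_A)(C^*\otimes f\otimes A^*)(C^*\otimes i_B\otimes B\otimes A^*)\circ(C^*\otimes\otimes^{-1}_{g,e_B}\otimes A^*)\circ(e_C\otimes A^*)$, then $\otimes^{-1}_{(C^*\otimes i_B)(C^*\otimes g\otimes B^*),\,i_A(f\otimes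 A^*)}\circ(C^*\otimes C\otimes e_B\otimes A^*)(e_C\otimes A^*)$, then $(C^*\otimes i_B)(C^*\otimes g\otimes B^*)\circ\otimes^{-1}_{e_C,\,f^\#}$; and ${}^\#(fg)\Rightarrow{}^\#g\,{}^\#f$ is its mirror image. *Mirror image* means: reverse all tensor products and exchange $i_A\leftrightarrow i_{A^*}$, $e_A\leftrightarrow e_{A^*}$, ${}^\#f\leftrightarrow f^\#$, $\phi_f\leftrightarrow\phi_f^{-1}$, $\otimes_{f,g}\leftrightarrow\otimes^{-1}_{g,f}$, $T_A\leftrightarrow (T_A^\dagger)^{-1}$. For $f:A\to A$ put $\mathrm{Tr}_L(f)=i_{A^*}(A^*\otimes f)e_A$ and $\mathrm{Tr}_R(f)=i_A(f\otimes A^*)e_{A^*}$, and likewise on 2-morphisms. For $f:A\to B$ put $\cap^R_f=i_{i_A(f\otimes A^*)}:1_I\Rightarrow\mathrm{Tr}_R(ff^*)$, $\cup^R_f=(\cap^R_f)^*$, $\cap^L_f=i_{i_{A^*}(A^*\otimes f)}:1_I\Rightarrow \mathrm{Tr}_L(ff^*)$, $\cup^L_f=(\cap^L_f)^*$. The pivotal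 2-category is *consistent* if the canonical 2-isomorphisms $\theta^R_{f,g}:\mathrm{Tr}_R(fg)\Rightarrow\mathrm{Tr}_R(gf)$ and $\theta^L_{f,g}:\mathrm{Tr}_L(fg)\Rightarrow\mathrm{Tr}_L(gf)$ ($f:A\to B$, $g:B\to A$) satisfy $\cap^R_f\cdot\theta^R_{f,f^*}=\cap^R_{f^*}$, $\theta^R_{f,f^*}\cdot\cup^R_{f^*}=\cup^R_f$, and the same with $L$. Here $\theta^R_{f,g}$ is the vertical composite of $i_A(f\otimes A^*)\circ(T_B^\dagger\otimes A^*)\circ(g\otimes A^*)e_{A^*}$, then $i_A(f\otimes A^*)(B\otimes i_{B^*}\otimes A^*)\circ\otimes_{e_{B^*},\,(g\otimes A^*)e_{A^*}}$, then $i_A(f\otimes A^*)\circ(B\otimes\phi_g)\circ e_{B^*}$, then $\otimes_{i_A(f\otimes A^*),\,i_B(g\otimes B^*)}\circ(B\otimes e_A\otimes B^*)e_{B^*}$, then $i_B(g\otimes B^*)(i_A\otimes A\otimes B^*)\circ(\otimes_{f,e_A}\otimes B^*)\circ e_{B^*}$, then $i_B(g\otimes B^*)\circ(T_A\otimes B^*)\circ(f\otimes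 B^*)e_{B^*}$; and $\theta^L_{f,g}$ is its mirror image. A *spherical* 2-category is a consistent pivotal one with unitary 2-morphisms $\sigma_f:\mathrm{Tr}_L(f)\Rightarrow\mathrm{Tr}_R(f)$, natural in the endomorphism $f$, with $\cap^L_{1_A}\cdot\sigma_{1_A}=\cap^R_{1_A}$ and $\sigma_{1_A}\cdot\cup^R_{1_A}=\cup^L_{1_A}$. **Setting.** Let $\mathbb F$ be a field of characteristic $0$ and let $C$ be a semi-strict spherical 2-category whose categories $\mathrm{Hom}(A,B)$ are finite dimensional 2-vector spaces over $\mathbb F$ (linear categories with finite dimensional spaces of morphisms, with finite direct sums, and in which every object is a finite direct sum of members of a finite basis, i.e. a finite set of objects with one-dimensional endomorphism spaces and no non-zero morphisms between distinct members), with bilinear compositions and linear functors $A\otimes-$, $-\otimes A$, with $\mathrm{End}(I)$ of rank one and $2\mathrm{End}(1_I)=\mathbb F$. For $\alpha\in 2\mathrm{Hom}(f,g)$, $\beta\in2\mathrm{Hom}(g,f)$ put $$\langle\alpha,\beta\rangle=\cap^R_f\cdot\mathrm{Tr}_R\big((\alpha\cdot\beta)\circ 1_{f^*}\big)\cdot\cup^R_f\in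 2\mathrm{End}(1_I)=\mathbb F,$$ and assume that this pairing is non-degenerate for all parallel $f,g$; it identifies $2\mathrm{Hom}(f,g)$ with $2\mathrm{Hom}(g,f)^*$. Put $\dim_q(f)=\langle1_f,1_f\rangle$ and $\dim_q(A)=\dim_q(1_A)$. Let $\mathcal E$ be a finite set of non-zero, pairwise non-equivalent objects for which $C$ is finitely semi-simple: for all $A,B$ composition induces an equivalence $\bigoplus_{X\in\mathcal E}\mathrm{Hom}(A,X)\otimes\mathrm{Hom}(X,B)\simeq\mathrm{Hom}(A,B)$. Fix a finite basis $\mathcal F_{A,B}$ of $\mathrm{Hom}(A,B)$ for all $A,B$. **Labels and partition functions.** Edges $(ij)$, $i<j$, are labelled by $e_{ij}\in\mathcal E$ and triangles $(ijk)$, $i<j<k$, by $f_{ijk}\in\mathcal F_{e_{ik},\,e_{jk}\otimes e_{ij}}$. For $i<j<k<l$ put $f_{(ijk)l}=f_{ikl}(e_{kl}\otimes f_{ijk})$, $f_{i(jkl)}=f_{ijl}(f_{jkl}\otimes e_{ij})$ and $$2H(ijkl)=2\mathrm{Hom}(f_{(ijk)l},f_{i(jkl)}).$$ For $i<j<k<l<m$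 the linear map $$Z(+(ijklm)):2H(iklm)\otimes2H(ijkm)\to2H(jklm)\otimes2H(ijlm)\otimes2H(ijkl)$$ is determined, through $2\mathrm{Hom}(f,g)=2\mathrm{Hom}(g,f)^*$, by $\langle\beta\delta,\alpha\gamma\epsilon\rangle$ for $\beta\in 2H(iklm)$, $\delta\in 2H(ijkm)$, $\alpha\in2\mathrm{Hom}(f_{j(klm)},f_{(jkl)m})$, $\gamma\in2\mathrm{Hom}(f_{i(jlm)},f_{(ijl)m})$, $\epsilon\in2\mathrm{Hom}(f_{i(jkl)},f_{(ijk)l})$, where $$\beta\delta=\big(\beta\circ(e_{lm}\otimes e_{kl}\otimes f_{ijk})\big)\cdot\big(f_{ikm}\circ\otimes_{f_{klm},f_{ijk}}\big)\cdot\big(\delta\circ(f_{klm}\otimes e_{jk}\otimes e_{ij})\big),$$ $$\alpha\gamma\epsilon=\big(f_{ijm}\circ(\alpha\otimes e_{ij})\big)\cdot\big(\gamma\circ(e_{lm}\otimes f_{jkl}\otimes e_{ij})\big)\cdot\big(f_{ilm}\circ(e_{lm}\otimes\epsilon)\big).$$ The linear map $Z(-(ijklm)):2H(jklm)\otimes2H(ijlm)\otimes2H(ijkl)\to2H(iklm)\otimes2H(ijkm)$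 is determined in the same way by $\langle\delta\beta,\epsilon\gamma\alpha\rangle$ for $\alpha\in2H(jklm)$, $\gamma\in2H(ijlm)$, $\epsilon\in2H(ijkl)$, $\beta\in2\mathrm{Hom}(f_{i(klm)},f_{(ikl)m})$, $\delta\in2\mathrm{Hom}(f_{i(jkm)},f_{(ijk)m})$, where $$\delta\beta=\big(\delta\circ(f_{klm}\otimes e_{jk}\otimes e_{ij})\big)\cdot\big(f_{ikm}\circ\otimes_{f_{klm},f_{ijk}}^{-1}\big)\cdot\big(\beta\circ(e_{lm}\otimes e_{kl}\otimes f_{ijk})\big),$$ $$\epsilon\gamma\alpha=\big(f_{ilm}\circ(e_{lm}\otimes\epsilon)\big)\cdot\big(\gamma\circ(e_{lm}\otimes f_{jkl}\otimes e_{ij})\big)\cdot\big(f_{ijm}\circ(\alpha\otimes e_{ij})\big).$$ **Lemma 5.3 ($2\rightleftharpoons4$).** Fix labels of all edges of $(012345)$ other than $(14)$ and of all triangles of $(012345)$ that do not contain $(14)$. Then, as linear maps $$2H(2345)\otimes2H(0245)\otimes2H(0234)\otimes2H(0125)\to2H(0345)\otimes2H(1235)\otimes2H(0135)\otimes2H(0123),$$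 one has $$\begin{aligned}&(Z(-(02345))\otimes1)(1\otimes Z(+(01235)))\\&=\sum_{e_{14},f_{014},f_{124},f_{145},f_{134}}\dim_q(e_{14})^{-1}\dim_q(f_{014})\dim_q(f_{124})\dim_q(f_{145})\dim_q(f_{134})\\&\quad(1\otimes1\otimes P)(1\otimes Z(+(01245))\otimes1)(1\otimes1\otimes1\otimes P)(1\otimes1\otimes1\otimes Z(+(01234)))\\&\quad(1\otimes1\otimes P\otimes1\otimes1)(Z(-(12345))\otimes1\otimes1\otimes1)(P\otimes1\otimes1\otimes1)(1\otimes Z(-(01345))\otimes1)(P\otimes1\otimes1),\end{aligned}$$ where $e_{14}$ runs over $\mathcal E$ and $f_{014},f_{124},f_{145},f_{134}$ run over $\mathcal F_{e_{04},e_{14}\otimes e_{01}}$, $\mathcal F_{e_{14},e_{24}\otimes e_{12}}$, $\mathcal F_{e_{15},e_{45}\otimes e_{14}}$, $\mathcal F_{e_{14},e_{34}\otimes e_{13}}$. -/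

import Mathlib

universe u v w

set_option linter.checkUnivs false
set_option linter.unusedSectionVars false

namespace Spherical2

/-! ### Strict 2-categories

A strict 2-category with class of objects `O` is given by its set of 1-morphisms and its set of
2-morphisms, with source and target maps.  In this presentation the strict equations between
objects, 1-morphisms and 2-morphisms of a semi-strict structure are plain equations.  Compositions
are written in diagrammatic order and are only specified on composable pairs. -/

/-- The operations of a strict 2-category: `dom, cod` are source and target of a 1-morphism,
`src, tgt` source and target of a 2-morphism, `comp f g` is `fg` (first `f`), `vcomp`, `hcomp` are
vertical and horizontal composition of 2-morphisms. -/
class TwoCatData (O : Type u) where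
  Mor : Type v
  Cell : Type w
  dom : Mor → O
  cod : Mor → O
  src : Cell → Mor
  tgt : Cell → Mor
  one : O → Mor
  comp : Mor → Mor → Mor
  idc : Mor → Cell
  vcomp : Cell → Cell → Cell
  hcomp : Cell → Cell → Cell

open TwoCatData

infixl:75 " ⨾ " => TwoCatData.comp
infixl:65 " ⬝ " => TwoCatData.vcomp
infixl:70 " ⊚ " => TwoCatData.hcomp

/-- The axioms of a strict 2-category. -/
class StrictTwoCategory (O : Type u) [TwoCatData.{u, v, w} O] : Prop where
  dom_src_eq : ∀ α : Cell O, dom (src α) = dom (tgt α)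
  cod_src_eq : ∀ α : Cell O, cod (src α) = cod (tgt α)
  dom_one : ∀ A : O, dom (one A) = A
  cod_one : ∀ A : O, cod (one A) = A
  dom_comp : ∀ f g : Mor O, cod f = dom g → dom (f ⨾ g) = dom f
  cod_comp : ∀ f g : Mor O, cod f = dom g → cod (f ⨾ g) = cod g
  comp_assoc : ∀ f g h : Mor O, cod f = dom g → cod g = dom h → (f ⨾ g) ⨾ h = f ⨾ (g ⨾ h)
  one_comp : ∀ f : Mor O, one (dom f) ⨾ f = f
  comp_one : ∀ f : Mor O, f ⨾ one (cod f) = f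
  src_idc : ∀ f : Mor O, src (idc f) = f
  tgt_idc : ∀ f : Mor O, tgt (idc f) = f
  src_vcomp : ∀ α β : Cell O, tgt α = src β → src (α ⬝ β) = src α
  tgt_vcomp : ∀ α β : Cell O, tgt α = src β → tgt (α ⬝ β) = tgt β
  vcomp_assoc : ∀ α β γ : Cell O, tgt α = src β → tgt β = src γ → (α ⬝ β) ⬝ γ = α ⬝ (β ⬝ γ)
  idc_vcomp : ∀ α : Cell O, idc (src α) ⬝ α = α
  vcomp_idc : ∀ α : Cell O, α ⬝ idc (tgt α) = α
  src_hcomp : ∀ α β : Cell O, cod (src α) = dom (src β) → src (α ⊚ β) = src α ⨾ src β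
  tgt_hcomp : ∀ α β : Cell O, cod (src α) = dom (src β) → tgt (α ⊚ β) = tgt α ⨾ tgt β
  hcomp_assoc : ∀ α β γ : Cell O, cod (src α) = dom (src β) → cod (src β) = dom (src γ) →
    (α ⊚ β) ⊚ γ = α ⊚ (β ⊚ γ)
  one_hcomp : ∀ α : Cell O, idc (one (dom (src α))) ⊚ α = α
  hcomp_one : ∀ α : Cell O, α ⊚ idc (one (cod (src α))) = α
  idc_hcomp_idc : ∀ f g : Mor O, cod f = dom g → idc f ⊚ idc g = idc (f ⨾ g)
  interchange : ∀ α α' β β' : Cell O, tgt α = src α' → tgt β = src β' → cod (src α) = dom (src β) →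
    (α ⬝ α') ⊚ (β ⬝ β') = (α ⊚ β) ⬝ (α' ⊚ β')

/-! ### Semi-strict monoidal 2-categories -/

/-- The operations of a semi-strict monoidal structure: the unit object `unit`, the tensor product
of two objects, of an object and a 1-morphism (in both orders), of an object and a 2-morphism (in
both orders), the tensorator and its inverse. -/
class MonoidalData (O : Type u) [TwoCatData.{u, v, w} O] where
  unit : O
  tensor : O → O → O
  lMor : O → Mor O → Mor O
  rMor : Mor O → O → Mor O
  lCell : O → Cell O → Cell O
  rCell : Cell O → O → Cell O
  tensorator : Mor O → Mor O → Cell O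
  tensoratorInv : Mor O → Mor O → Cell O

open MonoidalData

infixr:85 " ⊗ₒ " => MonoidalData.tensor
infixr:85 " ◁₁ " => MonoidalData.lMor
infixl:86 " ▷₁ " => MonoidalData.rMor
infixr:85 " ◁₂ " => MonoidalData.lCell
infixl:86 " ▷₂ " => MonoidalData.rCell

/-- Semi-strict monoidal 2-categories: everything is strict except the interchange of
`f ⊗ B` and `A ⊗ g`, which is governed by the invertible tensorator
`(f ⊗ dom g)(cod f ⊗ g) ⇒ (dom f ⊗ g)(f ⊗ cod g)`. -/
class SemistrictMonoidal (O : Type u) [TwoCatData.{u, v, w} O] [MonoidalData O] : Prop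
    extends StrictTwoCategory O where
  unit_tensor : ∀ A : O, (unit : O) ⊗ₒ A = A
  tensor_unit : ∀ A : O, A ⊗ₒ (unit : O) = A
  tensor_assoc : ∀ A B C : O, (A ⊗ₒ B) ⊗ₒ C = A ⊗ₒ (B ⊗ₒ C)
  -- sources and targets
  dom_lMor : ∀ (A : O) (f : Mor O), dom (A ◁₁ f) = A ⊗ₒ dom f
  cod_lMor : ∀ (A : O) (f : Mor O), cod (A ◁₁ f) = A ⊗ₒ cod f
  dom_rMor : ∀ (f : Mor O) (A : O), dom (f ▷₁ A) = dom f ⊗ₒ A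
  cod_rMor : ∀ (f : Mor O) (A : O), cod (f ▷₁ A) = cod f ⊗ₒ A
  src_lCell : ∀ (A : O) (α : Cell O), src (A ◁₂ α) = A ◁₁ src α
  tgt_lCell : ∀ (A : O) (α : Cell O), tgt (A ◁₂ α) = A ◁₁ tgt α
  src_rCell : ∀ (α : Cell O) (A : O), src (α ▷₂ A) = src α ▷₁ A
  tgt_rCell : ∀ (α : Cell O) (A : O), tgt (α ▷₂ A) = tgt α ▷₁ A
  -- tensoring with an object, on the left and on the right, is a strict 2-functor
  lMor_one : ∀ A B : O, A ◁₁ one B = one (A ⊗ₒ B)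
  lMor_comp : ∀ (A : O) (f g : Mor O), cod f = dom g → A ◁₁ (f ⨾ g) = (A ◁₁ f) ⨾ (A ◁₁ g)
  lCell_idc : ∀ (A : O) (f : Mor O), A ◁₂ idc f = idc (A ◁₁ f)
  lCell_vcomp : ∀ (A : O) (α β : Cell O), tgt α = src β → A ◁₂ (α ⬝ β) = (A ◁₂ α) ⬝ (A ◁₂ β)
  lCell_hcomp : ∀ (A : O) (α β : Cell O), cod (src α) = dom (src β) →
    A ◁₂ (α ⊚ β) = (A ◁₂ α) ⊚ (A ◁₂ β)
  rMor_one : ∀ A B : O, one A ▷₁ B = one (A ⊗ₒ B)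
  rMor_comp : ∀ (f g : Mor O) (A : O), cod f = dom g → (f ⨾ g) ▷₁ A = (f ▷₁ A) ⨾ (g ▷₁ A)
  rCell_idc : ∀ (f : Mor O) (A : O), idc f ▷₂ A = idc (f ▷₁ A)
  rCell_vcomp : ∀ (α β : Cell O) (A : O), tgt α = src β → (α ⬝ β) ▷₂ A = (α ▷₂ A) ⬝ (β ▷₂ A)
  rCell_hcomp : ∀ (α β : Cell O) (A : O), cod (src α) = dom (src β) →
    (α ⊚ β) ▷₂ A = (α ▷₂ A) ⊚ (β ▷₂ A)
  -- strict unit and associativity laws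
  unit_lMor : ∀ f : Mor O, (unit : O) ◁₁ f = f
  rMor_unit : ∀ f : Mor O, f ▷₁ (unit : O) = f
  unit_lCell : ∀ α : Cell O, (unit : O) ◁₂ α = α
  rCell_unit : ∀ α : Cell O, α ▷₂ (unit : O) = α
  lMor_lMor : ∀ (A B : O) (f : Mor O), A ◁₁ (B ◁₁ f) = (A ⊗ₒ B) ◁₁ f
  lMor_rMor : ∀ (A : O) (f : Mor O) (B : O), A ◁₁ (f ▷₁ B) = (A ◁₁ f) ▷₁ B
  rMor_rMor : ∀ (f : Mor O) (A B : O), (f ▷₁ A) ▷₁ B = f ▷₁ (A ⊗ₒ B)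
  lCell_lCell : ∀ (A B : O) (α : Cell O), A ◁₂ (B ◁₂ α) = (A ⊗ₒ B) ◁₂ α
  lCell_rCell : ∀ (A : O) (α : Cell O) (B : O), A ◁₂ (α ▷₂ B) = (A ◁₂ α) ▷₂ B
  rCell_rCell : ∀ (α : Cell O) (A B : O), (α ▷₂ A) ▷₂ B = α ▷₂ (A ⊗ₒ B)
  -- the tensorator is a 2-isomorphism
  src_tensorator : ∀ f g : Mor O, src (tensorator f g) = (f ▷₁ dom g) ⨾ (cod f ◁₁ g)
  tgt_tensorator : ∀ f g : Mor O, tgt (tensorator f g) = (dom f ◁₁ g) ⨾ (f ▷₁ cod g)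
  src_tensoratorInv : ∀ f g : Mor O, src (tensoratorInv f g) = (dom f ◁₁ g) ⨾ (f ▷₁ cod g)
  tgt_tensoratorInv : ∀ f g : Mor O, tgt (tensoratorInv f g) = (f ▷₁ dom g) ⨾ (cod f ◁₁ g)
  tensorator_inv : ∀ f g : Mor O,
    tensorator f g ⬝ tensoratorInv f g = idc ((f ▷₁ dom g) ⨾ (cod f ◁₁ g))
  inv_tensorator : ∀ f g : Mor O,
    tensoratorInv f g ⬝ tensorator f g = idc ((dom f ◁₁ g) ⨾ (f ▷₁ cod g))
  -- compatibility of the tensorator with tensoring, identities, 2-morphisms and composition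
  tensorator_lMor : ∀ (A : O) (f g : Mor O), tensorator (A ◁₁ f) g = A ◁₂ tensorator f g
  tensorator_mid : ∀ (f : Mor O) (A : O) (g : Mor O), tensorator (f ▷₁ A) g = tensorator f (A ◁₁ g)
  tensorator_rMor : ∀ (f g : Mor O) (A : O), tensorator f (g ▷₁ A) = tensorator f g ▷₂ A
  tensorator_one_left : ∀ (A : O) (g : Mor O), tensorator (one A) g = idc (A ◁₁ g)
  tensorator_one_right : ∀ (f : Mor O) (A : O), tensorator f (one A) = idc (f ▷₁ A)
  tensorator_natural : ∀ α β : Cell O,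
    ((α ▷₂ dom (src β)) ⊚ (cod (src α) ◁₂ β)) ⬝ tensorator (tgt α) (tgt β) =
      tensorator (src α) (src β) ⬝ ((dom (src α) ◁₂ β) ⊚ (α ▷₂ cod (src β)))
  tensorator_comp_left : ∀ f f' g : Mor O, cod f = dom f' →
    tensorator (f ⨾ f') g =
      (idc (f ▷₁ dom g) ⊚ tensorator f' g) ⬝ (tensorator f g ⊚ idc (f' ▷₁ cod g))
  tensorator_comp_right : ∀ f g g' : Mor O, cod g = dom g' →
    tensorator f (g ⨾ g') =
      (tensorator f g ⊚ idc (cod f ◁₁ g')) ⬝ (idc (dom f ◁₁ g) ⊚ tensorator f g')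

/-! ### Duals -/

/-- The duality operations: duals of objects, 1-morphisms and 2-morphisms, the unit `iMor f` and
counit `eMor f` (2-morphisms) of a 1-morphism `f`, the unit `iObj A` and counit `eObj A`
(1-morphisms) of an object `A`, and the triangulator `triang A`. -/
class DualData (O : Type u) [TwoCatData.{u, v, w} O] where
  dualObj : O → O
  dualMor : Mor O → Mor O
  dualCell : Cell O → Cell O
  iMor : Mor O → Cell O
  eMor : Mor O → Cell O
  iObj : O → Mor O
  eObj : O → Mor O
  triang : O → Cell O

open DualData

postfix:max "⋆ₒ" => DualData.dualObj
postfix:max "⋆₁" => DualData.dualMor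
postfix:max "⋆₂" => DualData.dualCell

section
variable {O : Type u} [TwoCatData.{u, v, w} O] [DualData O]

/-- `α` is invertible with inverse `α*`. -/
def IsUnitary (α : Cell O) : Prop :=
  α ⬝ α⋆₂ = idc (src α) ∧ α⋆₂ ⬝ α = idc (tgt α)

/-- The adjoint `α† : g* ⇒ f*` of `α : f ⇒ g`. -/
def adj (α : Cell O) : Cell O :=
  (idc (tgt α)⋆₁ ⊚ iMor (src α)) ⬝ (idc (tgt α)⋆₁ ⊚ α ⊚ idc (src α)⋆₁) ⬝
    (eMor (tgt α) ⊚ idc (src α)⋆₁)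

/-- The other adjoint `†α : g* ⇒ f*` of `α : f ⇒ g`. -/
def adjL (α : Cell O) : Cell O :=
  (iMor (src α)⋆₁ ⊚ idc (tgt α)⋆₁) ⬝ (idc (src α)⋆₁ ⊚ α ⊚ idc (tgt α)⋆₁) ⬝
    (idc (src α)⋆₁ ⊚ eMor (tgt α)⋆₁)

end

/-- Semi-strict monoidal 2-categories with duals. -/
class SemistrictMonoidalDuals (O : Type u) [TwoCatData.{u, v, w} O] [MonoidalData O] [DualData O] :
    Prop extends SemistrictMonoidal O where
  -- sources and targets
  dom_dualMor : ∀ f : Mor O, dom f⋆₁ = cod f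
  cod_dualMor : ∀ f : Mor O, cod f⋆₁ = dom f
  src_dualCell : ∀ α : Cell O, src α⋆₂ = tgt α
  tgt_dualCell : ∀ α : Cell O, tgt α⋆₂ = src α
  src_iMor : ∀ f : Mor O, src (iMor f) = one (dom f)
  tgt_iMor : ∀ f : Mor O, tgt (iMor f) = f ⨾ f⋆₁
  src_eMor : ∀ f : Mor O, src (eMor f) = f⋆₁ ⨾ f
  tgt_eMor : ∀ f : Mor O, tgt (eMor f) = one (cod f)
  dom_iObj : ∀ A : O, dom (iObj A) = (unit : O)
  cod_iObj : ∀ A : O, cod (iObj A) = A ⊗ₒ A⋆ₒ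
  dom_eObj : ∀ A : O, dom (eObj A) = A⋆ₒ ⊗ₒ A
  cod_eObj : ∀ A : O, cod (eObj A) = (unit : O)
  src_triang : ∀ A : O, src (triang A) = (iObj A ▷₁ A) ⨾ (A ◁₁ eObj A)
  tgt_triang : ∀ A : O, tgt (triang A) = one A
  -- duals are involutive and preserve identities
  dualObj_dualObj : ∀ A : O, A⋆ₒ⋆ₒ = A
  dualMor_dualMor : ∀ f : Mor O, f⋆₁⋆₁ = f
  dualCell_dualCell : ∀ α : Cell O, α⋆₂⋆₂ = α
  dualMor_one : ∀ A : O, (one A)⋆₁ = one A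
  dualCell_idc : ∀ f : Mor O, (idc f)⋆₂ = idc f
  -- compatibility with compositions and tensor products
  dualCell_vcomp : ∀ α β : Cell O, tgt α = src β → (α ⬝ β)⋆₂ = β⋆₂ ⬝ α⋆₂
  dualCell_hcomp : ∀ α β : Cell O, cod (src α) = dom (src β) → (α ⊚ β)⋆₂ = α⋆₂ ⊚ β⋆₂
  dualMor_comp : ∀ f g : Mor O, cod f = dom g → (f ⨾ g)⋆₁ = g⋆₁ ⨾ f⋆₁
  dualCell_lCell : ∀ (A : O) (α : Cell O), (A ◁₂ α)⋆₂ = A ◁₂ α⋆₂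
  dualMor_lMor : ∀ (A : O) (f : Mor O), (A ◁₁ f)⋆₁ = A ◁₁ f⋆₁
  dualCell_rCell : ∀ (α : Cell O) (A : O), (α ▷₂ A)⋆₂ = α⋆₂ ▷₂ A
  dualMor_rMor : ∀ (f : Mor O) (A : O), (f ▷₁ A)⋆₁ = f⋆₁ ▷₁ A
  dualObj_tensor : ∀ A B : O, (A ⊗ₒ B)⋆ₒ = B⋆ₒ ⊗ₒ A⋆ₒ
  -- unitarity of the tensorator and of the triangulator
  tensorator_unitary : ∀ f g : Mor O, IsUnitary (tensorator f g)
  triang_unitary : ∀ A : O, IsUnitary (triang A)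
  -- units and counits
  iObj_dual : ∀ A : O, iObj A⋆ₒ = (eObj A)⋆₁
  eObj_dual : ∀ A : O, eObj A⋆ₒ = (iObj A)⋆₁
  iMor_dual : ∀ f : Mor O, iMor f⋆₁ = (eMor f)⋆₂
  eMor_dual : ∀ f : Mor O, eMor f⋆₁ = (iMor f)⋆₂
  iObj_tensor : ∀ A B : O, iObj (A ⊗ₒ B) = iObj A ⨾ (A ◁₁ iObj B ▷₁ A⋆ₒ)
  eObj_tensor : ∀ A B : O, eObj (A ⊗ₒ B) = (B⋆ₒ ◁₁ eObj A ▷₁ B) ⨾ eObj B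
  triang_tensor : ∀ A B : O, triang (A ⊗ₒ B) =
    (idc (iObj A ▷₁ (A ⊗ₒ B)) ⊚ (A ◁₂ tensorator (iObj B) (eObj A) ▷₂ B) ⊚
        idc ((A ⊗ₒ B) ◁₁ eObj B)) ⬝
      ((triang A ▷₂ B) ⊚ (A ◁₂ triang B))
  triang_unit : triang (unit : O) = idc (one (unit : O))
  iMor_lMor : ∀ (A : O) (f : Mor O), iMor (A ◁₁ f) = A ◁₂ iMor f
  iMor_rMor : ∀ (f : Mor O) (A : O), iMor (f ▷₁ A) = iMor f ▷₂ A
  eMor_lMor : ∀ (A : O) (f : Mor O), eMor (A ◁₁ f) = A ◁₂ eMor f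
  eMor_rMor : ∀ (f : Mor O) (A : O), eMor (f ▷₁ A) = eMor f ▷₂ A
  iMor_comp : ∀ f g : Mor O, cod f = dom g →
    iMor (f ⨾ g) = iMor f ⬝ (idc f ⊚ iMor g ⊚ idc f⋆₁)
  eMor_comp : ∀ f g : Mor O, cod f = dom g →
    eMor (f ⨾ g) = (idc g⋆₁ ⊚ eMor f ⊚ idc g) ⬝ eMor g
  zigzag : ∀ f : Mor O, (iMor f ⊚ idc f) ⬝ (idc f ⊚ eMor f) = idc f
  zigzag_dual : ∀ f : Mor O, (idc f⋆₁ ⊚ iMor f) ⬝ (eMor f ⊚ idc f⋆₁) = idc f⋆₁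
  adj_dualCell : ∀ α : Cell O, (adj α)⋆₂ = adj α⋆₂
  swallowtail : ∀ A : O,
    (idc (iObj A) ⊚ (A ◁₂ adj (triang A⋆ₒ))) ⬝
        (tensorator (iObj A) (iObj A) ⊚ idc (A ◁₁ eObj A ▷₁ A⋆ₒ)) ⬝
      (idc (iObj A) ⊚ (triang A ▷₂ A⋆ₒ)) = idc (iObj A)

/-! ### Pivotal and spherical structures -/

section
variable {O : Type u} [TwoCatData.{u, v, w} O] [MonoidalData O] [DualData O]

/-- `#f : B* → A*` for `f : A → B`. -/
def lsharp (f : Mor O) : Mor O :=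
  (iObj (dom f)⋆ₒ ▷₁ (cod f)⋆ₒ) ⨾ ((dom f)⋆ₒ ◁₁ f ▷₁ (cod f)⋆ₒ) ⨾ ((dom f)⋆ₒ ◁₁ eObj (cod f)⋆ₒ)

/-- `f# : B* → A*` for `f : A → B`. -/
def rsharp (f : Mor O) : Mor O :=
  ((cod f)⋆ₒ ◁₁ iObj (dom f)) ⨾ ((cod f)⋆ₒ ◁₁ f ▷₁ (dom f)⋆ₒ) ⨾ (eObj (cod f) ▷₁ (dom f)⋆ₒ)

/-- `#α : #f ⇒ #g` for `α : f ⇒ g`. -/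
def lsharpCell (α : Cell O) : Cell O :=
  idc (iObj (dom (src α))⋆ₒ ▷₁ (cod (src α))⋆ₒ) ⊚
      ((dom (src α))⋆ₒ ◁₂ α ▷₂ (cod (src α))⋆ₒ) ⊚
    idc ((dom (src α))⋆ₒ ◁₁ eObj (cod (src α))⋆ₒ)

/-- `α# : f# ⇒ g#` for `α : f ⇒ g`. -/
def rsharpCell (α : Cell O) : Cell O :=
  idc ((cod (src α))⋆ₒ ◁₁ iObj (dom (src α))) ⊚
      ((cod (src α))⋆ₒ ◁₂ α ▷₂ (dom (src α))⋆ₒ) ⊚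
    idc (eObj (cod (src α)) ▷₁ (dom (src α))⋆ₒ)

/-- The canonical 2-isomorphism `#(fg) ⇒ #g #f`. -/
def lsharpComp (f g : Mor O) : Cell O :=
  let A := dom f
  let B := cod f
  let C := cod g
  (idc ((iObj A⋆ₒ ▷₁ C⋆ₒ) ⨾ (A⋆ₒ ◁₁ f ▷₁ C⋆ₒ)) ⊚ (A⋆ₒ ◁₂ adj (triang B) ▷₂ C⋆ₒ) ⊚
      idc ((A⋆ₒ ◁₁ g ▷₁ C⋆ₒ) ⨾ (A⋆ₒ ◁₁ eObj C⋆ₒ))) ⬝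
    (idc ((iObj A⋆ₒ ▷₁ C⋆ₒ) ⨾ (A⋆ₒ ◁₁ f ▷₁ C⋆ₒ) ⨾ ((A⋆ₒ ⊗ₒ B) ◁₁ iObj B⋆ₒ ▷₁ C⋆ₒ)) ⊚
        (A⋆ₒ ◁₂ tensorator (eObj B⋆ₒ) g ▷₂ C⋆ₒ) ⊚ idc (A⋆ₒ ◁₁ eObj C⋆ₒ)) ⬝
    (tensorator (iObj A⋆ₒ ⨾ (A⋆ₒ ◁₁ f)) ((iObj B⋆ₒ ▷₁ C⋆ₒ) ⨾ (B⋆ₒ ◁₁ g ▷₁ C⋆ₒ)) ⊚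
        idc ((A⋆ₒ ◁₁ eObj B⋆ₒ ▷₁ (C ⊗ₒ C⋆ₒ)) ⨾ (A⋆ₒ ◁₁ eObj C⋆ₒ))) ⬝
    (idc ((iObj B⋆ₒ ▷₁ C⋆ₒ) ⨾ (B⋆ₒ ◁₁ g ▷₁ C⋆ₒ)) ⊚
        tensorator ((iObj A⋆ₒ ▷₁ B⋆ₒ) ⨾ (A⋆ₒ ◁₁ f ▷₁ B⋆ₒ) ⨾ (A⋆ₒ ◁₁ eObj B⋆ₒ)) (eObj C⋆ₒ))

/-- The canonical 2-isomorphism `(fg)# ⇒ g# f#`; `(triang B)⋆₂` is the inverse of `triang B`. -/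
def rsharpComp (f g : Mor O) : Cell O :=
  let A := dom f
  let B := cod f
  let C := cod g
  (idc ((C⋆ₒ ◁₁ iObj A) ⨾ (C⋆ₒ ◁₁ f ▷₁ A⋆ₒ)) ⊚ (C⋆ₒ ◁₂ (triang B)⋆₂ ▷₂ A⋆ₒ) ⊚
      idc ((C⋆ₒ ◁₁ g ▷₁ A⋆ₒ) ⨾ (eObj C ▷₁ A⋆ₒ))) ⬝
    (idc ((C⋆ₒ ◁₁ iObj A) ⨾ (C⋆ₒ ◁₁ f ▷₁ A⋆ₒ) ⨾ (C⋆ₒ ◁₁ iObj B ▷₁ (B ⊗ₒ A⋆ₒ))) ⊚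
        (C⋆ₒ ◁₂ tensoratorInv g (eObj B) ▷₂ A⋆ₒ) ⊚ idc (eObj C ▷₁ A⋆ₒ)) ⬝
    (tensoratorInv ((C⋆ₒ ◁₁ iObj B) ⨾ (C⋆ₒ ◁₁ g ▷₁ B⋆ₒ)) (iObj A ⨾ (f ▷₁ A⋆ₒ)) ⊚
        idc (((C⋆ₒ ⊗ₒ C) ◁₁ eObj B ▷₁ A⋆ₒ) ⨾ (eObj C ▷₁ A⋆ₒ))) ⬝
    (idc ((C⋆ₒ ◁₁ iObj B) ⨾ (C⋆ₒ ◁₁ g ▷₁ B⋆ₒ)) ⊚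
        tensoratorInv (eObj C) ((B⋆ₒ ◁₁ iObj A) ⨾ (B⋆ₒ ◁₁ f ▷₁ A⋆ₒ) ⨾ (eObj B ▷₁ A⋆ₒ)))

end

/-- The family of 2-morphisms `piv f : #f ⇒ f#` of a pivotal 2-category. -/
class PivotalData (O : Type u) [TwoCatData.{u, v, w} O] where
  piv : Mor O → Cell O

open PivotalData

/-- Semi-strict pivotal 2-categories. -/
class Pivotal (O : Type u) [TwoCatData.{u, v, w} O] [MonoidalData O] [DualData O] [PivotalData O] :
    Prop extends SemistrictMonoidalDuals O where
  src_piv : ∀ f : Mor O, src (piv f) = lsharp f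
  tgt_piv : ∀ f : Mor O, tgt (piv f) = rsharp f
  piv_unitary : ∀ f : Mor O, IsUnitary (piv f)
  piv_natural : ∀ α : Cell O, lsharpCell α ⬝ piv (tgt α) = piv (src α) ⬝ rsharpCell α
  adj_piv : ∀ f : Mor O, adj (piv f) = piv f⋆₁
  piv_comp : ∀ f g : Mor O, cod f = dom g →
    piv (f ⨾ g) ⬝ rsharpComp f g = lsharpComp f g ⬝ (piv g ⊚ piv f)
  lsharp_adj : ∀ α : Cell O, lsharpCell (adj α) = adjL (rsharpCell α)
  adj_lsharp : ∀ α : Cell O, adj (lsharpCell α) = rsharpCell (adjL α)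

section
variable {O : Type u} [TwoCatData.{u, v, w} O] [MonoidalData O] [DualData O]

/-- Left trace of a 1-morphism `f : A → A`. -/
def trL (f : Mor O) : Mor O := iObj (dom f)⋆ₒ ⨾ ((dom f)⋆ₒ ◁₁ f) ⨾ eObj (dom f)

/-- Right trace of a 1-morphism `f : A → A`. -/
def trR (f : Mor O) : Mor O := iObj (dom f) ⨾ (f ▷₁ (dom f)⋆ₒ) ⨾ eObj (dom f)⋆ₒ

/-- Left trace of a 2-morphism between endomorphisms of `A`. -/
def trLCell (α : Cell O) : Cell O :=
  idc (iObj (dom (src α))⋆ₒ) ⊚ ((dom (src α))⋆ₒ ◁₂ α) ⊚ idc (eObj (dom (src α)))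

/-- Right trace of a 2-morphism between endomorphisms of `A`. -/
def trRCell (α : Cell O) : Cell O :=
  idc (iObj (dom (src α))) ⊚ (α ▷₂ (dom (src α))⋆ₒ) ⊚ idc (eObj (dom (src α))⋆ₒ)

/-- The right cap `1_I ⇒ Tr_R(ff*)`. -/
def capR (f : Mor O) : Cell O := iMor (iObj (dom f) ⨾ (f ▷₁ (dom f)⋆ₒ))

/-- The right cup `Tr_R(ff*) ⇒ 1_I`. -/
def cupR (f : Mor O) : Cell O := (capR f)⋆₂

/-- The left cap `1_I ⇒ Tr_L(ff*)`. -/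
def capL (f : Mor O) : Cell O := iMor (iObj (dom f)⋆ₒ ⨾ ((dom f)⋆ₒ ◁₁ f))

/-- The left cup `Tr_L(ff*) ⇒ 1_I`. -/
def cupL (f : Mor O) : Cell O := (capL f)⋆₂

/-- The underlying 2-morphism `1_I ⇒ 1_I` of the pairing of `α : f ⇒ g` and `β : g ⇒ f`. -/
def pairingCell (α β : Cell O) : Cell O :=
  capR (src α) ⬝ trRCell ((α ⬝ β) ⊚ idc (src α)⋆₁) ⬝ cupR (src α)

end

section
variable {O : Type u} [TwoCatData.{u, v, w} O] [MonoidalData O] [DualData O] [PivotalData O]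

/-- The canonical 2-isomorphism `Tr_R(fg) ⇒ Tr_R(gf)`, for `f : A → B` and `g : B → A`. -/
def thetaR (f g : Mor O) : Cell O :=
  let A := dom f
  let B := cod f
  (idc (iObj A ⨾ (f ▷₁ A⋆ₒ)) ⊚ (adj (triang B) ▷₂ A⋆ₒ) ⊚ idc ((g ▷₁ A⋆ₒ) ⨾ eObj A⋆ₒ)) ⬝
    (idc (iObj A ⨾ (f ▷₁ A⋆ₒ) ⨾ (B ◁₁ iObj B⋆ₒ ▷₁ A⋆ₒ)) ⊚
        tensorator (eObj B⋆ₒ) ((g ▷₁ A⋆ₒ) ⨾ eObj A⋆ₒ)) ⬝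
    (idc (iObj A ⨾ (f ▷₁ A⋆ₒ)) ⊚ (B ◁₂ piv g) ⊚ idc (eObj B⋆ₒ)) ⬝
    (tensorator (iObj A ⨾ (f ▷₁ A⋆ₒ)) (iObj B ⨾ (g ▷₁ B⋆ₒ)) ⊚
        idc ((B ◁₁ eObj A ▷₁ B⋆ₒ) ⨾ eObj B⋆ₒ)) ⬝
    (idc (iObj B ⨾ (g ▷₁ B⋆ₒ) ⨾ (iObj A ▷₁ (A ⊗ₒ B⋆ₒ))) ⊚ (tensorator f (eObj A) ▷₂ B⋆ₒ) ⊚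
        idc (eObj B⋆ₒ)) ⬝
    (idc (iObj B ⨾ (g ▷₁ B⋆ₒ)) ⊚ (triang A ▷₂ B⋆ₒ) ⊚ idc ((f ▷₁ B⋆ₒ) ⨾ eObj B⋆ₒ))

/-- The canonical 2-isomorphism `Tr_L(fg) ⇒ Tr_L(gf)`, for `f : A → B` and `g : B → A`: the mirror
image of `thetaR`.  Reversing the tensor product exchanges `iObj A` with `iObj A⋆ₒ`, `eObj A` with
`eObj A⋆ₒ`, `f#` with `#f`, `tensorator f g` with `tensoratorInv g f`, and `triang A` with the
inverse of `adj (triang A)`; the duals of the unitary 2-morphisms `triang B`, `piv g` and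
`adj (triang A)` are their inverses. -/
def thetaL (f g : Mor O) : Cell O :=
  let A := dom f
  let B := cod f
  (idc (iObj A⋆ₒ ⨾ (A⋆ₒ ◁₁ f)) ⊚ (A⋆ₒ ◁₂ (triang B)⋆₂) ⊚ idc ((A⋆ₒ ◁₁ g) ⨾ eObj A)) ⬝
    (idc (iObj A⋆ₒ ⨾ (A⋆ₒ ◁₁ f) ⨾ (A⋆ₒ ◁₁ iObj B ▷₁ B)) ⊚
        tensoratorInv ((A⋆ₒ ◁₁ g) ⨾ eObj A) (eObj B)) ⬝
    (idc (iObj A⋆ₒ ⨾ (A⋆ₒ ◁₁ f)) ⊚ ((piv g)⋆₂ ▷₂ B) ⊚ idc (eObj B)) ⬝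
    (tensoratorInv (iObj B⋆ₒ ⨾ (B⋆ₒ ◁₁ g)) (iObj A⋆ₒ ⨾ (A⋆ₒ ◁₁ f)) ⊚
        idc ((B⋆ₒ ◁₁ eObj A⋆ₒ ▷₁ B) ⨾ eObj B)) ⬝
    (idc (iObj B⋆ₒ ⨾ (B⋆ₒ ◁₁ g) ⨾ ((B⋆ₒ ⊗ₒ A) ◁₁ iObj A⋆ₒ)) ⊚
        (B⋆ₒ ◁₂ tensoratorInv (eObj A⋆ₒ) f) ⊚ idc (eObj B)) ⬝
    (idc (iObj B⋆ₒ ⨾ (B⋆ₒ ◁₁ g)) ⊚ (B⋆ₒ ◁₂ (adj (triang A))⋆₂) ⊚ idc ((B⋆ₒ ◁₁ f) ⨾ eObj B))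

end

/-- Semi-strict consistent pivotal 2-categories. -/
class ConsistentPivotal (O : Type u) [TwoCatData.{u, v, w} O] [MonoidalData O] [DualData O]
    [PivotalData O] : Prop extends Pivotal O where
  capR_theta : ∀ f : Mor O, capR f ⬝ thetaR f f⋆₁ = capR f⋆₁
  theta_cupR : ∀ f : Mor O, thetaR f f⋆₁ ⬝ cupR f⋆₁ = cupR f
  capL_theta : ∀ f : Mor O, capL f ⬝ thetaL f f⋆₁ = capL f⋆₁
  theta_cupL : ∀ f : Mor O, thetaL f f⋆₁ ⬝ cupL f⋆₁ = cupL f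

/-- The family of 2-morphisms `sph f : Tr_L(f) ⇒ Tr_R(f)` of a spherical 2-category; only its
values on endomorphisms matter. -/
class SphericalData (O : Type u) [TwoCatData.{u, v, w} O] where
  sph : Mor O → Cell O

open SphericalData

/-- Semi-strict spherical 2-categories. -/
class SphericalTwoCategory (O : Type u) [TwoCatData.{u, v, w} O] [MonoidalData O] [DualData O]
    [PivotalData O] [SphericalData O] : Prop extends ConsistentPivotal O where
  src_sph : ∀ f : Mor O, dom f = cod f → src (sph f) = trL f
  tgt_sph : ∀ f : Mor O, dom f = cod f → tgt (sph f) = trR f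
  sph_unitary : ∀ f : Mor O, dom f = cod f → IsUnitary (sph f)
  sph_natural : ∀ α : Cell O, dom (src α) = cod (src α) →
    sph (src α) ⬝ trRCell α = trLCell α ⬝ sph (tgt α)
  capL_sph : ∀ A : O, capL (one A) ⬝ sph (one A) = capR (one A)
  sph_cupR : ∀ A : O, sph (one A) ⬝ cupR (one A) = cupL (one A)

/-! ### Hom-categories -/

section
variable {O : Type u}

/-- The 1-morphisms `A → B`. -/
@[ext] structure Hom [TwoCatData.{u, v, w} O] (A B : O) : Type v where
  mor : Mor O
  dom_eq : dom mor = A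
  cod_eq : cod mor = B

/-- The 2-morphisms `f ⇒ g` between parallel 1-morphisms. -/
@[ext] structure Hom2 [TwoCatData.{u, v, w} O] {A B : O} (f g : Hom A B) : Type w where
  cell : Cell O
  src_eq : src cell = f.mor
  tgt_eq : tgt cell = g.mor

variable [TwoCatData.{u, v, w} O] [MonoidalData O] [SemistrictMonoidal O]

namespace Hom
variable {A B C X Y : O}

theorem composable (f : Hom A B) (g : Hom B C) : cod f.mor = dom g.mor :=
  f.cod_eq.trans g.dom_eq.symm

def id (A : O) : Hom A A where
  mor := one A
  dom_eq := StrictTwoCategory.dom_one A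
  cod_eq := StrictTwoCategory.cod_one A

def comp (f : Hom A B) (g : Hom B C) : Hom A C where
  mor := f.mor ⨾ g.mor
  dom_eq := (StrictTwoCategory.dom_comp _ _ (f.composable g)).trans f.dom_eq
  cod_eq := (StrictTwoCategory.cod_comp _ _ (f.composable g)).trans g.cod_eq

/-- `X ⊗ f`. -/
def lten (X : O) (f : Hom A B) : Hom (X ⊗ₒ A) (X ⊗ₒ B) where
  mor := X ◁₁ f.mor
  dom_eq := by rw [SemistrictMonoidal.dom_lMor, f.dom_eq]
  cod_eq := by rw [SemistrictMonoidal.cod_lMor, f.cod_eq]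

/-- `f ⊗ X`. -/
def rten (f : Hom A B) (X : O) : Hom (A ⊗ₒ X) (B ⊗ₒ X) where
  mor := f.mor ▷₁ X
  dom_eq := by rw [SemistrictMonoidal.dom_rMor, f.dom_eq]
  cod_eq := by rw [SemistrictMonoidal.cod_rMor, f.cod_eq]

/-- The same 1-morphism, with its source and target rewritten along equalities. -/
def cast (f : Hom A B) (hA : A = X) (hB : B = Y) : Hom X Y where
  mor := f.mor
  dom_eq := f.dom_eq.trans hA
  cod_eq := f.cod_eq.trans hB

end Hom

namespace Hom2
variable {A B C A' B' : O}

def id (f : Hom A B) : Hom2 f f where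
  cell := idc f.mor
  src_eq := StrictTwoCategory.src_idc _
  tgt_eq := StrictTwoCategory.tgt_idc _

def vcomp {f g h : Hom A B} (α : Hom2 f g) (β : Hom2 g h) : Hom2 f h where
  cell := α.cell ⬝ β.cell
  src_eq := by rw [StrictTwoCategory.src_vcomp _ _ (α.tgt_eq.trans β.src_eq.symm), α.src_eq]
  tgt_eq := by rw [StrictTwoCategory.tgt_vcomp _ _ (α.tgt_eq.trans β.src_eq.symm), β.tgt_eq]

theorem composable {f g : Hom A B} {h k : Hom B C} (α : Hom2 f g) (β : Hom2 h k) :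
    cod (src α.cell) = dom (src β.cell) := by
  rw [α.src_eq, β.src_eq, f.cod_eq, h.dom_eq]

def hcomp {f g : Hom A B} {h k : Hom B C} (α : Hom2 f g) (β : Hom2 h k) :
    Hom2 (f.comp h) (g.comp k) where
  cell := α.cell ⊚ β.cell
  src_eq := by rw [StrictTwoCategory.src_hcomp _ _ (composable α β), α.src_eq, β.src_eq]; rfl
  tgt_eq := by rw [StrictTwoCategory.tgt_hcomp _ _ (composable α β), α.tgt_eq, β.tgt_eq]; rfl

/-- `X ⊗ α`. -/
def lten {f g : Hom A B} (X : O) (α : Hom2 f g) : Hom2 (f.lten X) (g.lten X) where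
  cell := X ◁₂ α.cell
  src_eq := by rw [SemistrictMonoidal.src_lCell, α.src_eq]; rfl
  tgt_eq := by rw [SemistrictMonoidal.tgt_lCell, α.tgt_eq]; rfl

/-- `α ⊗ X`. -/
def rten {f g : Hom A B} (α : Hom2 f g) (X : O) : Hom2 (f.rten X) (g.rten X) where
  cell := α.cell ▷₂ X
  src_eq := by rw [SemistrictMonoidal.src_rCell, α.src_eq]; rfl
  tgt_eq := by rw [SemistrictMonoidal.tgt_rCell, α.tgt_eq]; rfl

/-- The same 2-morphism, with its source and target rewritten along equalities. -/
def cast {f g : Hom A B} {f' g' : Hom A' B'} (α : Hom2 f g) (hf : f.mor = f'.mor)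
    (hg : g.mor = g'.mor) : Hom2 f' g' where
  cell := α.cell
  src_eq := α.src_eq.trans hf
  tgt_eq := α.tgt_eq.trans hg

end Hom2
end

/-! ### Linear structure, semi-simplicity -/

/-- The 2-morphisms between any two parallel 1-morphisms form an abelian group. -/
class Preadditive2 (O : Type u) [TwoCatData.{u, v, w} O]
    [MonoidalData O] [SemistrictMonoidal O] where
  addCommGroup : ∀ {A B : O} (f g : Hom A B), AddCommGroup (Hom2 f g)

attribute [reducible, instance] Preadditive2.addCommGroup

section
variable {O : Type u} [TwoCatData.{u, v, w} O] [MonoidalData O] [SemistrictMonoidal O] [Preadditive2 O]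

/-- `h` is a direct sum of the 1-morphisms `s 0, …, s (n-1)` in the category `Hom(A,B)`. -/
def IsDirectSum {A B : O} (h : Hom A B) {n : ℕ} (s : Fin n → Hom A B) : Prop :=
  ∃ (inj : ∀ k, Hom2 (s k) h) (proj : ∀ k, Hom2 h (s k)),
    (∀ k, (inj k).vcomp (proj k) = Hom2.id (s k)) ∧
    (∀ k l, k ≠ l → (inj k).vcomp (proj l) = 0) ∧
    ∑ k, (proj k).vcomp (inj k) = Hom2.id h

/-- `S` is a finite basis of simple objects of the linear category `Hom(A,B)`: distinct members of
`S` have no 2-morphisms between them, `2End(s)` is one-dimensional for `s` in `S`, and every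
1-morphism `A → B` is a finite direct sum of members of `S`. -/
structure IsBasis (F : Type*) [Field F] [∀ {A B : O} (f g : Hom A B), Module F (Hom2 f g)]
    {A B : O} (S : Finset (Hom A B)) : Prop where
  finrank_end : ∀ s ∈ S, Module.finrank F (Hom2 s s) = 1
  eq_zero : ∀ s ∈ S, ∀ t ∈ S, s ≠ t → ∀ α : Hom2 s t, α = 0
  exists_sum : ∀ h : Hom A B, ∃ (n : ℕ) (s : Fin n → Hom A B), (∀ k, s k ∈ S) ∧ IsDirectSum h s

end

/-- `Vect`-linear semi-strict monoidal 2-categories over the field `F`: each `Hom(A,B)` is an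
`F`-linear category with finite dimensional spaces of 2-morphisms, with finite direct sums and with
a finite basis of simple objects, i.e. a 2-vector space of finite rank (a linear category equivalent
to `Vect^n`), and composition and tensor product are bilinear.  Moreover `End(I)` is equivalent to
`Vect` (it has a one-element basis) and `2End(1_I) = F`. -/
class VectLinear (F : Type*) [Field F] (O : Type u) [TwoCatData.{u, v, w} O]
    [MonoidalData O] [SemistrictMonoidal O]
    [Preadditive2 O] where
  module : ∀ {A B : O} (f g : Hom A B), Module F (Hom2 f g)
  finite : ∀ {A B : O} (f g : Hom A B), Module.Finite F (Hom2 f g)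
  add_vcomp : ∀ {A B : O} {f g h : Hom A B} (α α' : Hom2 f g) (β : Hom2 g h),
    (α + α').vcomp β = α.vcomp β + α'.vcomp β
  smul_vcomp : ∀ {A B : O} {f g h : Hom A B} (c : F) (α : Hom2 f g) (β : Hom2 g h),
    (c • α).vcomp β = c • α.vcomp β
  vcomp_add : ∀ {A B : O} {f g h : Hom A B} (α : Hom2 f g) (β β' : Hom2 g h),
    α.vcomp (β + β') = α.vcomp β + α.vcomp β'
  vcomp_smul : ∀ {A B : O} {f g h : Hom A B} (c : F) (α : Hom2 f g) (β : Hom2 g h),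
    α.vcomp (c • β) = c • α.vcomp β
  add_hcomp : ∀ {A B C : O} {f g : Hom A B} {h k : Hom B C} (α α' : Hom2 f g) (β : Hom2 h k),
    (α + α').hcomp β = α.hcomp β + α'.hcomp β
  smul_hcomp : ∀ {A B C : O} {f g : Hom A B} {h k : Hom B C} (c : F) (α : Hom2 f g)
    (β : Hom2 h k), (c • α).hcomp β = c • α.hcomp β
  hcomp_add : ∀ {A B C : O} {f g : Hom A B} {h k : Hom B C} (α : Hom2 f g) (β β' : Hom2 h k),
    α.hcomp (β + β') = α.hcomp β + α.hcomp β'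
  hcomp_smul : ∀ {A B C : O} {f g : Hom A B} {h k : Hom B C} (c : F) (α : Hom2 f g)
    (β : Hom2 h k), α.hcomp (c • β) = c • α.hcomp β
  lten_add : ∀ {A B : O} {f g : Hom A B} (X : O) (α α' : Hom2 f g),
    (α + α').lten X = α.lten X + α'.lten X
  lten_smul : ∀ {A B : O} {f g : Hom A B} (X : O) (c : F) (α : Hom2 f g),
    (c • α).lten X = c • α.lten X
  rten_add : ∀ {A B : O} {f g : Hom A B} (X : O) (α α' : Hom2 f g),
    (α + α').rten X = α.rten X + α'.rten X
  rten_smul : ∀ {A B : O} {f g : Hom A B} (X : O) (c : F) (α : Hom2 f g),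
    (c • α).rten X = c • α.rten X
  exists_directSum : ∀ {A B : O} {n : ℕ} (s : Fin n → Hom A B), ∃ h : Hom A B, IsDirectSum h s
  exists_basis : ∀ A B : O, ∃ S : Finset (Hom A B), IsBasis F S
  end_unit : ∃ s : Hom (unit : O) unit, IsBasis F {s}
  end_one_unit : Function.Bijective fun c : F => c • Hom2.id (Hom.id (unit : O))

attribute [reducible, instance] VectLinear.module
attribute [instance] VectLinear.finite

section
variable (F : Type*) [Field F] {O : Type u} [TwoCatData.{u, v, w} O] [MonoidalData O] [SemistrictMonoidal O] [Preadditive2 O]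
  [VectLinear F O]

/-- Vertical composition as a bilinear map. -/
def vcompL {A B : O} (f g h : Hom A B) : Hom2 f g →ₗ[F] Hom2 g h →ₗ[F] Hom2 f h :=
  LinearMap.mk₂ F (fun α β => α.vcomp β) (VectLinear.add_vcomp F) VectLinear.smul_vcomp
    (VectLinear.vcomp_add F) VectLinear.vcomp_smul

/-- Horizontal composition as a bilinear map. -/
def hcompL {A B C : O} (f g : Hom A B) (h k : Hom B C) :
    Hom2 f g →ₗ[F] Hom2 h k →ₗ[F] Hom2 (f.comp h) (g.comp k) :=
  LinearMap.mk₂ F (fun α β => α.hcomp β) (VectLinear.add_hcomp F) VectLinear.smul_hcomp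
    (VectLinear.hcomp_add F) VectLinear.hcomp_smul

def ltenL {A B : O} (X : O) (f g : Hom A B) : Hom2 f g →ₗ[F] Hom2 (f.lten X) (g.lten X) where
  toFun α := α.lten X
  map_add' := VectLinear.lten_add (F := F) X
  map_smul' := VectLinear.lten_smul X

def rtenL {A B : O} (f g : Hom A B) (X : O) : Hom2 f g →ₗ[F] Hom2 (f.rten X) (g.rten X) where
  toFun α := α.rten X
  map_add' := VectLinear.rten_add (F := F) X
  map_smul' := VectLinear.rten_smul X

variable {F} in
theorem cast_linear {A B A' B' : O} {f g : Hom A B} {f' g' : Hom A' B'} (hf : f.mor = f'.mor)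
    (hg : g.mor = g'.mor) : IsLinearMap F fun α : Hom2 f g => (α.cast hf hg : Hom2 f' g') := by
  obtain rfl : A = A' := by rw [← f.dom_eq, hf, f'.dom_eq]
  obtain rfl : B = B' := by rw [← f.cod_eq, hf, f'.cod_eq]
  obtain rfl : f = f' := Hom.ext hf
  obtain rfl : g = g' := Hom.ext hg
  exact ⟨fun _ _ => rfl, fun _ _ => rfl⟩

/-- `Hom2.cast` as a linear map. -/
def castL {A B A' B' : O} {f g : Hom A B} {f' g' : Hom A' B'} (hf : f.mor = f'.mor)
    (hg : g.mor = g'.mor) : Hom2 f g →ₗ[F] Hom2 f' g' :=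
  (cast_linear hf hg).mk'

/-- `2End(1_I) ≃ F`. -/
noncomputable def scalar : Hom2 (Hom.id (unit : O)) (Hom.id unit) ≃ₗ[F] F :=
  (LinearEquiv.ofBijective (LinearMap.toSpanSingleton F _ (Hom2.id (Hom.id (unit : O))))
    VectLinear.end_one_unit).symm

/-- The objects `X` and `Y` are equivalent. -/
def Equivalent (X Y : O) : Prop :=
  ∃ (f : Hom X Y) (g : Hom Y X),
    (∃ (a : Hom2 (f.comp g) (Hom.id X)) (b : Hom2 (Hom.id X) (f.comp g)),
      a.vcomp b = Hom2.id _ ∧ b.vcomp a = Hom2.id _) ∧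
    (∃ (a : Hom2 (g.comp f) (Hom.id Y)) (b : Hom2 (Hom.id Y) (g.comp f)),
      a.vcomp b = Hom2.id _ ∧ b.vcomp a = Hom2.id _)

/-- Finite (horizontal) semi-simplicity, with respect to the finite set `E` of non-zero, pairwise
non-equivalent objects: for all `A`, `B` the composition functor from
`⨁_{X ∈ E} Hom(A,X) ⊗ Hom(X,B)` to `Hom(A,B)` is an equivalence.  In the category
`Hom(A,X) ⊗ Hom(X,B)` the space of morphisms from `f ⊗ g` to `f' ⊗ g'` is
`2Hom(f,f') ⊗ 2Hom(g,g')`, every object is a direct sum of such `f ⊗ g`, and there are no non-zero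
morphisms between the summands for different `X`; so the functor is an equivalence when it is fully
faithful on these objects and every 1-morphism `A → B` is a direct sum of composites `fg`. -/
structure FinitelySemisimple (E : Finset O) : Prop where
  nonzero : ∀ X ∈ E, ∃ f : Hom X X, Hom2.id f ≠ 0
  nonequivalent : ∀ X ∈ E, ∀ Y ∈ E, X ≠ Y → ¬ Equivalent X Y
  bijective : ∀ X ∈ E, ∀ (A B : O) (f f' : Hom A X) (g g' : Hom X B),
    Function.Bijective (TensorProduct.lift (hcompL F f f' g g'))
  eq_zero : ∀ X ∈ E, ∀ Y ∈ E, X ≠ Y → ∀ (A B : O) (f : Hom A X) (g : Hom X B) (f' : Hom A Y)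
    (g' : Hom Y B) (α : Hom2 (f.comp g) (f'.comp g')), α = 0
  exists_sum : ∀ (A B : O) (h : Hom A B), ∃ (n : ℕ) (s : Fin n → Hom A B),
    (∀ k, ∃ X ∈ E, ∃ (f : Hom A X) (g : Hom X B), s k = f.comp g) ∧ IsDirectSum h s

end

/-! ### The pairing and quantum dimensions -/

section
variable {O : Type u} [TwoCatData.{u, v, w} O] [MonoidalData O] [DualData O]
  [SemistrictMonoidalDuals O]

/-- `f*`. -/
def Hom.dual {A B : O} (f : Hom A B) : Hom B A where
  mor := f.mor⋆₁
  dom_eq := (SemistrictMonoidalDuals.dom_dualMor _).trans f.cod_eq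
  cod_eq := (SemistrictMonoidalDuals.cod_dualMor _).trans f.dom_eq

/-- `i_A : I → A ⊗ A*`. -/
def iHom (A : O) : Hom unit (A ⊗ₒ A⋆ₒ) where
  mor := iObj A
  dom_eq := SemistrictMonoidalDuals.dom_iObj A
  cod_eq := SemistrictMonoidalDuals.cod_iObj A

/-- `e_{A*} : A ⊗ A* → I`. -/
def eHom (A : O) : Hom (A ⊗ₒ A⋆ₒ) unit where
  mor := eObj A⋆ₒ
  dom_eq := by rw [SemistrictMonoidalDuals.dom_eObj, SemistrictMonoidalDuals.dualObj_dualObj]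
  cod_eq := SemistrictMonoidalDuals.cod_eObj _

/-- `Tr_R(ff*)`. -/
def trHom {A B : O} (f : Hom A B) : Hom (unit : O) unit :=
  ((iHom A).comp ((f.comp f.dual).rten A⋆ₒ)).comp (eHom A)

theorem trHom_eq {A B : O} (f : Hom A B) :
    (iObj A ⨾ (f.mor ▷₁ A⋆ₒ)) ⨾ (iObj A ⨾ (f.mor ▷₁ A⋆ₒ))⋆₁ = (trHom f).mor := by
  have h1 : cod (iObj A) = dom (f.mor ▷₁ A⋆ₒ) := (iHom A).composable (f.rten A⋆ₒ)
  have h2 : cod f.mor = dom f.mor⋆₁ := f.composable f.dual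
  have h3 := (f.rten A⋆ₒ).composable (f.dual.rten A⋆ₒ)
  have h4 := (f.dual.rten A⋆ₒ).composable (eHom A)
  have h5 := (iHom A).composable ((f.rten A⋆ₒ).comp (f.dual.rten A⋆ₒ))
  have h6 := ((f.rten A⋆ₒ).comp (f.dual.rten A⋆ₒ)).composable (eHom A)
  have h7 := (f.rten A⋆ₒ).composable ((f.dual.rten A⋆ₒ).comp (eHom A))
  simp only [Hom.comp, Hom.rten, Hom.dual, iHom, eHom, trHom] at *
  rw [SemistrictMonoidalDuals.dualMor_comp _ _ h1, SemistrictMonoidalDuals.dualMor_rMor,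
    ← SemistrictMonoidalDuals.eObj_dual, SemistrictMonoidal.rMor_comp _ _ _ h2,
    StrictTwoCategory.comp_assoc _ _ _ h5 h6, StrictTwoCategory.comp_assoc _ _ _ h1 h7,
    StrictTwoCategory.comp_assoc _ _ _ h3 h4]

/-- The cap `1_I ⇒ Tr_R(ff*)`. -/
def capHom {A B : O} (f : Hom A B) : Hom2 (Hom.id unit) (trHom f) where
  cell := capR f.mor
  src_eq := by
    rw [capR, SemistrictMonoidalDuals.src_iMor, f.dom_eq]
    exact congrArg one ((iHom A).comp (f.rten A⋆ₒ)).dom_eq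
  tgt_eq := by rw [capR, SemistrictMonoidalDuals.tgt_iMor, f.dom_eq, trHom_eq]

/-- The cup `Tr_R(ff*) ⇒ 1_I`. -/
def cupHom {A B : O} (f : Hom A B) : Hom2 (trHom f) (Hom.id unit) where
  cell := cupR f.mor
  src_eq := (SemistrictMonoidalDuals.src_dualCell _).trans (capHom f).tgt_eq
  tgt_eq := (SemistrictMonoidalDuals.tgt_dualCell _).trans (capHom f).src_eq

variable (F : Type*) [Field F] [Preadditive2 O] [VectLinear F O]

/-- The pairing `⟨α,β⟩ = cap_f · Tr_R((α·β) ∘ 1_{f*}) · cup_f` of `α : f ⇒ g` and `β : g ⇒ f`, as a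
bilinear map with values in `F = 2End(1_I)`. -/
noncomputable def pairing {A B : O} (f g : Hom A B) : Hom2 f g →ₗ[F] Hom2 g f →ₗ[F] F :=
  (vcompL F f g f).compr₂
    ((scalar F).toLinearMap ∘ₗ
      (vcompL F _ _ _).flip (cupHom f) ∘ₗ
      vcompL F _ _ _ (capHom f) ∘ₗ
      (hcompL F _ _ _ _).flip (Hom2.id (eHom A)) ∘ₗ
      hcompL F _ _ _ _ (Hom2.id (iHom A)) ∘ₗ
      rtenL F _ _ A⋆ₒ ∘ₗ
      (hcompL F _ _ _ _).flip (Hom2.id f.dual))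

/-- The pairing is the one given by the explicit formula `pairingCell`. -/
theorem pairing_eq {A B : O} (f g : Hom A B) (α : Hom2 f g) (β : Hom2 g f) :
    ((scalar F).symm (pairing F f g α β)).cell = pairingCell α.cell β.cell := by
  have e : (scalar F).symm (pairing F f g α β) =
      ((capHom f).vcomp (((Hom2.id (iHom A)).hcomp
        (((α.vcomp β).hcomp (Hom2.id f.dual)).rten A⋆ₒ)).hcomp (Hom2.id (eHom A)))).vcomp
          (cupHom f) := by
    rw [LinearEquiv.symm_apply_eq]; rfl
  have hA : dom (src ((α.vcomp β).hcomp (Hom2.id f.dual)).cell) = A := by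
    rw [((α.vcomp β).hcomp (Hom2.id f.dual)).src_eq, (f.comp f.dual).dom_eq]
  simp only [Hom2.hcomp, Hom2.vcomp, Hom2.id, Hom.dual] at hA
  rw [e]
  simp only [pairingCell, trRCell, α.src_eq, hA]
  rfl

/-- The quantum dimension of an object. -/
noncomputable def dimObj (A : O) : F :=
  pairing F (Hom.id A) (Hom.id A) (Hom2.id _) (Hom2.id _)

/-- The quantum dimension of a 1-morphism. -/
noncomputable def dimMor {A B : O} (f : Hom A B) : F :=
  pairing F f f (Hom2.id _) (Hom2.id _)

/-- Non-degeneracy of the pairing. -/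
class NonDegenerate (F : Type*) [Field F] (O : Type u) [TwoCatData.{u, v, w} O] [MonoidalData O]
    [DualData O] [SemistrictMonoidalDuals O] [Preadditive2 O] [VectLinear F O] : Prop where
  nondegenerate : ∀ {A B : O} (f g : Hom A B), (pairing F f g).Nondegenerate

instance [NonDegenerate F O] {A B : O} (f g : Hom A B) : (pairing F f g).IsPerfPair :=
  LinearMap.IsPerfPair.of_injective
    (LinearMap.ker_eq_bot.mp (LinearMap.separatingLeft_iff_ker_eq_bot.mp
      (NonDegenerate.nondegenerate f g).1))
    (LinearMap.ker_eq_bot.mp (LinearMap.separatingRight_iff_flip_ker_eq_bot.mp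
      (NonDegenerate.nondegenerate f g).2))

/-- The identification `2Hom(f,g) = 2Hom(g,f)*` given by the pairing. -/
noncomputable def dualEquiv [NonDegenerate F O] {A B : O} (f g : Hom A B) :
    Hom2 f g ≃ₗ[F] Module.Dual F (Hom2 g f) :=
  (pairing F f g).toPerfPair

end

/-! ### State spaces and partition functions

Throughout, `ei j` stands for the label `e_{ij} : O` of an edge and `fijk` for the label
`f_{ijk} : e_{ik} → e_{jk} ⊗ e_{ij}` of a triangle. -/

section
variable {O : Type u} [TwoCatData.{u, v, w} O] [MonoidalData O] [SemistrictMonoidal O]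

/-- `f_{(ijk)l} = f_{ikl} (e_{kl} ⊗ f_{ijk})`. -/
def lComp {eij eik eil ejk ekl : O} (fijk : Hom eik (ejk ⊗ₒ eij)) (fikl : Hom eil (ekl ⊗ₒ eik)) :
    Hom eil (ekl ⊗ₒ ejk ⊗ₒ eij) :=
  fikl.comp (fijk.lten ekl)

/-- `f_{i(jkl)} = f_{ijl} (f_{jkl} ⊗ e_{ij})`. -/
def rComp {eij eil ejk ejl ekl : O} (fijl : Hom eil (ejl ⊗ₒ eij)) (fjkl : Hom ejl (ekl ⊗ₒ ejk)) :
    Hom eil (ekl ⊗ₒ ejk ⊗ₒ eij) :=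
  (fijl.comp (fjkl.rten eij)).cast rfl (SemistrictMonoidal.tensor_assoc _ _ _)

/-- `f_{((ijk)l)m} = f_{ilm} (e_{lm} ⊗ f_{ikl}) (e_{lm} ⊗ e_{kl} ⊗ f_{ijk})`. -/
def lComp₄ {eij eik eil eim ejk ekl elm : O} (fijk : Hom eik (ejk ⊗ₒ eij))
    (fikl : Hom eil (ekl ⊗ₒ eik)) (film : Hom eim (elm ⊗ₒ eil)) :
    Hom eim (elm ⊗ₒ ekl ⊗ₒ ejk ⊗ₒ eij) :=
  (lComp fikl film).comp ((fijk.lten ekl).lten elm)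

/-- `f_{i(j(klm))} = f_{ijm} (f_{jkm} ⊗ e_{ij}) (f_{klm} ⊗ e_{jk} ⊗ e_{ij})`. -/
def rComp₄ {eij eim ejk ejm ekl ekm elm : O} (fijm : Hom eim (ejm ⊗ₒ eij))
    (fjkm : Hom ejm (ekm ⊗ₒ ejk)) (fklm : Hom ekm (elm ⊗ₒ ekl)) :
    Hom eim (elm ⊗ₒ ekl ⊗ₒ ejk ⊗ₒ eij) :=
  ((rComp fijm fjkm).comp (fklm.rten (ejk ⊗ₒ eij))).cast rfl
    (SemistrictMonoidal.tensor_assoc _ _ _)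

/-- The state space `2H(ijkl) = 2Hom(f_{(ijk)l}, f_{i(jkl)})` of a labelled tetrahedron. -/
abbrev TwoH {eij eik eil ejk ejl ekl : O} (fijk : Hom eik (ejk ⊗ₒ eij))
    (fijl : Hom eil (ejl ⊗ₒ eij)) (fikl : Hom eil (ekl ⊗ₒ eik)) (fjkl : Hom ejl (ekl ⊗ₒ ejk)) :=
  Hom2 (lComp fijk fikl) (rComp fijl fjkl)

/-- The space `2Hom(f_{i(jkl)}, f_{(ijk)l})`, identified with `2H(ijkl)*` through the pairing. -/
abbrev TwoH' {eij eik eil ejk ejl ekl : O} (fijk : Hom eik (ejk ⊗ₒ eij))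
    (fijl : Hom eil (ejl ⊗ₒ eij)) (fikl : Hom eil (ekl ⊗ₒ eik)) (fjkl : Hom ejl (ekl ⊗ₒ ejk)) :=
  Hom2 (rComp fijl fjkl) (lComp fijk fikl)

end

section
variable {O : Type u} [TwoCatData.{u, v, w} O] [MonoidalData O] [SemistrictMonoidal O]

theorem Hom.assoc_mor {A B C D : O} (f : Hom A B) (g : Hom B C) (h : Hom C D) :
    (f.mor ⨾ g.mor) ⨾ h.mor = f.mor ⨾ (g.mor ⨾ h.mor) :=
  StrictTwoCategory.comp_assoc _ _ _ (f.composable g) (g.composable h)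

theorem Hom.lten_mor {A B C : O} (X : O) (f : Hom A B) (g : Hom B C) :
    X ◁₁ (f.mor ⨾ g.mor) = (X ◁₁ f.mor) ⨾ (X ◁₁ g.mor) :=
  SemistrictMonoidal.lMor_comp _ _ _ (f.composable g)

theorem Hom.rten_mor {A B C : O} (f : Hom A B) (g : Hom B C) (X : O) :
    (f.mor ⨾ g.mor) ▷₁ X = (f.mor ▷₁ X) ⨾ (g.mor ▷₁ X) :=
  SemistrictMonoidal.rMor_comp _ _ _ (f.composable g)

/-- The tensorator `(f ⊗ C)(B ⊗ g) ⇒ (A ⊗ g)(f ⊗ D)` of `f : A → B` and `g : C → D`. -/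
def tensHom {A B C D : O} (f : Hom A B) (g : Hom C D) :
    Hom2 ((f.rten C).comp (g.lten B)) ((g.lten A).comp (f.rten D)) where
  cell := tensorator f.mor g.mor
  src_eq := by rw [SemistrictMonoidal.src_tensorator, g.dom_eq, f.cod_eq]; rfl
  tgt_eq := by rw [SemistrictMonoidal.tgt_tensorator, f.dom_eq, g.cod_eq]; rfl

/-- The inverse of the tensorator. -/
def tensInvHom {A B C D : O} (f : Hom A B) (g : Hom C D) :
    Hom2 ((g.lten A).comp (f.rten D)) ((f.rten C).comp (g.lten B)) where
  cell := tensoratorInv f.mor g.mor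
  src_eq := by rw [SemistrictMonoidal.src_tensoratorInv, f.dom_eq, g.cod_eq]; rfl
  tgt_eq := by rw [SemistrictMonoidal.tgt_tensoratorInv, g.dom_eq, f.cod_eq]; rfl

variable {eij eik eil eim ejk ejl ejm ekl ekm elm : O}

/-- `f_{ikm} (f_{klm} ⊗ e_{ik}) (e_{lm} ⊗ e_{kl} ⊗ f_{ijk})`. -/
def midL (fijk : Hom eik (ejk ⊗ₒ eij)) (fikm : Hom eim (ekm ⊗ₒ eik)) (fklm : Hom ekm (elm ⊗ₒ ekl)) :
    Hom eim (elm ⊗ₒ ekl ⊗ₒ ejk ⊗ₒ eij) :=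
  (rComp fikm fklm).comp ((fijk.lten ekl).lten elm)

/-- `f_{ikm} (e_{km} ⊗ f_{ijk}) (f_{klm} ⊗ e_{jk} ⊗ e_{ij})`. -/
def midR (fijk : Hom eik (ejk ⊗ₒ eij)) (fikm : Hom eim (ekm ⊗ₒ eik)) (fklm : Hom ekm (elm ⊗ₒ ekl)) :
    Hom eim (elm ⊗ₒ ekl ⊗ₒ ejk ⊗ₒ eij) :=
  ((lComp fijk fikm).comp (fklm.rten (ejk ⊗ₒ eij))).cast rfl
    (SemistrictMonoidal.tensor_assoc _ _ _)

theorem midL_mor (fijk : Hom eik (ejk ⊗ₒ eij)) (fikm : Hom eim (ekm ⊗ₒ eik))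
    (fklm : Hom ekm (elm ⊗ₒ ekl)) :
    (fikm.comp ((fklm.rten eik).comp (fijk.lten (elm ⊗ₒ ekl)))).mor = (midL fijk fikm fklm).mor := by
  have h := Hom.assoc_mor fikm (fklm.rten eik) (fijk.lten (elm ⊗ₒ ekl))
  simp only [midL, rComp, Hom.comp, Hom.cast, Hom.lten, Hom.rten,
    SemistrictMonoidal.lMor_lMor] at h ⊢
  exact h.symm

theorem midR_mor (fijk : Hom eik (ejk ⊗ₒ eij)) (fikm : Hom eim (ekm ⊗ₒ eik))
    (fklm : Hom ekm (elm ⊗ₒ ekl)) :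
    (fikm.comp ((fijk.lten ekm).comp (fklm.rten (ejk ⊗ₒ eij)))).mor =
      (midR fijk fikm fklm).mor :=
  (Hom.assoc_mor fikm (fijk.lten ekm) (fklm.rten (ejk ⊗ₒ eij))).symm

/-- `f_{ikm} ∘ ⊗_{f_{klm}, f_{ijk}}`. -/
def midHom (fijk : Hom eik (ejk ⊗ₒ eij)) (fikm : Hom eim (ekm ⊗ₒ eik))
    (fklm : Hom ekm (elm ⊗ₒ ekl)) : Hom2 (midL fijk fikm fklm) (midR fijk fikm fklm) :=
  ((Hom2.id fikm).hcomp (tensHom fklm fijk)).cast (midL_mor _ _ _) (midR_mor _ _ _)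

/-- `f_{ikm} ∘ ⊗⁻¹_{f_{klm}, f_{ijk}}`. -/
def midInvHom (fijk : Hom eik (ejk ⊗ₒ eij)) (fikm : Hom eim (ekm ⊗ₒ eik))
    (fklm : Hom ekm (elm ⊗ₒ ekl)) : Hom2 (midR fijk fikm fklm) (midL fijk fikm fklm) :=
  ((Hom2.id fikm).hcomp (tensInvHom fklm fijk)).cast (midR_mor _ _ _) (midL_mor _ _ _)

/-- `f_{i((jkl)m)} = f_{ijm} (f_{jlm} ⊗ e_{ij}) (e_{lm} ⊗ f_{jkl} ⊗ e_{ij})`. -/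
def midA (fijm : Hom eim (ejm ⊗ₒ eij)) (fjkl : Hom ejl (ekl ⊗ₒ ejk)) (fjlm : Hom ejm (elm ⊗ₒ ejl)) :
    Hom eim (elm ⊗ₒ ekl ⊗ₒ ejk ⊗ₒ eij) :=
  ((rComp fijm fjlm).comp ((fjkl.rten eij).lten elm)).cast rfl
    (congrArg (elm ⊗ₒ ·) (SemistrictMonoidal.tensor_assoc _ _ _))

/-- `f_{(i(jkl))m} = f_{ilm} (e_{lm} ⊗ f_{ijl}) (e_{lm} ⊗ f_{jkl} ⊗ e_{ij})`. -/
def midE (fijl : Hom eil (ejl ⊗ₒ eij)) (film : Hom eim (elm ⊗ₒ eil)) (fjkl : Hom ejl (ekl ⊗ₒ ejk)) :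
    Hom eim (elm ⊗ₒ ekl ⊗ₒ ejk ⊗ₒ eij) :=
  ((lComp fijl film).comp ((fjkl.rten eij).lten elm)).cast rfl
    (congrArg (elm ⊗ₒ ·) (SemistrictMonoidal.tensor_assoc _ _ _))

theorem midA_src (fijm : Hom eim (ejm ⊗ₒ eij)) (fjkm : Hom ejm (ekm ⊗ₒ ejk))
    (fklm : Hom ekm (elm ⊗ₒ ekl)) :
    (fijm.comp ((rComp fjkm fklm).rten eij)).mor = (rComp₄ fijm fjkm fklm).mor := by
  have h1 := Hom.assoc_mor fijm (fjkm.rten eij) ((fklm.rten ejk).rten eij)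
  have h2 := Hom.rten_mor fjkm (fklm.rten ejk) eij
  simp only [rComp₄, rComp, Hom.comp, Hom.cast, Hom.rten,
    SemistrictMonoidal.rMor_rMor] at h1 h2 ⊢
  rw [h2, h1]

theorem midA_tgt (fijm : Hom eim (ejm ⊗ₒ eij)) (fjkl : Hom ejl (ekl ⊗ₒ ejk))
    (fjlm : Hom ejm (elm ⊗ₒ ejl)) :
    (fijm.comp ((lComp fjkl fjlm).rten eij)).mor = (midA fijm fjkl fjlm).mor := by
  have h1 := Hom.assoc_mor fijm (fjlm.rten eij) ((fjkl.lten elm).rten eij)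
  have h2 := Hom.rten_mor fjlm (fjkl.lten elm) eij
  simp only [midA, lComp, rComp, Hom.comp, Hom.cast, Hom.rten, Hom.lten,
    SemistrictMonoidal.lMor_rMor] at h1 h2 ⊢
  rw [h2, h1]

theorem midE_src (fijl : Hom eil (ejl ⊗ₒ eij)) (film : Hom eim (elm ⊗ₒ eil))
    (fjkl : Hom ejl (ekl ⊗ₒ ejk)) :
    (film.comp ((rComp fijl fjkl).lten elm)).mor = (midE fijl film fjkl).mor := by
  have h1 := Hom.assoc_mor film (fijl.lten elm) ((fjkl.rten eij).lten elm)
  have h2 := Hom.lten_mor elm fijl (fjkl.rten eij)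
  simp only [midE, lComp, rComp, Hom.comp, Hom.cast, Hom.rten, Hom.lten] at h1 h2 ⊢
  rw [h2, h1]

theorem midE_tgt (fijk : Hom eik (ejk ⊗ₒ eij)) (fikl : Hom eil (ekl ⊗ₒ eik))
    (film : Hom eim (elm ⊗ₒ eil)) :
    (film.comp ((lComp fijk fikl).lten elm)).mor = (lComp₄ fijk fikl film).mor := by
  have h1 := Hom.assoc_mor film (fikl.lten elm) ((fijk.lten ekl).lten elm)
  have h2 := Hom.lten_mor elm fikl (fijk.lten ekl)
  simp only [lComp₄, lComp, Hom.comp, Hom.lten] at h1 h2 ⊢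
  rw [h2, h1]

end

section
open TensorProduct

variable (F : Type*) [Field F] {O : Type u} [TwoCatData.{u, v, w} O] [MonoidalData O]
  [SemistrictMonoidal O] [Preadditive2 O] [VectLinear F O]

/-- Vertical composition as a linear map on the tensor product. -/
noncomputable def vcompT {A B : O} (f g h : Hom A B) :
    Hom2 f g ⊗[F] Hom2 g h →ₗ[F] Hom2 f h :=
  TensorProduct.lift (vcompL F f g h)

variable {eij eik eil eim ejk ejl ejm ekl ekm elm : O}

/-- `β ↦ β ∘ (e_{lm} ⊗ e_{kl} ⊗ f_{ijk})` on `2Hom(f_{(ikl)m}, f_{i(klm)})`. -/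
def betaL (fijk : Hom eik (ejk ⊗ₒ eij)) (fikl : Hom eil (ekl ⊗ₒ eik)) (fikm : Hom eim (ekm ⊗ₒ eik))
    (film : Hom eim (elm ⊗ₒ eil)) (fklm : Hom ekm (elm ⊗ₒ ekl)) :
    TwoH fikl fikm film fklm →ₗ[F] Hom2 (lComp₄ fijk fikl film) (midL fijk fikm fklm) :=
  (hcompL F _ _ _ _).flip (Hom2.id ((fijk.lten ekl).lten elm))

/-- `β ↦ β ∘ (e_{lm} ⊗ e_{kl} ⊗ f_{ijk})` on `2Hom(f_{i(klm)}, f_{(ikl)m})`. -/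
def betaL' (fijk : Hom eik (ejk ⊗ₒ eij)) (fikl : Hom eil (ekl ⊗ₒ eik)) (fikm : Hom eim (ekm ⊗ₒ eik))
    (film : Hom eim (elm ⊗ₒ eil)) (fklm : Hom ekm (elm ⊗ₒ ekl)) :
    TwoH' fikl fikm film fklm →ₗ[F] Hom2 (midL fijk fikm fklm) (lComp₄ fijk fikl film) :=
  (hcompL F _ _ _ _).flip (Hom2.id ((fijk.lten ekl).lten elm))

/-- `δ ↦ δ ∘ (f_{klm} ⊗ e_{jk} ⊗ e_{ij})` on `2Hom(f_{(ijk)m}, f_{i(jkm)})`. -/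
def deltaL (fijk : Hom eik (ejk ⊗ₒ eij)) (fijm : Hom eim (ejm ⊗ₒ eij)) (fikm : Hom eim (ekm ⊗ₒ eik))
    (fjkm : Hom ejm (ekm ⊗ₒ ejk)) (fklm : Hom ekm (elm ⊗ₒ ekl)) :
    TwoH fijk fijm fikm fjkm →ₗ[F] Hom2 (midR fijk fikm fklm) (rComp₄ fijm fjkm fklm) :=
  castL F (f := (lComp fijk fikm).comp (fklm.rten (ejk ⊗ₒ eij))) (g := (rComp fijm fjkm).comp (fklm.rten (ejk ⊗ₒ eij)))
      rfl rfl ∘ₗ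
    (hcompL F (lComp fijk fikm) (rComp fijm fjkm) _ _).flip (Hom2.id (fklm.rten (ejk ⊗ₒ eij)))

/-- `δ ↦ δ ∘ (f_{klm} ⊗ e_{jk} ⊗ e_{ij})` on `2Hom(f_{i(jkm)}, f_{(ijk)m})`. -/
def deltaL' (fijk : Hom eik (ejk ⊗ₒ eij)) (fijm : Hom eim (ejm ⊗ₒ eij))
    (fikm : Hom eim (ekm ⊗ₒ eik)) (fjkm : Hom ejm (ekm ⊗ₒ ejk)) (fklm : Hom ekm (elm ⊗ₒ ekl)) :
    TwoH' fijk fijm fikm fjkm →ₗ[F] Hom2 (rComp₄ fijm fjkm fklm) (midR fijk fikm fklm) :=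
  castL F (f := (rComp fijm fjkm).comp (fklm.rten (ejk ⊗ₒ eij))) (g := (lComp fijk fikm).comp (fklm.rten (ejk ⊗ₒ eij)))
      rfl rfl ∘ₗ
    (hcompL F (rComp fijm fjkm) (lComp fijk fikm) _ _).flip (Hom2.id (fklm.rten (ejk ⊗ₒ eij)))

/-- `α ↦ f_{ijm} ∘ (α ⊗ e_{ij})` on `2Hom(f_{(jkl)m}, f_{j(klm)})`. -/
def alphaL (fijm : Hom eim (ejm ⊗ₒ eij)) (fjkl : Hom ejl (ekl ⊗ₒ ejk)) (fjkm : Hom ejm (ekm ⊗ₒ ejk))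
    (fjlm : Hom ejm (elm ⊗ₒ ejl)) (fklm : Hom ekm (elm ⊗ₒ ekl)) :
    TwoH fjkl fjkm fjlm fklm →ₗ[F] Hom2 (midA fijm fjkl fjlm) (rComp₄ fijm fjkm fklm) :=
  castL F (midA_tgt fijm fjkl fjlm) (midA_src fijm fjkm fklm) ∘ₗ
    hcompL F _ _ _ _ (Hom2.id fijm) ∘ₗ rtenL F _ _ eij

/-- `α ↦ f_{ijm} ∘ (α ⊗ e_{ij})` on `2Hom(f_{j(klm)}, f_{(jkl)m})`. -/
def alphaL' (fijm : Hom eim (ejm ⊗ₒ eij)) (fjkl : Hom ejl (ekl ⊗ₒ ejk))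
    (fjkm : Hom ejm (ekm ⊗ₒ ejk)) (fjlm : Hom ejm (elm ⊗ₒ ejl)) (fklm : Hom ekm (elm ⊗ₒ ekl)) :
    TwoH' fjkl fjkm fjlm fklm →ₗ[F] Hom2 (rComp₄ fijm fjkm fklm) (midA fijm fjkl fjlm) :=
  castL F (midA_src fijm fjkm fklm) (midA_tgt fijm fjkl fjlm) ∘ₗ
    hcompL F _ _ _ _ (Hom2.id fijm) ∘ₗ rtenL F _ _ eij

/-- `γ ↦ γ ∘ (e_{lm} ⊗ f_{jkl} ⊗ e_{ij})` on `2Hom(f_{(ijl)m}, f_{i(jlm)})`. -/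
def gammaL (fijl : Hom eil (ejl ⊗ₒ eij)) (fijm : Hom eim (ejm ⊗ₒ eij)) (film : Hom eim (elm ⊗ₒ eil))
    (fjkl : Hom ejl (ekl ⊗ₒ ejk)) (fjlm : Hom ejm (elm ⊗ₒ ejl)) :
    TwoH fijl fijm film fjlm →ₗ[F] Hom2 (midE fijl film fjkl) (midA fijm fjkl fjlm) :=
  castL F (f := (lComp fijl film).comp ((fjkl.rten eij).lten elm)) (g := (rComp fijm fjlm).comp ((fjkl.rten eij).lten elm))
      rfl rfl ∘ₗ
    (hcompL F (lComp fijl film) (rComp fijm fjlm) _ _).flip (Hom2.id ((fjkl.rten eij).lten elm))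

/-- `γ ↦ γ ∘ (e_{lm} ⊗ f_{jkl} ⊗ e_{ij})` on `2Hom(f_{i(jlm)}, f_{(ijl)m})`. -/
def gammaL' (fijl : Hom eil (ejl ⊗ₒ eij)) (fijm : Hom eim (ejm ⊗ₒ eij))
    (film : Hom eim (elm ⊗ₒ eil)) (fjkl : Hom ejl (ekl ⊗ₒ ejk)) (fjlm : Hom ejm (elm ⊗ₒ ejl)) :
    TwoH' fijl fijm film fjlm →ₗ[F] Hom2 (midA fijm fjkl fjlm) (midE fijl film fjkl) :=
  castL F (f := (rComp fijm fjlm).comp ((fjkl.rten eij).lten elm)) (g := (lComp fijl film).comp ((fjkl.rten eij).lten elm))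
      rfl rfl ∘ₗ
    (hcompL F (rComp fijm fjlm) (lComp fijl film) _ _).flip (Hom2.id ((fjkl.rten eij).lten elm))

/-- `ε ↦ f_{ilm} ∘ (e_{lm} ⊗ ε)` on `2Hom(f_{(ijk)l}, f_{i(jkl)})`. -/
def epsL (fijk : Hom eik (ejk ⊗ₒ eij)) (fijl : Hom eil (ejl ⊗ₒ eij)) (fikl : Hom eil (ekl ⊗ₒ eik))
    (film : Hom eim (elm ⊗ₒ eil)) (fjkl : Hom ejl (ekl ⊗ₒ ejk)) :
    TwoH fijk fijl fikl fjkl →ₗ[F] Hom2 (lComp₄ fijk fikl film) (midE fijl film fjkl) :=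
  castL F (midE_tgt fijk fikl film) (midE_src fijl film fjkl) ∘ₗ
    hcompL F _ _ _ _ (Hom2.id film) ∘ₗ ltenL F elm _ _

/-- `ε ↦ f_{ilm} ∘ (e_{lm} ⊗ ε)` on `2Hom(f_{i(jkl)}, f_{(ijk)l})`. -/
def epsL' (fijk : Hom eik (ejk ⊗ₒ eij)) (fijl : Hom eil (ejl ⊗ₒ eij)) (fikl : Hom eil (ekl ⊗ₒ eik))
    (film : Hom eim (elm ⊗ₒ eil)) (fjkl : Hom ejl (ekl ⊗ₒ ejk)) :
    TwoH' fijk fijl fikl fjkl →ₗ[F] Hom2 (midE fijl film fjkl) (lComp₄ fijk fikl film) :=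
  castL F (midE_src fijl film fjkl) (midE_tgt fijk fikl film) ∘ₗ
    hcompL F _ _ _ _ (Hom2.id film) ∘ₗ ltenL F elm _ _

/-- `βδ = (β ∘ (e_{lm} ⊗ e_{kl} ⊗ f_{ijk})) · (f_{ikm} ∘ ⊗_{f_{klm}, f_{ijk}}) ·
(δ ∘ (f_{klm} ⊗ e_{jk} ⊗ e_{ij}))`. -/
noncomputable def betaDelta (fijk : Hom eik (ejk ⊗ₒ eij)) (fijm : Hom eim (ejm ⊗ₒ eij))
    (fikl : Hom eil (ekl ⊗ₒ eik)) (fikm : Hom eim (ekm ⊗ₒ eik)) (film : Hom eim (elm ⊗ₒ eil))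
    (fjkm : Hom ejm (ekm ⊗ₒ ejk)) (fklm : Hom ekm (elm ⊗ₒ ekl)) :
    TwoH fikl fikm film fklm ⊗[F] TwoH fijk fijm fikm fjkm →ₗ[F]
      Hom2 (lComp₄ fijk fikl film) (rComp₄ fijm fjkm fklm) :=
  vcompT F _ _ _ ∘ₗ
    TensorProduct.map
      ((vcompL F _ _ _).flip (midHom fijk fikm fklm) ∘ₗ betaL F fijk fikl fikm film fklm)
      (deltaL F fijk fijm fikm fjkm fklm)

/-- `δβ = (δ ∘ (f_{klm} ⊗ e_{jk} ⊗ e_{ij})) · (f_{ikm} ∘ ⊗⁻¹_{f_{klm}, f_{ijk}}) ·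
(β ∘ (e_{lm} ⊗ e_{kl} ⊗ f_{ijk}))`, as a function of `β ⊗ δ`. -/
noncomputable def deltaBeta (fijk : Hom eik (ejk ⊗ₒ eij)) (fijm : Hom eim (ejm ⊗ₒ eij))
    (fikl : Hom eil (ekl ⊗ₒ eik)) (fikm : Hom eim (ekm ⊗ₒ eik)) (film : Hom eim (elm ⊗ₒ eil))
    (fjkm : Hom ejm (ekm ⊗ₒ ejk)) (fklm : Hom ekm (elm ⊗ₒ ekl)) :
    TwoH' fikl fikm film fklm ⊗[F] TwoH' fijk fijm fikm fjkm →ₗ[F]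
      Hom2 (rComp₄ fijm fjkm fklm) (lComp₄ fijk fikl film) :=
  vcompT F _ _ _ ∘ₗ
    TensorProduct.map
      ((vcompL F _ _ _).flip (midInvHom fijk fikm fklm) ∘ₗ deltaL' F fijk fijm fikm fjkm fklm)
      (betaL' F fijk fikl fikm film fklm) ∘ₗ
    (TensorProduct.comm F _ _).toLinearMap

/-- `αγε = (f_{ijm} ∘ (α ⊗ e_{ij})) · (γ ∘ (e_{lm} ⊗ f_{jkl} ⊗ e_{ij})) · (f_{ilm} ∘ (e_{lm} ⊗ ε))`,
as a function of `α ⊗ γ ⊗ ε`. -/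
noncomputable def alphaGammaEps (fijk : Hom eik (ejk ⊗ₒ eij)) (fijl : Hom eil (ejl ⊗ₒ eij))
    (fijm : Hom eim (ejm ⊗ₒ eij)) (fikl : Hom eil (ekl ⊗ₒ eik)) (film : Hom eim (elm ⊗ₒ eil))
    (fjkl : Hom ejl (ekl ⊗ₒ ejk)) (fjkm : Hom ejm (ekm ⊗ₒ ejk)) (fjlm : Hom ejm (elm ⊗ₒ ejl))
    (fklm : Hom ekm (elm ⊗ₒ ekl)) :
    TwoH' fjkl fjkm fjlm fklm ⊗[F] (TwoH' fijl fijm film fjlm ⊗[F] TwoH' fijk fijl fikl fjkl) →ₗ[F]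
      Hom2 (rComp₄ fijm fjkm fklm) (lComp₄ fijk fikl film) :=
  vcompT F _ _ _ ∘ₗ
    TensorProduct.map (alphaL' F fijm fjkl fjkm fjlm fklm)
      (vcompT F _ _ _ ∘ₗ
        TensorProduct.map (gammaL' F fijl fijm film fjkl fjlm) (epsL' F fijk fijl fikl film fjkl))

/-- `εγα = (f_{ilm} ∘ (e_{lm} ⊗ ε)) · (γ ∘ (e_{lm} ⊗ f_{jkl} ⊗ e_{ij})) · (f_{ijm} ∘ (α ⊗ e_{ij}))`,
as a function of `α ⊗ γ ⊗ ε`. -/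
noncomputable def epsGammaAlpha (fijk : Hom eik (ejk ⊗ₒ eij)) (fijl : Hom eil (ejl ⊗ₒ eij))
    (fijm : Hom eim (ejm ⊗ₒ eij)) (fikl : Hom eil (ekl ⊗ₒ eik)) (film : Hom eim (elm ⊗ₒ eil))
    (fjkl : Hom ejl (ekl ⊗ₒ ejk)) (fjkm : Hom ejm (ekm ⊗ₒ ejk)) (fjlm : Hom ejm (elm ⊗ₒ ejl))
    (fklm : Hom ekm (elm ⊗ₒ ekl)) :
    TwoH fjkl fjkm fjlm fklm ⊗[F] (TwoH fijl fijm film fjlm ⊗[F] TwoH fijk fijl fikl fjkl) →ₗ[F]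
      Hom2 (lComp₄ fijk fikl film) (rComp₄ fijm fjkm fklm) :=
  vcompT F _ _ _ ∘ₗ
    TensorProduct.map
      (vcompT F _ _ _ ∘ₗ
        TensorProduct.map (epsL F fijk fijl fikl film fjkl) (gammaL F fijl fijm film fjkl fjlm))
      (alphaL F fijm fjkl fjkm fjlm fklm) ∘ₗ
    (TensorProduct.comm F _ _).toLinearMap ∘ₗ
    LinearMap.lTensor _ (TensorProduct.comm F _ _).toLinearMap

end

section
open TensorProduct

variable (F : Type*) [Field F] {O : Type u} [TwoCatData.{u, v, w} O] [MonoidalData O] [DualData O]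
  [SemistrictMonoidalDuals O] [Preadditive2 O] [VectLinear F O] [NonDegenerate F O]

/-- The identification of `2Hom(f,f') ⊗ 2Hom(g,g')` with `(2Hom(f',f) ⊗ 2Hom(g',g))*`. -/
noncomputable def dualEquiv₂ {A B C D : O} (f f' : Hom A B) (g g' : Hom C D) :
    Hom2 f f' ⊗[F] Hom2 g g' ≃ₗ[F] Module.Dual F (Hom2 f' f ⊗[F] Hom2 g' g) :=
  TensorProduct.congr (dualEquiv F f f') (dualEquiv F g g') ≪≫ₗ
    TensorProduct.dualDistribEquiv F (Hom2 f' f) (Hom2 g' g)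

/-- The identification of `2Hom(f,f') ⊗ 2Hom(g,g') ⊗ 2Hom(h,h')` with
`(2Hom(f',f) ⊗ 2Hom(g',g) ⊗ 2Hom(h',h))*`. -/
noncomputable def dualEquiv₃ {A B C D X Y : O} (f f' : Hom A B) (g g' : Hom C D) (h h' : Hom X Y) :
    Hom2 f f' ⊗[F] (Hom2 g g' ⊗[F] Hom2 h h') ≃ₗ[F]
      Module.Dual F (Hom2 f' f ⊗[F] (Hom2 g' g ⊗[F] Hom2 h' h)) :=
  TensorProduct.congr (dualEquiv F f f') (dualEquiv₂ F g g' h h') ≪≫ₗ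
    TensorProduct.dualDistribEquiv F (Hom2 f' f) (Hom2 g' g ⊗[F] Hom2 h' h)

variable {eij eik eil eim ejk ejl ejm ekl ekm elm : O}

/-- The partition function `Z(+(ijklm)) : 2H(iklm) ⊗ 2H(ijkm) → 2H(jklm) ⊗ 2H(ijlm) ⊗ 2H(ijkl)`
of a labelled 4-simplex: the image of `β ⊗ δ` is the element that corresponds to the linear form
`α ⊗ γ ⊗ ε ↦ ⟨βδ, αγε⟩`. -/
noncomputable def Zplus (fijk : Hom eik (ejk ⊗ₒ eij)) (fijl : Hom eil (ejl ⊗ₒ eij))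
    (fijm : Hom eim (ejm ⊗ₒ eij)) (fikl : Hom eil (ekl ⊗ₒ eik)) (fikm : Hom eim (ekm ⊗ₒ eik))
    (film : Hom eim (elm ⊗ₒ eil)) (fjkl : Hom ejl (ekl ⊗ₒ ejk)) (fjkm : Hom ejm (ekm ⊗ₒ ejk))
    (fjlm : Hom ejm (elm ⊗ₒ ejl)) (fklm : Hom ekm (elm ⊗ₒ ekl)) :
    TwoH fikl fikm film fklm ⊗[F] TwoH fijk fijm fikm fjkm →ₗ[F]
      TwoH fjkl fjkm fjlm fklm ⊗[F] (TwoH fijl fijm film fjlm ⊗[F] TwoH fijk fijl fikl fjkl) :=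
  (dualEquiv₃ F _ _ _ _ _ _).symm.toLinearMap ∘ₗ
    (pairing F (lComp₄ fijk fikl film) (rComp₄ fijm fjkm fklm)).compl₁₂
      (betaDelta F fijk fijm fikl fikm film fjkm fklm)
      (alphaGammaEps F fijk fijl fijm fikl film fjkl fjkm fjlm fklm)

/-- The partition function `Z(-(ijklm)) : 2H(jklm) ⊗ 2H(ijlm) ⊗ 2H(ijkl) → 2H(iklm) ⊗ 2H(ijkm)`
of an oppositely oriented labelled 4-simplex: the image of `α ⊗ γ ⊗ ε` is the element that
corresponds to the linear form `β ⊗ δ ↦ ⟨δβ, εγα⟩`. -/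
noncomputable def Zminus (fijk : Hom eik (ejk ⊗ₒ eij)) (fijl : Hom eil (ejl ⊗ₒ eij))
    (fijm : Hom eim (ejm ⊗ₒ eij)) (fikl : Hom eil (ekl ⊗ₒ eik)) (fikm : Hom eim (ekm ⊗ₒ eik))
    (film : Hom eim (elm ⊗ₒ eil)) (fjkl : Hom ejl (ekl ⊗ₒ ejk)) (fjkm : Hom ejm (ekm ⊗ₒ ejk))
    (fjlm : Hom ejm (elm ⊗ₒ ejl)) (fklm : Hom ekm (elm ⊗ₒ ekl)) :
    TwoH fjkl fjkm fjlm fklm ⊗[F] (TwoH fijl fijm film fjlm ⊗[F] TwoH fijk fijl fikl fjkl) →ₗ[F]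
      TwoH fikl fikm film fklm ⊗[F] TwoH fijk fijm fikm fjkm :=
  (dualEquiv₂ F _ _ _ _).symm.toLinearMap ∘ₗ
    ((pairing F (rComp₄ fijm fjkm fklm) (lComp₄ fijk fikl film)).compl₁₂
      (deltaBeta F fijk fijm fikl fikm film fjkm fklm)
      (epsGammaAlpha F fijk fijl fijm fikl film fjkl fjkm fjlm fklm)).flip

end

/-! ### Maps on iterated tensor products

Iterated tensor products are nested to the right. -/

section
open TensorProduct

variable {F : Type*} [Field F] {M₁ M₂ M₃ N₁ N₂ N₃ : Type*}
  [AddCommGroup M₁] [AddCommGroup M₂] [AddCommGroup M₃]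
  [AddCommGroup N₁] [AddCommGroup N₂] [AddCommGroup N₃]
  [Module F M₁] [Module F M₂] [Module F M₃] [Module F N₁] [Module F N₂] [Module F N₃]

/-- `φ ⊗ 1` for `φ : M₁ ⊗ M₂ → N₁ ⊗ N₂ ⊗ N₃`. -/
noncomputable def onTwo (R : Type*) [AddCommGroup R] [Module F R]
    (φ : M₁ ⊗[F] M₂ →ₗ[F] N₁ ⊗[F] (N₂ ⊗[F] N₃)) :
    M₁ ⊗[F] (M₂ ⊗[F] R) →ₗ[F] N₁ ⊗[F] (N₂ ⊗[F] (N₃ ⊗[F] R)) :=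
  LinearMap.lTensor N₁ (TensorProduct.assoc F N₂ N₃ R).toLinearMap ∘ₗ
    (TensorProduct.assoc F N₁ (N₂ ⊗[F] N₃) R).toLinearMap ∘ₗ
    LinearMap.rTensor R φ ∘ₗ
    (TensorProduct.assoc F M₁ M₂ R).symm.toLinearMap

/-- `φ ⊗ 1` for `φ : M₁ ⊗ M₂ ⊗ M₃ → N₁ ⊗ N₂`. -/
noncomputable def onThree (R : Type*) [AddCommGroup R] [Module F R]
    (φ : M₁ ⊗[F] (M₂ ⊗[F] M₃) →ₗ[F] N₁ ⊗[F] N₂) :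
    M₁ ⊗[F] (M₂ ⊗[F] (M₃ ⊗[F] R)) →ₗ[F] N₁ ⊗[F] (N₂ ⊗[F] R) :=
  (TensorProduct.assoc F N₁ N₂ R).toLinearMap ∘ₗ
    LinearMap.rTensor R φ ∘ₗ
    (TensorProduct.assoc F M₁ (M₂ ⊗[F] M₃) R).symm.toLinearMap ∘ₗ
    LinearMap.lTensor M₁ (TensorProduct.assoc F M₂ M₃ R).symm.toLinearMap

/-- `1 ⊗ φ`. -/
noncomputable abbrev idTensor (L : Type*) [AddCommGroup L] [Module F L] (φ : M₁ →ₗ[F] N₁) :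
    L ⊗[F] M₁ →ₗ[F] L ⊗[F] N₁ :=
  LinearMap.lTensor L φ

/-- The transposition `P : M₁ ⊗ M₂ → M₂ ⊗ M₁`. -/
noncomputable abbrev transp : M₁ ⊗[F] M₂ →ₗ[F] M₂ ⊗[F] M₁ :=
  (TensorProduct.comm F M₁ M₂).toLinearMap

/-- `P ⊗ 1`. -/
noncomputable abbrev transpHead (R : Type*) [AddCommGroup R] [Module F R] :
    M₁ ⊗[F] (M₂ ⊗[F] R) →ₗ[F] M₂ ⊗[F] (M₁ ⊗[F] R) :=
  (TensorProduct.leftComm F M₁ M₂ R).toLinearMap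

end

end Spherical2

open Spherical2
open scoped TensorProduct

set_option linter.unusedSectionVars false
set_option linter.unusedSimpArgs false

/-! Both sides are evaluated on arbitrary tensors and paired with arbitrary dual elements for the
tetrahedra 0345, 1235, 0135, 0123. The pairing is non-degenerate, so only numbers have to be
compared, and each number is the trace of a closed pasting diagram. Two facts govern these traces:
they are cyclic (`tr_comm`), and a trace over a composite `fg` is the trace over `f` of a partial
trace over `g` (`tr_comp`). Hence pairing off one tensor factor of `Zminus` forms a partial trace
(`pairing_betaContract`, `pairing_deltaContract`), which can be reopened inside a larger diagram.

On the left-hand side everything is sliding and rotation. Naturality of the tensorator moves the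
tetrahedron 2345 past the triangle 012 (`slide_left`) and 0123 past 345 (`slide_right`). The
outcome, `closingForm_betaDelta`, is that the number is a linear form `closingForm`, not depending
on the elements at 0245 and 0125, applied to their composite `βδ : f_{((012)4)5} ⇒ f_{0(1(245))}`.

Semi-simplicity expands every such 2-morphism into composites `εγα` over the labels `e14`, `f014`,
`f124`, `f145` (`sum_epsGammaAlpha`); the coefficients of `βδ` are by definition those of
Z(+(01245)). The composites span because the identity of `e24 ⊗ e12` splits through objects of `E`,
after which the 1-morphisms split into basis elements (`mem_spanEpsGammaAlpha`). The weights come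
from orthogonality: the pairing of an `εγα` with an `αγε` contains two strands `t' t*`, with `t`,
`t'` the two candidates for `f124`. The identity of `t' t*` vanishes when the labels differ, and for
`t' = t` it is `dim e14 / dim t` times counit followed by unit
(`FinitelySemisimple.id_comp_dual_eq_smul`). This cuts the diagram, and the two remaining loops
contribute `1 / dim f145` and `1 / dim f014`.

Each term of this expansion, closed up, is again a linear form (`innerForm`) of a composite of the
elements at 0123, 0234 and 0124 (`innerForm_innerCellArg`). A second expansion, along the basis for
`f134` with weights `dim f134` (`sum_gammaAlpha`), has as coefficients a contraction of Z(+(01234))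
(`contract_Zplus`), and `innerForm` on its terms is the contraction of Z(-(12345)) and Z(-(01345))
(`innerForm_gammaAlpha`). What remains is bookkeeping of tensor factors. -/

namespace Spherical2

open TwoCatData MonoidalData DualData StrictTwoCategory SemistrictMonoidal SemistrictMonoidalDuals

-- Normal form of pasting diagrams: right-bracketed vertical composites of whiskered generators

attribute [simp] dom_one cod_one dom_comp cod_comp comp_assoc src_idc tgt_idc src_vcomp tgt_vcomp
  vcomp_assoc src_hcomp tgt_hcomp hcomp_assoc idc_hcomp_idc
  unit_tensor tensor_unit tensor_assoc dom_lMor cod_lMor dom_rMor cod_rMor src_lCell tgt_lCell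
  src_rCell tgt_rCell lMor_one lMor_comp lCell_idc lCell_vcomp lCell_hcomp rMor_one rMor_comp
  rCell_idc rCell_vcomp rCell_hcomp unit_lMor rMor_unit unit_lCell rCell_unit lMor_lMor lMor_rMor
  rMor_rMor lCell_lCell lCell_rCell rCell_rCell src_tensorator tgt_tensorator src_tensoratorInv
  tgt_tensoratorInv

attribute [simp] dom_dualMor cod_dualMor src_dualCell tgt_dualCell src_iMor tgt_iMor src_eMor
  tgt_eMor dom_iObj cod_iObj dom_eObj cod_eObj dualObj_dualObj dualMor_dualMor dualCell_dualCell
  dualMor_one dualCell_idc dualCell_vcomp dualCell_hcomp dualMor_comp dualCell_lCell dualMor_lMor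
  dualCell_rCell dualMor_rMor dualObj_tensor iMor_lMor iMor_rMor eMor_lMor eMor_rMor

/-! ### Calculus in a strict 2-category -/

section
variable {O : Type u} [TwoCatData.{u, v, w} O] [StrictTwoCategory O]

-- Keeping the boundary as a side condition lets `simp` use the unit law when the source agrees with
-- `f` only after simplification. The next lemmas have this form for the same reason.
@[simp] theorem idc_vcomp' (f : Mor O) (α : Cell O) (h : src α = f) : idc f ⬝ α = α := by
  subst h; exact idc_vcomp α

@[simp] theorem vcomp_idc' (f : Mor O) (α : Cell O) (h : tgt α = f) : α ⬝ idc f = α := by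
  subst h; exact vcomp_idc α

@[simp] theorem one_comp' (A : O) (f : Mor O) (h : dom f = A) : one A ⨾ f = f := by
  subst h; exact one_comp f

@[simp] theorem comp_one' (A : O) (f : Mor O) (h : cod f = A) : f ⨾ one A = f := by
  subst h; exact comp_one f

@[simp] theorem one_hcomp' (A : O) (α : Cell O) (h : dom (src α) = A) :
    idc (one A) ⊚ α = α := by
  subst h; exact one_hcomp α

@[simp] theorem hcomp_one' (A : O) (α : Cell O) (h : cod (src α) = A) :
    α ⊚ idc (one A) = α := by
  subst h; exact hcomp_one α

@[simp] theorem idc_hcomp_idc_hcomp (f g : Mor O) (α : Cell O) (h : cod f = dom g)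
    (h' : cod g = dom (src α)) : idc f ⊚ (idc g ⊚ α) = idc (f ⨾ g) ⊚ α := by
  rw [← hcomp_assoc _ _ _ (by simpa) (by simpa), idc_hcomp_idc _ _ h]

@[simp] theorem idc_hcomp_vcomp (f : Mor O) (α β : Cell O) (h : tgt α = src β)
    (h' : cod f = dom (src α)) : idc f ⊚ (α ⬝ β) = (idc f ⊚ α) ⬝ (idc f ⊚ β) := by
  rw [← interchange _ _ _ _ (by simp) h (by simpa), idc_vcomp' _ _ (by simp)]

@[simp] theorem vcomp_hcomp_idc (f : Mor O) (α β : Cell O) (h : tgt α = src β)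
    (h' : cod (src α) = dom f) : (α ⬝ β) ⊚ idc f = (α ⊚ idc f) ⬝ (β ⊚ idc f) := by
  rw [← interchange _ _ _ _ h (by simp) (by simpa), idc_vcomp' _ _ (by simp)]

/-- Both sides equal `α ⊚ β` by the interchange law. This relation has no preferred direction and so
stays outside the `simp` set; it is invoked by hand wherever two 2-morphisms pass each other. -/
theorem exchange (α β : Cell O) (h : cod (src α) = dom (src β)) :
    (α ⊚ idc (src β)) ⬝ (idc (tgt α) ⊚ β) = (idc (src α) ⊚ β) ⬝ (α ⊚ idc (tgt β)) := by
  have h1 := interchange α (idc (tgt α)) (idc (src β)) β (by simp) (by simp) (by simpa)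
  have h2 := interchange (idc (src α)) α β (idc (tgt β)) (by simp) (by simp) (by simpa)
  rw [← h1, ← h2]; simp

/-- Normal forms are bracketed to the right, so an equation for `α ⬝ β` can be used inside a longer
composite only in a version with a tail `ε`. -/
theorem vcomp_reassoc₁ {α β γ : Cell O} (h : α ⬝ β = γ) (ε : Cell O) (h1 : tgt α = src β)
    (h3 : tgt β = src ε) : α ⬝ (β ⬝ ε) = γ ⬝ ε := by
  rw [← vcomp_assoc _ _ _ h1 h3, h]

theorem vcomp_reassoc {α β γ δ : Cell O} (h : α ⬝ β = γ ⬝ δ) (ε : Cell O) (h1 : tgt α = src β)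
    (h2 : tgt γ = src δ) (h3 : tgt β = src ε) (h4 : tgt δ = src ε) :
    α ⬝ (β ⬝ ε) = γ ⬝ (δ ⬝ ε) := by
  rw [← vcomp_assoc _ _ _ h1 h3, h, vcomp_assoc _ _ _ h2 h4]

end

-- Passage from typed 1- and 2-morphisms to the underlying ones

attribute [simp] Hom.dom_eq Hom.cod_eq Hom2.src_eq Hom2.tgt_eq

section
variable {O : Type u} [TwoCatData.{u, v, w} O] [MonoidalData O] [SemistrictMonoidal O]
  {A B C X Y : O}

@[simp] theorem mor_id (A : O) : (Hom.id A).mor = one A := rfl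
@[simp] theorem mor_comp (f : Hom A B) (g : Hom B C) : (f.comp g).mor = f.mor ⨾ g.mor := rfl
@[simp] theorem mor_lten (X : O) (f : Hom A B) : (f.lten X).mor = X ◁₁ f.mor := rfl
@[simp] theorem mor_rten (X : O) (f : Hom A B) : (f.rten X).mor = f.mor ▷₁ X := rfl
@[simp] theorem mor_cast (f : Hom A B) (hA : A = X) (hB : B = Y) : (f.cast hA hB).mor = f.mor := rfl

@[simp] theorem cell_id (f : Hom A B) : (Hom2.id f).cell = idc f.mor := rfl
@[simp] theorem cell_vcomp {f g h : Hom A B} (α : Hom2 f g) (β : Hom2 g h) :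
    (α.vcomp β).cell = α.cell ⬝ β.cell := rfl
@[simp] theorem cell_hcomp {f g : Hom A B} {h k : Hom B C} (α : Hom2 f g) (β : Hom2 h k) :
    (α.hcomp β).cell = α.cell ⊚ β.cell := rfl
@[simp] theorem cell_lten {f g : Hom A B} (X : O) (α : Hom2 f g) :
    (α.lten X).cell = X ◁₂ α.cell := rfl
@[simp] theorem cell_rten {f g : Hom A B} (X : O) (α : Hom2 f g) :
    (α.rten X).cell = α.cell ▷₂ X := rfl
@[simp] theorem cell_cast {f g : Hom A B} {f' g' : Hom X Y} (α : Hom2 f g) (hf : f.mor = f'.mor)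
    (hg : g.mor = g'.mor) : (α.cast hf hg).cell = α.cell := rfl

@[simp] theorem tensorator_lMor' (A : O) (f g : Mor O) :
    tensorator (A ◁₁ f) g = A ◁₂ tensorator f g := tensorator_lMor A f g
@[simp] theorem tensorator_mid' (f : Mor O) (A : O) (g : Mor O) :
    tensorator (f ▷₁ A) g = tensorator f (A ◁₁ g) := tensorator_mid f A g
@[simp] theorem tensorator_rMor' (f g : Mor O) (A : O) :
    tensorator f (g ▷₁ A) = tensorator f g ▷₂ A := tensorator_rMor f g A

attribute [simp] tensorator_one_left tensorator_one_right tensorator_comp_left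
  tensorator_comp_right

end

/-! ### Units, counits and partial traces of 1-morphisms -/

section
variable {O : Type u} [TwoCatData.{u, v, w} O] [MonoidalData O] [DualData O]
  [SemistrictMonoidalDuals O] {A B C D E : O}

@[simp] theorem mor_dual (f : Hom A B) : f.dual.mor = f.mor⋆₁ := rfl
@[simp] theorem mor_iHom (A : O) : (iHom A).mor = iObj A := rfl
@[simp] theorem mor_eHom (A : O) : (eHom A).mor = eObj A⋆ₒ := rfl

/-- `i_f : 1 ⇒ f f*`. -/
def unitHom (f : Hom A B) : Hom2 (Hom.id A) (f.comp f.dual) where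
  cell := iMor f.mor
  src_eq := by simp
  tgt_eq := by simp

/-- `i_f* : f f* ⇒ 1`. -/
def counitHom (f : Hom A B) : Hom2 (f.comp f.dual) (Hom.id A) where
  cell := (iMor f.mor)⋆₂
  src_eq := by simp
  tgt_eq := by simp

@[simp] theorem cell_unitHom (f : Hom A B) : (unitHom f).cell = iMor f.mor := rfl
@[simp] theorem cell_counitHom (f : Hom A B) : (counitHom f).cell = (iMor f.mor)⋆₂ := rfl

/-- The right partial trace `f ⇒ f'` of a 2-morphism `x : fg ⇒ f'g`. -/
def ptr (f f' : Hom A B) (g : Hom B C) (x : Hom2 (f.comp g) (f'.comp g)) : Hom2 f f' where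
  cell := (idc f.mor ⊚ iMor g.mor) ⬝ (x.cell ⊚ idc g.mor⋆₁) ⬝ (idc f'.mor ⊚ (iMor g.mor)⋆₂)
  -- Composability side conditions nest with the length of a composite, and the default discharge
  -- depth of `simp` is too small for them; the same option recurs throughout.
  src_eq := by simp (maxDischargeDepth := 20)
  tgt_eq := by simp (maxDischargeDepth := 20)

theorem cell_ptr (f f' : Hom A B) (g : Hom B C) (x : Hom2 (f.comp g) (f'.comp g)) :
    (ptr f f' g x).cell =
      (idc f.mor ⊚ iMor g.mor) ⬝ (x.cell ⊚ idc g.mor⋆₁) ⬝ (idc f'.mor ⊚ (iMor g.mor)⋆₂) := rfl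

/-- Sliding `b` past the unit of `g`. -/
theorem iMor_tensorator (g : Hom B C) (b : Hom D E) :
    (iMor g.mor ▷₂ D ⊚ idc (B ◁₁ b.mor)) ⬝ ((idc (g.mor ▷₁ D) ⊚ tensorator g.mor⋆₁ b.mor) ⬝
      (tensorator g.mor b.mor ⊚ idc (g.mor⋆₁ ▷₁ E))) = idc (B ◁₁ b.mor) ⊚ iMor g.mor ▷₂ E := by
  have := tensorator_natural (iMor g.mor) (idc b.mor)
  simpa (maxDischargeDepth := 20) using this

/-- Naturality of the tensorator in its first variable, at the counit of `g g*`: the crossing of `b`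
with `g g*` is the composite of two crossings, and the crossing with an identity is trivial. -/
theorem tensorator_counit (g : Hom B C) (b : Hom D E) :
    (idc (g.mor ▷₁ D) ⊚ tensorator g.mor⋆₁ b.mor) ⬝ ((tensorator g.mor b.mor ⊚
      idc (g.mor⋆₁ ▷₁ E)) ⬝ (idc (B ◁₁ b.mor) ⊚ (iMor g.mor)⋆₂ ▷₂ E)) =
      (iMor g.mor)⋆₂ ▷₂ D ⊚ idc (B ◁₁ b.mor) := by
  have := tensorator_natural (iMor g.mor)⋆₂ (idc b.mor)
  simpa (maxDischargeDepth := 20) using this.symm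

@[simp] theorem tensorator_inv' (f : Hom A B) (g : Hom C D) :
    tensorator f.mor g.mor ⬝ tensoratorInv f.mor g.mor =
      idc ((f.mor ▷₁ C) ⨾ (B ◁₁ g.mor)) := by
  simp [tensorator_inv]

@[simp] theorem inv_tensorator' (f : Hom A B) (g : Hom C D) :
    tensoratorInv f.mor g.mor ⬝ tensorator f.mor g.mor =
      idc ((A ◁₁ g.mor) ⨾ (f.mor ▷₁ D)) := by
  simp [inv_tensorator]

/-- Obtained from `iMor_tensorator` by cancelling the crossing of `b` with `g`; only the crossing
with `g*` is left. -/
theorem unit_tensoratorInv (g : Hom B C) (b : Hom D E) :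
    (idc (B ◁₁ b.mor) ⊚ iMor g.mor ▷₂ E) ⬝ (tensoratorInv g.mor b.mor ⊚ idc (g.mor⋆₁ ▷₁ E)) =
    (iMor g.mor ▷₂ D ⊚ idc (B ◁₁ b.mor)) ⬝ (idc (g.mor ▷₁ D) ⊚ tensorator g.mor⋆₁ b.mor) := by
  have h : (tensorator g.mor b.mor ⊚ idc (g.mor⋆₁ ▷₁ E)) ⬝
      (tensoratorInv g.mor b.mor ⊚ idc (g.mor⋆₁ ▷₁ E)) =
      idc ((g.mor ▷₁ D) ⨾ (C ◁₁ b.mor) ⨾ (g.mor⋆₁ ▷₁ E)) := by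
    rw [← vcomp_hcomp_idc] <;> simp (maxDischargeDepth := 20)
  rw [← iMor_tensorator]
  simp (maxDischargeDepth := 20) [h]

/-- The strand `b` is pulled across the loop of `g`. At the unit this leaves a crossing of `b` with
`g*` (`unit_tensoratorInv`), which passes `x` by exchange and is absorbed at the counit
(`tensorator_counit`). What remains is `x` conjugated by the crossing of `b` with `g`. -/
theorem ptr_tensorator (f f' : Hom A (B ⊗ₒ D)) (g : Hom B C) (b : Hom D E)
    (x : Hom2 (f.comp (g.rten D)) (f'.comp (g.rten D))) :
    (ptr f f' (g.rten D) x).cell ⊚ idc (B ◁₁ b.mor) =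
      (idc (f.mor ⨾ (B ◁₁ b.mor)) ⊚ iMor g.mor ▷₂ E) ⬝
       (((idc f.mor ⊚ tensoratorInv g.mor b.mor) ⬝ (x.cell ⊚ idc (C ◁₁ b.mor)) ⬝
         (idc f'.mor ⊚ tensorator g.mor b.mor)) ⊚ idc (g.mor⋆₁ ▷₁ E)) ⬝
       (idc (f'.mor ⨾ (B ◁₁ b.mor)) ⊚ (iMor g.mor)⋆₂ ▷₂ E) := by
  have h1 := congrArg (idc f.mor ⊚ ·) (unit_tensoratorInv g b)
  have h2 := congrArg (idc f'.mor ⊚ ·) (tensorator_counit g b)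
  have h3 := exchange x.cell (tensorator g.mor⋆₁ b.mor) (by simp (maxDischargeDepth := 20))
  simp (maxDischargeDepth := 20) at h1 h2 h3
  simp (maxDischargeDepth := 20) [cell_ptr]
  rw [vcomp_reassoc h1, ← h2, vcomp_reassoc h3]
  all_goals simp (maxDischargeDepth := 20)

end

/-! ### The trace: cyclicity and nesting -/

section
variable {O : Type u} [TwoCatData.{u, v, w} O] [MonoidalData O] [DualData O]
  [SemistrictMonoidalDuals O] {A B C D E : O}

/-- `α* : g ⇒ f` for `α : f ⇒ g`. -/
def dualHom2 {f g : Hom A B} (α : Hom2 f g) : Hom2 g f where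
  cell := α.cell⋆₂
  src_eq := by simp
  tgt_eq := by simp

@[simp] theorem cell_dualHom2 {f g : Hom A B} (α : Hom2 f g) :
    (dualHom2 α).cell = α.cell⋆₂ := rfl

/-- The adjoint `g* ⇒ f*` of `α : f ⇒ g`. -/
def adjHom2 {f g : Hom A B} (α : Hom2 f g) : Hom2 g.dual f.dual where
  cell := adj α.cell
  src_eq := by simp (maxDischargeDepth := 20) [adj]
  tgt_eq := by simp (maxDischargeDepth := 20) [adj]

@[simp] theorem src_adj {f g : Hom A B} (α : Hom2 f g) : src (adj α.cell) = g.mor⋆₁ :=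
  (adjHom2 α).src_eq

@[simp] theorem tgt_adj {f g : Hom A B} (α : Hom2 f g) : tgt (adj α.cell) = f.mor⋆₁ :=
  (adjHom2 α).tgt_eq

/-- Sliding a 2-morphism around a cap. -/
theorem iMor_slide {h k : Hom A B} (α : Hom2 h k) :
    iMor h.mor ⬝ (α.cell ⊚ idc h.mor⋆₁) = iMor k.mor ⬝ (idc k.mor ⊚ adj α.cell) := by
  have h1 := exchange (iMor k.mor) (iMor h.mor) (by simp (maxDischargeDepth := 20))
  have h2 := exchange (iMor k.mor) (α.cell ⊚ idc h.mor⋆₁) (by simp (maxDischargeDepth := 20))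
  have h3 := congrArg (· ⊚ idc h.mor⋆₁) (zigzag k.mor)
  simp (maxDischargeDepth := 20) at h1 h2 h3
  simp (maxDischargeDepth := 20) [adj]
  rw [vcomp_reassoc h1, vcomp_reassoc h2, h3]
  all_goals simp (maxDischargeDepth := 20)

/-- The dual of `iMor_slide` for `α*`; the compatibility of `†` with `*` turns the adjoint of the
dual back into the dual of the adjoint. -/
theorem counit_slide {h k : Hom A B} (α : Hom2 h k) :
    (α.cell ⊚ idc k.mor⋆₁) ⬝ (iMor k.mor)⋆₂ = (idc h.mor ⊚ adj α.cell) ⬝ (iMor h.mor)⋆₂ := by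
  have := congrArg dualCell (iMor_slide (dualHom2 α))
  have h := src_adj (dualHom2 α)
  simp only [cell_dualHom2] at h
  simpa (maxDischargeDepth := 20) [adj_dualCell, h] using this

/-- `α` slides over the unit onto the dual strand as `α†`, passes `β` there by exchange, and returns
through the counit on the other side of `β`. -/
theorem unit_trace_comm {h k : Hom A B} (α : Hom2 h k) (β : Hom2 k h) :
    iMor h.mor ⬝ ((α.cell ⬝ β.cell) ⊚ idc h.mor⋆₁) ⬝ (iMor h.mor)⋆₂ =
      iMor k.mor ⬝ ((β.cell ⬝ α.cell) ⊚ idc k.mor⋆₁) ⬝ (iMor k.mor)⋆₂ := by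
  have h1 := exchange β.cell (adj α.cell) (by simp)
  have h2 := vcomp_reassoc (iMor_slide α) ((β.cell ⊚ idc h.mor⋆₁) ⬝ (iMor h.mor)⋆₂)
  simp (maxDischargeDepth := 20) at h1 h2 ⊢
  rw [h2, vcomp_reassoc h1.symm, ← counit_slide]
  all_goals simp (maxDischargeDepth := 20)

variable (F : Type*) [Field F] [Preadditive2 O] [VectLinear F O]

/-- The trace of a 2-endomorphism of `f`, so that `⟨α,β⟩` is the trace of `α · β`. -/
noncomputable def tr {A B : O} (f : Hom A B) : Hom2 f f →ₗ[F] F :=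
    ((scalar F).toLinearMap ∘ₗ
      (vcompL F _ _ _).flip (cupHom f) ∘ₗ
      vcompL F _ _ _ (capHom f) ∘ₗ
      (hcompL F _ _ _ _).flip (Hom2.id (eHom A)) ∘ₗ
      hcompL F _ _ _ _ (Hom2.id (iHom A)) ∘ₗ
      rtenL F _ _ A⋆ₒ ∘ₗ
      (hcompL F _ _ _ _).flip (Hom2.id f.dual))

theorem pairing_eq_tr {f g : Hom A B} (α : Hom2 f g) (β : Hom2 g f) :
    pairing F f g α β = tr F f (α.vcomp β) := rfl

theorem cell_capHom (f : Hom A B) : (capHom f).cell = iMor (iObj A ⨾ (f.mor ▷₁ A⋆ₒ)) := by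
  change iMor (iObj (dom f.mor) ⨾ (f.mor ▷₁ (dom f.mor)⋆ₒ)) = _
  simp

theorem cell_cupHom (f : Hom A B) :
    (cupHom f).cell = (iMor (iObj A ⨾ (f.mor ▷₁ A⋆ₒ)))⋆₂ :=
  congrArg dualCell (cell_capHom f)

/-- Since the adjoint of `i_A` is `e_{A*}`, closing up `f` and then the object `A` is the same as
closing up the single 1-morphism `i_A (f ⊗ A*)`. Properties of `tr` thereby reduce to those of
unit-counit loops. -/
theorem scalar_symm_tr (f : Hom A B) (x : Hom2 f f) :
    ((scalar F).symm (tr F f x)).cell =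
      iMor (iObj A ⨾ (f.mor ▷₁ A⋆ₒ)) ⬝ ((idc (iObj A) ⊚ (x.cell ▷₂ A⋆ₒ)) ⊚
        idc (iObj A ⨾ (f.mor ▷₁ A⋆ₒ))⋆₁) ⬝ (iMor (iObj A ⨾ (f.mor ▷₁ A⋆ₒ)))⋆₂ := by
  have e : (scalar F).symm (tr F f x) =
      ((capHom f).vcomp (((Hom2.id (iHom A)).hcomp
        ((x.hcomp (Hom2.id f.dual)).rten A⋆ₒ)).hcomp (Hom2.id (eHom A)))).vcomp
          (cupHom f) := by
    rw [LinearEquiv.symm_apply_eq]; rfl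
  rw [e]
  change (capHom f).cell ⬝ ((idc (iObj A) ⊚ ((x.cell ⊚ idc f.mor⋆₁) ▷₂ A⋆ₒ)) ⊚ idc (eObj A⋆ₒ)) ⬝
    (cupHom f).cell = _
  simp (maxDischargeDepth := 20) [cell_capHom, cell_cupHom, eObj_dual]

theorem tr_comm {f g : Hom A B} (α : Hom2 f g) (β : Hom2 g f) :
    tr F f (α.vcomp β) = tr F g (β.vcomp α) := by
  apply (scalar F (O := O)).symm.injective
  ext1
  rw [scalar_symm_tr, scalar_symm_tr]
  have := unit_trace_comm ((Hom2.id (iHom A)).hcomp (α.rten A⋆ₒ))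
    ((Hom2.id (iHom A)).hcomp (β.rten A⋆ₒ))
  simpa (maxDischargeDepth := 20) using this

/-- The unit of a composite is the unit of `f` with the unit of `g` nested inside, so the loop of
`fg` is a loop of `g` inside a loop of `f`. -/
theorem tr_comp (f : Hom A B) (g : Hom B C) (x : Hom2 (f.comp g) (f.comp g)) :
    tr F (f.comp g) x = tr F f (ptr f f g x) := by
  apply (scalar F (O := O)).symm.injective
  ext1
  rw [scalar_symm_tr, scalar_symm_tr]
  have h := iMor_comp (iObj A ⨾ (f.mor ▷₁ A⋆ₒ)) (g.mor ▷₁ A⋆ₒ) (by simp)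
  simp (maxDischargeDepth := 20) at h
  simp (maxDischargeDepth := 20) [cell_ptr, h]

end

/-! ### Zero and finite sums under the operations on 2-morphisms -/

section
variable {O : Type u} [TwoCatData.{u, v, w} O] [MonoidalData O] [SemistrictMonoidal O]
  [Preadditive2 O] (F : Type*) [Field F] [VectLinear F O] {A B C D X Y : O}

include F

theorem zero_vcomp {f g h : Hom A B} (β : Hom2 g h) : (0 : Hom2 f g).vcomp β = 0 :=
  LinearMap.map_zero₂ (vcompL F f g h) β

theorem vcomp_zero {f g h : Hom A B} (α : Hom2 f g) : α.vcomp (0 : Hom2 g h) = 0 :=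
  (vcompL F f g h α).map_zero

theorem zero_hcomp {f g : Hom A B} {h k : Hom B C} (β : Hom2 h k) : (0 : Hom2 f g).hcomp β = 0 :=
  LinearMap.map_zero₂ (hcompL F f g h k) β

theorem hcomp_zero {f g : Hom A B} {h k : Hom B C} (α : Hom2 f g) : α.hcomp (0 : Hom2 h k) = 0 :=
  (hcompL F f g h k α).map_zero

theorem zero_lten {f g : Hom A B} (X : O) : (0 : Hom2 f g).lten X = 0 := (ltenL F X f g).map_zero

theorem zero_rten {f g : Hom A B} (X : O) : (0 : Hom2 f g).rten X = 0 := (rtenL F f g X).map_zero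

theorem sum_vcomp {ι : Type*} (s : Finset ι) {f g h : Hom A B} (α : ι → Hom2 f g)
    (β : Hom2 g h) : (∑ i ∈ s, α i).vcomp β = ∑ i ∈ s, (α i).vcomp β :=
  map_sum ((vcompL F f g h).flip β) α s

theorem vcomp_sum {ι : Type*} (s : Finset ι) {f g h : Hom A B} (α : Hom2 f g)
    (β : ι → Hom2 g h) : α.vcomp (∑ i ∈ s, β i) = ∑ i ∈ s, α.vcomp (β i) :=
  map_sum (vcompL F f g h α) β s

theorem hcomp_sum {ι : Type*} (s : Finset ι) {f g : Hom A B} {h k : Hom B C}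
    (α : Hom2 f g) (β : ι → Hom2 h k) : α.hcomp (∑ i ∈ s, β i) = ∑ i ∈ s, α.hcomp (β i) :=
  map_sum (hcompL F f g h k α) β s

theorem sum_lten {ι : Type*} (s : Finset ι) {f g : Hom A B} (X : O) (α : ι → Hom2 f g) :
    (∑ i ∈ s, α i).lten X = ∑ i ∈ s, (α i).lten X := map_sum (ltenL F X f g) α s

theorem sum_rten {ι : Type*} (s : Finset ι) {f g : Hom A B} (X : O) (α : ι → Hom2 f g) :
    (∑ i ∈ s, α i).rten X = ∑ i ∈ s, (α i).rten X := map_sum (rtenL F f g X) α s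

theorem cast_zero {A' B' : O} {f g : Hom A B} {f' g' : Hom A' B'} (hf : f.mor = f'.mor)
    (hg : g.mor = g'.mor) : ((0 : Hom2 f g).cast hf hg : Hom2 f' g') = 0 :=
  (castL F hf hg).map_zero

end

/-! ### Unit and associativity laws for typed 2-morphisms -/

section
variable {O : Type u} [TwoCatData.{u, v, w} O] [MonoidalData O] [SemistrictMonoidal O]
  {A B C D X Y : O}

theorem Hom2.id_vcomp {f g : Hom A B} (α : Hom2 f g) : (Hom2.id f).vcomp α = α := by
  ext1; simp

theorem Hom2.vcomp_id {f g : Hom A B} (α : Hom2 f g) : α.vcomp (Hom2.id g) = α := by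
  ext1; simp

theorem Hom2.vcomp_assoc {f g h k : Hom A B} (α : Hom2 f g) (β : Hom2 g h) (γ : Hom2 h k) :
    (α.vcomp β).vcomp γ = α.vcomp (β.vcomp γ) := by
  ext1; simp

end

/-! ### Quantum dimensions, simple 1-morphisms and semi-simplicity -/

section
variable {O : Type u} [TwoCatData.{u, v, w} O] [MonoidalData O] [DualData O]
  [SemistrictMonoidalDuals O] (F : Type*) [Field F] [Preadditive2 O] [VectLinear F O]
  {A B C D : O}

open Classical in
/-- The trace of a 2-endomorphism, on the class of all 2-morphisms. -/
noncomputable def trc (c : Cell O) : F :=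
  if h : src c = tgt c then tr F (⟨src c, rfl, rfl⟩ : Hom (dom (src c)) (cod (src c)))
    ⟨c, rfl, h.symm⟩ else 0

/-- Computing traces on underlying cells avoids transports between `Hom` types whose objects agree
only up to a strict equation. -/
theorem trc_cell (f : Hom A B) (x : Hom2 f f) : trc F x.cell = tr F f x := by
  obtain ⟨f, rfl, rfl⟩ := f
  obtain ⟨c, h1, h2⟩ := x
  dsimp only at h1 h2
  subst h1
  rw [trc, dif_pos h2.symm]

theorem trc_comm {f g : Hom A B} (α : Hom2 f g) (β : Hom2 g f) :
    trc F (α.cell ⬝ β.cell) = trc F (β.cell ⬝ α.cell) := by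
  rw [← cell_vcomp, ← cell_vcomp, trc_cell, trc_cell, tr_comm]

theorem trc_comp (f : Hom A B) (g : Hom B C) (x : Hom2 (f.comp g) (f.comp g)) :
    trc F x.cell = trc F (ptr f f g x).cell := by
  rw [trc_cell, trc_cell, tr_comp]

theorem dimMor_eq_tr (f : Hom A B) : dimMor F f = tr F f (Hom2.id f) := by
  rw [dimMor, pairing_eq_tr, Hom2.id_vcomp]

theorem dimObj_eq_dimMor (X : O) : dimObj F X = dimMor F (Hom.id X) := rfl

/-- Every 2-endomorphism is a multiple of the identity, so a vanishing dimension would put the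
identity in the radical of the pairing. -/
theorem dimMor_ne_zero [NonDegenerate F O] (f : Hom A B) (h : Module.finrank F (Hom2 f f) = 1) :
    dimMor F f ≠ 0 := by
  intro h0
  have : Nontrivial (Hom2 f f) := Module.nontrivial_of_finrank_pos (R := F) (by omega)
  have hid : Hom2.id f ≠ 0 := by
    intro hid
    obtain ⟨x, hx⟩ := exists_ne (0 : Hom2 f f)
    exact hx (by rw [← Hom2.id_vcomp x, hid, zero_vcomp F])
  apply hid
  refine (NonDegenerate.nondegenerate (F := F) f f).1 _ fun y => ?_
  obtain ⟨c, rfl⟩ := exists_smul_eq_of_finrank_eq_one h hid y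
  rw [map_smul]
  change c • dimMor F f = 0
  rw [h0, smul_zero]

/-- The scalar by which a 2-endomorphism of a simple 1-morphism acts is read off by taking traces.
-/
theorem eq_smul_id [NonDegenerate F O] (f : Hom A B) (h : Module.finrank F (Hom2 f f) = 1)
    (x : Hom2 f f) : x = (tr F f x / dimMor F f) • Hom2.id f := by
  have h0 := dimMor_ne_zero F f h
  have hid : Hom2.id f ≠ 0 := fun hid => h0 (by rw [dimMor_eq_tr, hid, map_zero])
  obtain ⟨c, rfl⟩ := exists_smul_eq_of_finrank_eq_one h hid x
  rw [map_smul, ← dimMor_eq_tr, smul_eq_mul, mul_div_cancel_right₀ _ h0]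

variable {F} {E : Finset O} (hE : FinitelySemisimple F E)
include hE

/-- Since `1_X 1_X = 1_X`, full faithfulness of composition gives `n * n = n` for the dimension `n`
of `2End(1_X)`, and `n ≠ 0` because `X` is non-zero. -/
theorem FinitelySemisimple.finrank_id {X : O} (hX : X ∈ E) :
    Module.finrank F (Hom2 (Hom.id X) (Hom.id X)) = 1 := by
  have e : (Hom.id X).comp (Hom.id X) = Hom.id X := by ext1; simp
  have h := (LinearEquiv.ofBijective _
    (hE.bijective X hX X X (Hom.id X) (Hom.id X) (Hom.id X) (Hom.id X))).finrank_eq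
  rw [Module.finrank_tensorProduct, e] at h
  have h0 : Module.finrank F (Hom2 (Hom.id X) (Hom.id X)) ≠ 0 := by
    intro h0
    obtain ⟨f, hf⟩ := hE.nonzero X hX
    have h1 : Hom2.id (Hom.id X) = 0 := by
      have := Module.finrank_zero_iff.mp h0
      exact Subsingleton.elim _ _
    apply hf
    have : Hom2.id f = (((Hom2.id (Hom.id X)).hcomp (Hom2.id f)).cast (by simp) (by simp) : Hom2 f f) := by
      ext1; simp
    rw [this, h1, zero_hcomp F, cast_zero F]
  exact Nat.eq_of_mul_eq_mul_left (Nat.pos_of_ne_zero h0) (by omega)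

/-- The equality `1_X f = f 1_Y` presents the identity of `f` as a 2-morphism between composites
through different objects of `E`. -/
theorem FinitelySemisimple.id_eq_zero {X Y : O} (hX : X ∈ E) (hY : Y ∈ E) (h : X ≠ Y)
    (f : Hom X Y) : Hom2.id f = 0 := by
  have h1 := hE.eq_zero X hX Y hY h X Y (Hom.id X) f f (Hom.id Y)
    ((Hom2.id f).cast (by simp) (by simp))
  have : Hom2.id f = (((Hom2.id f).cast (by simp) (by simp) :
      Hom2 ((Hom.id X).comp f) (f.comp (Hom.id Y))).cast (by simp) (by simp) : Hom2 f f) := by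
    ext1; simp
  rw [this, h1, cast_zero F]

/-- Every 1-endomorphism of `X` in `E` is a multiple of the identity. -/
theorem FinitelySemisimple.id_mem_span {X : O} (hX : X ∈ E) (h : Hom X X) :
    Hom2.id h ∈ Submodule.span F (Set.range fun q : Hom2 h (Hom.id X) × Hom2 (Hom.id X) h =>
      q.1.vcomp q.2) := by
  -- The identity of `h` is read as a 2-morphism `h 1_X ⇒ 1_X h`. By semi-simplicity it is a sum of
  -- `α ⊚ β` with `α : h ⇒ 1_X` and `β : 1_X ⇒ h`, and by interchange `α ⊚ β` is the vertical
  -- composite `α ⬝ β`.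
  obtain ⟨z, hz⟩ := (hE.bijective X hX X X h (Hom.id X) (Hom.id X) h).2
    ((Hom2.id h).cast (by simp) (by simp))
  have : Hom2.id h = castL F (by simp) (by simp) (TensorProduct.lift (hcompL F _ _ _ _) z) := by
    rw [hz]; rfl
  rw [this]
  clear this hz
  induction z using TensorProduct.induction_on with
  | zero => rw [map_zero, map_zero]; exact Submodule.zero_mem _
  | add x y hx hy => rw [map_add, map_add]; exact Submodule.add_mem _ hx hy
  | tmul α β =>
    refine Submodule.subset_span ⟨(α, β), ?_⟩
    ext1
    have := interchange α.cell (idc (one X)) (idc (one X)) β.cell (by simp) (by simp) (by simp)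
    simp at this
    exact this.symm

omit hE in
/-- A 2-morphism `t' t* ⇒ 1` factors through the counit of `t`. -/
theorem eq_hcomp_counit {X T : O} (t t' : Hom X T) (α : Hom2 (t'.comp t.dual) (Hom.id X)) :
    ∃ a : Hom2 t' t, α = (a.hcomp (Hom2.id t.dual)).vcomp (counitHom t) := by
  -- The witness is the mate of `α`: insert the unit `1 ⇒ t* t` on the right of `t'` and apply `α`.
  -- The dual of `zigzag_dual` straightens the strand.
  refine ⟨⟨(idc t'.mor ⊚ (eMor t.mor)⋆₂) ⬝ (α.cell ⊚ idc t.mor), ?_, ?_⟩, ?_⟩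
  · simp (maxDischargeDepth := 20)
  · simp (maxDischargeDepth := 20)
  · ext1
    have h1 := exchange α.cell (iMor t.mor)⋆₂ (by simp)
    have h2 := congrArg (fun x => idc t'.mor ⊚ x⋆₂) (zigzag_dual t.mor)
    simp (maxDischargeDepth := 20) at h1 h2
    simp (maxDischargeDepth := 20)
    rw [h1, vcomp_reassoc₁ h2]
    all_goals simp (maxDischargeDepth := 20)

omit hE in
-- The image of `eq_hcomp_counit` under duality of 2-morphisms.
theorem eq_unit_hcomp {X T : O} (t t' : Hom X T) (β : Hom2 (Hom.id X) (t'.comp t.dual)) :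
    ∃ b : Hom2 t t', β = (unitHom t).vcomp (b.hcomp (Hom2.id t.dual)) := by
  obtain ⟨a, ha⟩ := eq_hcomp_counit t t' (dualHom2 β)
  refine ⟨dualHom2 a, ?_⟩
  ext1
  have := congrArg (fun x => x.cell⋆₂) ha
  simpa using this

/-- The identity of `t' t*` is a combination of 2-morphisms through `1_X`, and each 2-morphism `t'
t* ⇒ 1_X` factors through some `t' ⇒ t`. -/
theorem FinitelySemisimple.id_comp_dual_eq_zero {X T : O} (hX : X ∈ E) (t t' : Hom X T)
    (h : ∀ a : Hom2 t' t, a = 0) : Hom2.id (t'.comp t.dual) = 0 := by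
  rw [← Submodule.mem_bot F]
  refine (Submodule.span_le.mpr ?_) (hE.id_mem_span hX (t'.comp t.dual))
  rintro _ ⟨⟨α, β⟩, rfl⟩
  obtain ⟨a, rfl⟩ := eq_hcomp_counit t t' α
  simp only [h a, zero_hcomp F, zero_vcomp F]
  exact Submodule.zero_mem _

/-- A loop of `t` is a scalar because `2End(1_X)` is one-dimensional; its trace is `dim t` by
nesting of traces. -/
theorem FinitelySemisimple.unit_counit [NonDegenerate F O] {X T : O} (hX : X ∈ E) (t : Hom X T) :
    (unitHom t).vcomp (counitHom t) = (dimMor F t / dimObj F X) • Hom2.id (Hom.id X) := by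
  rw [eq_smul_id F _ (hE.finrank_id hX) ((unitHom t).vcomp (counitHom t)), ← dimObj_eq_dimMor]
  congr 2
  rw [← trc_cell, dimMor_eq_tr, ← trc_cell]
  have := trc_comp F (Hom.id X) t (((Hom2.id t).cast (by simp) (by simp)))
  simpa [cell_ptr] using this.symm

/-- The surgery formula behind the factor `dim(e14)⁻¹`. The identity factors through `1_X`, and
because `t` is simple every such factorisation is a multiple of counit followed by unit. -/
theorem FinitelySemisimple.id_comp_dual_eq_smul [NonDegenerate F O] {X T : O} (hX : X ∈ E)
    (t : Hom X T) (ht : Module.finrank F (Hom2 t t) = 1) :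
    Hom2.id (t.comp t.dual) =
      (dimObj F X / dimMor F t) • (counitHom t).vcomp (unitHom t) := by
  have h1 : Hom2.id (t.comp t.dual) ∈
      Submodule.span F {(counitHom t).vcomp (unitHom t)} := by
    refine (Submodule.span_le.mpr ?_) (hE.id_mem_span hX (t.comp t.dual))
    rintro _ ⟨⟨α, β⟩, rfl⟩
    obtain ⟨a, rfl⟩ := eq_hcomp_counit t t α
    obtain ⟨b, rfl⟩ := eq_unit_hcomp t t β
    rw [eq_smul_id F t ht a, eq_smul_id F t ht b]
    refine Submodule.mem_span_singleton.mpr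
      ⟨(tr F t b / dimMor F t) * (tr F t a / dimMor F t), ?_⟩
    have e : (Hom2.id t).hcomp (Hom2.id t.dual) = Hom2.id (t.comp t.dual) := by ext1; simp
    simp only [VectLinear.smul_hcomp, VectLinear.smul_vcomp, VectLinear.vcomp_smul, smul_smul, e,
      Hom2.id_vcomp, Hom2.vcomp_id]
  -- The constant is found by composing with the unit of `t`, which produces a loop: `K * (dim t /
  -- dim X) = 1`.
  obtain ⟨K, hK⟩ := Submodule.mem_span_singleton.mp h1
  have h2 := congrArg (fun x => (unitHom t).vcomp x) hK
  simp only [VectLinear.vcomp_smul, Hom2.vcomp_id, ← Hom2.vcomp_assoc] at h2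
  rw [hE.unit_counit hX, VectLinear.smul_vcomp, Hom2.id_vcomp, smul_smul] at h2
  have h7 : dimObj F X ≠ 0 := dimMor_ne_zero F _ (hE.finrank_id hX)
  have h8 := dimMor_ne_zero F t ht
  have h3 : unitHom t ≠ 0 := by
    intro h0
    have h4 := congrArg (tr F (Hom.id X)) (hE.unit_counit hX t)
    rw [h0, zero_vcomp F, map_zero, map_smul, ← dimMor_eq_tr, ← dimObj_eq_dimMor, smul_eq_mul,
      div_mul_cancel₀ _ h7] at h4
    exact h8 h4.symm
  have h5 : K * (dimMor F t / dimObj F X) = 1 := by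
    have h6 : (K * (dimMor F t / dimObj F X) - 1) • unitHom t = 0 := by
      rw [sub_smul, one_smul, h2, sub_self]
    rcases smul_eq_zero.mp h6 with h | h
    · exact sub_eq_zero.mp h
    · exact absurd h h3
  rw [← hK]
  congr 1
  field_simp at h5 ⊢
  exact h5
end

/-! ### 2-morphisms between two-step composites -/

section
variable {O : Type u} [TwoCatData.{u, v, w} O] [MonoidalData O] [SemistrictMonoidal O]
  {A B C D X Y Z M : O}

@[simp] theorem mor_lComp {eij eik eil ejk ekl : O} (fijk : Hom eik (ejk ⊗ₒ eij))
    (fikl : Hom eil (ekl ⊗ₒ eik)) : (lComp fijk fikl).mor = fikl.mor ⨾ (ekl ◁₁ fijk.mor) := rfl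

@[simp] theorem mor_rComp {eij eil ejk ejl ekl : O} (fijl : Hom eil (ejl ⊗ₒ eij))
    (fjkl : Hom ejl (ekl ⊗ₒ ejk)) : (rComp fijl fjkl).mor = fijl.mor ⨾ (fjkl.mor ▷₁ eij) := rfl

/-- `a ∘ (b ⊗ e_{ij})` between 1-morphisms of the form `f_{i(jkl)}`. -/
def rCompCell {f f' : Hom A (X ⊗ₒ Y)} {g g' : Hom X (Z ⊗ₒ M)} (a : Hom2 f f') (b : Hom2 g g') :
    Hom2 (rComp f g) (rComp f' g') :=
  (a.hcomp (b.rten Y)).cast rfl rfl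

/-- `b ∘ (e_{kl} ⊗ a)` between 1-morphisms of the form `f_{(ijk)l}`. -/
def lCompCell {f f' : Hom X (Z ⊗ₒ M)} {g g' : Hom A (Y ⊗ₒ X)} (a : Hom2 f f') (b : Hom2 g g') :
    Hom2 (lComp f g) (lComp f' g') :=
  b.hcomp (a.lten Y)

@[simp] theorem cell_rCompCell {f f' : Hom A (X ⊗ₒ Y)} {g g' : Hom X (Z ⊗ₒ M)} (a : Hom2 f f')
    (b : Hom2 g g') : (rCompCell a b).cell = a.cell ⊚ (b.cell ▷₂ Y) := rfl

@[simp] theorem cell_lCompCell {f f' : Hom X (Z ⊗ₒ M)} {g g' : Hom A (Y ⊗ₒ X)} (a : Hom2 f f')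
    (b : Hom2 g g') : (lCompCell a b).cell = b.cell ⊚ (Y ◁₂ a.cell) := rfl

theorem lCompCell_id (f : Hom X (Z ⊗ₒ M)) (g : Hom A (Y ⊗ₒ X)) :
    lCompCell (Hom2.id f) (Hom2.id g) = Hom2.id (lComp f g) := by
  ext1; simp

theorem rCompCell_id (f : Hom A (X ⊗ₒ Y)) (g : Hom X (Z ⊗ₒ M)) :
    rCompCell (Hom2.id f) (Hom2.id g) = Hom2.id (rComp f g) := by
  ext1; simp

theorem lCompCell_id_vcomp {f : Hom X (Z ⊗ₒ M)} {g g' g'' : Hom A (Y ⊗ₒ X)} (b : Hom2 g g')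
    (b' : Hom2 g' g'') : lCompCell (Hom2.id f) (b.vcomp b') =
      (lCompCell (Hom2.id f) b).vcomp (lCompCell (Hom2.id f) b') := by
  ext1; simp

theorem rCompCell_id_vcomp {f : Hom A (X ⊗ₒ Y)} {g g' g'' : Hom X (Z ⊗ₒ M)} (b : Hom2 g g')
    (b' : Hom2 g' g'') : rCompCell (Hom2.id f) (b.vcomp b') =
      (rCompCell (Hom2.id f) b).vcomp (rCompCell (Hom2.id f) b') := by
  ext1; simp

theorem lCompCell_vcomp_id {f f' f'' : Hom X (Z ⊗ₒ M)} {g : Hom A (Y ⊗ₒ X)} (b : Hom2 f f')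
    (b' : Hom2 f' f'') : lCompCell (b.vcomp b') (Hom2.id g) =
      (lCompCell b (Hom2.id g)).vcomp (lCompCell b' (Hom2.id g)) := by
  ext1; simp

variable (F : Type*) [Field F] [Preadditive2 O] [VectLinear F O]

/-- `lCompCell` as a bilinear map. -/
def lCompCellL (f f' : Hom X (Z ⊗ₒ M)) (g g' : Hom A (Y ⊗ₒ X)) :
    Hom2 f f' →ₗ[F] Hom2 g g' →ₗ[F] Hom2 (lComp f g) (lComp f' g') :=
  (hcompL F g g' _ _).flip ∘ₗ ltenL F Y f f'

/-- `rCompCell` as a bilinear map. -/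
def rCompCellL (f f' : Hom A (X ⊗ₒ Y)) (g g' : Hom X (Z ⊗ₒ M)) :
    Hom2 f f' →ₗ[F] Hom2 g g' →ₗ[F] Hom2 (rComp f g) (rComp f' g') :=
  ((hcompL F f f' _ _).compr₂ (castL F (f' := rComp f g) (g' := rComp f' g') rfl rfl)).compl₂
    (rtenL F g g' Y)

theorem lCompCellL_apply {f f' : Hom X (Z ⊗ₒ M)} {g g' : Hom A (Y ⊗ₒ X)} (a : Hom2 f f')
    (b : Hom2 g g') : lCompCellL F f f' g g' a b = lCompCell a b := rfl

theorem rCompCellL_apply {f f' : Hom A (X ⊗ₒ Y)} {g g' : Hom X (Z ⊗ₒ M)} (a : Hom2 f f')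
    (b : Hom2 g g') : rCompCellL F f f' g g' a b = rCompCell a b := rfl

theorem cell_castL {f g : Hom A B} {f' g' : Hom X Y} (hf : f.mor = f'.mor)
    (hg : g.mor = g'.mor) (α : Hom2 f g) : (castL F hf hg α : Hom2 f' g').cell = α.cell := rfl

/-- `γ ⊗ α ↦ (γ ∘ (Z ⊗ r ⊗ Y)) · (u ∘ (α ⊗ Y))`. -/
def gammaAlpha {R S : O} (p : Hom A (Z ⊗ₒ M ⊗ₒ Y)) (u : Hom A (X ⊗ₒ Y)) (f : Hom X (Z ⊗ₒ M))
    (r : Hom M (R ⊗ₒ S)) (k : Hom X (Z ⊗ₒ R ⊗ₒ S)) :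
    Hom2 p (rComp u f) →ₗ[F] Hom2 (lComp r f) k →ₗ[F]
      Hom2 (p.comp ((r.rten Y).lten Z)) (rComp u k) :=
  (vcompL F _ _ _).compl₁₂
    ((hcompL F p (rComp u f) _ _).flip (Hom2.id ((r.rten Y).lten Z)))
    (castL F (by simp) (by simp) ∘ₗ hcompL F _ _ _ _ (Hom2.id u) ∘ₗ rtenL F (lComp r f) k Y)

theorem cell_gammaAlpha {R S : O} (p : Hom A (Z ⊗ₒ M ⊗ₒ Y)) (u : Hom A (X ⊗ₒ Y))
    (f : Hom X (Z ⊗ₒ M)) (r : Hom M (R ⊗ₒ S)) (k : Hom X (Z ⊗ₒ R ⊗ₒ S))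
    (γ : Hom2 p (rComp u f)) (α : Hom2 (lComp r f) k) :
    (gammaAlpha F p u f r k γ α).cell = (γ.cell ⊚ idc (Z ◁₁ (r.mor ▷₁ Y))) ⬝
      (idc u.mor ⊚ (α.cell ▷₂ Y)) := rfl

/-- `γ ⊗ α ↦ (u ∘ (α ⊗ Y)) · (γ ∘ (Z ⊗ r ⊗ Y))`. -/
def alphaGamma {R S : O} (p : Hom A (Z ⊗ₒ M ⊗ₒ Y)) (u : Hom A (X ⊗ₒ Y)) (f : Hom X (Z ⊗ₒ M))
    (r : Hom M (R ⊗ₒ S)) (k : Hom X (Z ⊗ₒ R ⊗ₒ S)) :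
    Hom2 k (lComp r f) →ₗ[F] Hom2 (rComp u f) p →ₗ[F]
      Hom2 (rComp u k) (p.comp ((r.rten Y).lten Z)) :=
  (vcompL F _ _ _).compl₁₂
    (castL F (by simp) (by simp) ∘ₗ hcompL F _ _ _ _ (Hom2.id u) ∘ₗ rtenL F k (lComp r f) Y)
    ((hcompL F (rComp u f) p _ _).flip (Hom2.id ((r.rten Y).lten Z)))

theorem cell_alphaGamma {R S : O} (p : Hom A (Z ⊗ₒ M ⊗ₒ Y)) (u : Hom A (X ⊗ₒ Y))
    (f : Hom X (Z ⊗ₒ M)) (r : Hom M (R ⊗ₒ S)) (k : Hom X (Z ⊗ₒ R ⊗ₒ S))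
    (γ : Hom2 (rComp u f) p) (α : Hom2 k (lComp r f)) :
    (alphaGamma F p u f r k α γ).cell = (idc u.mor ⊚ (α.cell ▷₂ Y)) ⬝
      (γ.cell ⊚ idc (Z ◁₁ (r.mor ▷₁ Y))) := rfl

theorem exists_decomposition {S : Finset (Hom A B)} (hS : IsBasis F S) (h : Hom A B) :
    ∃ (n : ℕ) (s : Fin n → Hom A B) (q : ∀ k, Hom2 h (s k)) (j : ∀ k, Hom2 (s k) h),
      (∀ k, s k ∈ S) ∧ Hom2.id h = ∑ k, (q k).vcomp (j k) := by
  obtain ⟨n, s, hs, inj, proj, -, -, h3⟩ := hS.exists_sum h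
  exact ⟨n, s, proj, inj, hs, h3.symm⟩

end

/-! ### Partial traces over a triangle -/

section
variable {O : Type u} [TwoCatData.{u, v, w} O] [MonoidalData O] [DualData O]
  [SemistrictMonoidalDuals O] (F : Type*) [Field F] [Preadditive2 O] [VectLinear F O]
  {A B C D X Y Z M R S : O}

/-- The partial trace over `f_{ijk}` between 1-morphisms of the form `f_{(ijk)l}`. -/
def ptrLComp (f : Hom X (Z ⊗ₒ M)) (g g' : Hom A (Y ⊗ₒ X)) (x : Hom2 (lComp f g) (lComp f g')) :
    Hom2 g g' :=
  ptr g g' (f.lten Y) x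

/-- The partial trace over `f_{jkl}` between 1-morphisms of the form `f_{i(jkl)}`. -/
def ptrRComp (f f' : Hom A (X ⊗ₒ Y)) (g : Hom X (Z ⊗ₒ M)) (x : Hom2 (rComp f g) (rComp f' g)) :
    Hom2 f f' :=
  ptr f f' (g.rten Y) (x.cast rfl rfl)

theorem cell_ptrLComp (f : Hom X (Z ⊗ₒ M)) (g g' : Hom A (Y ⊗ₒ X))
    (x : Hom2 (lComp f g) (lComp f g')) : (ptrLComp f g g' x).cell =
      (idc g.mor ⊚ (Y ◁₂ iMor f.mor)) ⬝ (x.cell ⊚ idc (Y ◁₁ f.mor⋆₁)) ⬝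
        (idc g'.mor ⊚ (Y ◁₂ (iMor f.mor)⋆₂)) := by
  change (idc g.mor ⊚ iMor (Y ◁₁ f.mor)) ⬝ (x.cell ⊚ idc (Y ◁₁ f.mor)⋆₁) ⬝
    (idc g'.mor ⊚ (iMor (Y ◁₁ f.mor))⋆₂) = _
  simp

theorem cell_ptrRComp (f f' : Hom A (X ⊗ₒ Y)) (g : Hom X (Z ⊗ₒ M))
    (x : Hom2 (rComp f g) (rComp f' g)) : (ptrRComp f f' g x).cell =
      (idc f.mor ⊚ (iMor g.mor ▷₂ Y)) ⬝ (x.cell ⊚ idc (g.mor⋆₁ ▷₁ Y)) ⬝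
        (idc f'.mor ⊚ ((iMor g.mor)⋆₂ ▷₂ Y)) := by
  change (idc f.mor ⊚ iMor (g.mor ▷₁ Y)) ⬝ (x.cell ⊚ idc (g.mor ▷₁ Y)⋆₁) ⬝
    (idc f'.mor ⊚ (iMor (g.mor ▷₁ Y))⋆₂) = _
  simp

theorem tr_lComp (f : Hom X (Z ⊗ₒ M)) (g : Hom A (Y ⊗ₒ X)) (x : Hom2 (lComp f g) (lComp f g)) :
    tr F (lComp f g) x = tr F g (ptrLComp f g g x) :=
  tr_comp F g (f.lten Y) x

theorem tr_rComp (f : Hom A (X ⊗ₒ Y)) (g : Hom X (Z ⊗ₒ M)) (x : Hom2 (rComp f g) (rComp f g)) :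
    tr F (rComp f g) x = tr F f (ptrRComp f f g x) := by
  rw [← trc_cell, ← trc_cell]
  exact trc_comp F f (g.rten Y) (x.cast rfl rfl)

/-- Closing up `Z ⊗ r ⊗ Y` first, the loop of `r` slides off `γ` and `γ'` and encloses only `α ⬝
α'`. The partial trace that appears is a 2-morphism `f ⇒ f'`, to which the simplicity of basis
elements applies. -/
theorem pairing_gammaAlpha (p : Hom A (Z ⊗ₒ M ⊗ₒ Y)) (u : Hom A (X ⊗ₒ Y)) (f f' : Hom X (Z ⊗ₒ M))
    (r : Hom M (R ⊗ₒ S)) (k : Hom X (Z ⊗ₒ R ⊗ₒ S)) (γ : Hom2 p (rComp u f))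
    (α : Hom2 (lComp r f) k) (γ' : Hom2 (rComp u f') p) (α' : Hom2 k (lComp r f')) :
    pairing F _ _ (gammaAlpha F p u f r k γ α) (alphaGamma F p u f' r k α' γ') =
      tr F p ((γ.vcomp (rCompCell (Hom2.id u) (ptrLComp r f f' (α.vcomp α')))).vcomp γ') := by
  rw [pairing_eq_tr, tr_comp]
  congr 1
  ext1
  have h1 := exchange γ.cell (Z ◁₂ (iMor r.mor ▷₂ Y)) (by simp)
  have h2 := exchange γ'.cell (Z ◁₂ ((iMor r.mor)⋆₂ ▷₂ Y)) (by simp (maxDischargeDepth := 20))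
  simp (maxDischargeDepth := 20) at h1 h2
  simp (maxDischargeDepth := 20) [cell_ptr, cell_ptrLComp, cell_gammaAlpha, cell_alphaGamma]
  rw [vcomp_reassoc h1.symm, h2]
  all_goals simp (maxDischargeDepth := 20)

/-- The strand `r` is bent round, which makes `w` a composite through one 1-morphism; that
1-morphism is then split into members of `T`. -/
theorem mem_span_gammaAlpha {T : Finset (Hom X (Z ⊗ₒ M))} (hT : IsBasis F T)
    (p : Hom A (Z ⊗ₒ M ⊗ₒ Y)) (u : Hom A (X ⊗ₒ Y))
    (r : Hom M (R ⊗ₒ S)) (k : Hom X (Z ⊗ₒ R ⊗ₒ S))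
    (w : Hom2 (p.comp ((r.rten Y).lten Z)) (rComp u k)) :
    w ∈ Submodule.span F {x | ∃ f ∈ T, ∃ γ α, x = gammaAlpha F p u f r k γ α} := by
  -- With `f₀ = k (Z ⊗ r*)`, the first factor of `w` is `w` bent by the unit of `r` and the second
  -- is the counit of `r`; the zigzag identity recovers `w`.
  let f₀ : Hom X (Z ⊗ₒ M) := k.comp (r.dual.lten Z)
  let γ₀ : Hom2 p (rComp u f₀) :=
    ⟨(idc p.mor ⊚ (Z ◁₂ (iMor r.mor ▷₂ Y))) ⬝ (w.cell ⊚ idc (Z ◁₁ (r.mor⋆₁ ▷₁ Y))),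
      by simp (maxDischargeDepth := 20), by simp (maxDischargeDepth := 20) [f₀]⟩
  let α₀ : Hom2 (lComp r f₀) k :=
    ⟨idc k.mor ⊚ (Z ◁₂ eMor r.mor), by simp (maxDischargeDepth := 20) [f₀],
      by simp (maxDischargeDepth := 20) [f₀]⟩
  have hw : w = gammaAlpha F p u f₀ r k γ₀ α₀ := by
    ext1
    have h1 := exchange w.cell (Z ◁₂ (eMor r.mor ▷₂ Y)) (by simp (maxDischargeDepth := 20))
    have h2 := congrArg (fun x => idc p.mor ⊚ (Z ◁₂ (x ▷₂ Y))) (zigzag r.mor)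
    simp (maxDischargeDepth := 20) at h1 h2
    simp (maxDischargeDepth := 20) [cell_gammaAlpha, γ₀, α₀]
    rw [h1, vcomp_reassoc₁ h2]
    all_goals simp (maxDischargeDepth := 20)
  -- The identity of `f₀` is resolved in front of `α₀`; the projections are then carried over to
  -- `γ₀`, the injections stay with `α₀`.
  obtain ⟨n, s, q, j, hs, hid⟩ := exists_decomposition F hT f₀
  have hα : α₀ = ∑ i, (lCompCell (Hom2.id r) (q i)).vcomp ((lCompCell (Hom2.id r) (j i)).vcomp α₀) := by
    simp only [← Hom2.vcomp_assoc, ← lCompCell_id_vcomp]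
    rw [← sum_vcomp F]
    simp only [← lCompCellL_apply F]
    rw [← map_sum, ← hid, lCompCellL_apply, lCompCell_id, Hom2.id_vcomp]
  rw [hw, hα, map_sum]
  refine Submodule.sum_mem _ fun i _ => Submodule.subset_span
    ⟨s i, hs i, γ₀.vcomp (rCompCell (Hom2.id u) (q i)), (lCompCell (Hom2.id r) (j i)).vcomp α₀, ?_⟩
  ext1
  simp (maxDischargeDepth := 20) [cell_gammaAlpha]

end

/-! ### Expansion of 2-morphisms along the basis for one triangle -/

section
variable {O : Type u} [TwoCatData.{u, v, w} O] [MonoidalData O] [DualData O]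
  [SemistrictMonoidalDuals O] (F : Type*) [Field F] [Preadditive2 O] [VectLinear F O]
  [NonDegenerate F O] {A B C D X Y Z M R S : O}

theorem dualEquiv₂_tmul (f f' : Hom A B) (g g' : Hom C D) (a : Hom2 f f') (b : Hom2 g g')
    (a' : Hom2 f' f) (b' : Hom2 g' g) :
    dualEquiv₂ F f f' g g' (a ⊗ₜ b) (a' ⊗ₜ b') = pairing F f f' a a' * pairing F g g' b b' :=
  rfl

theorem dualEquiv₃_tmul (f f' : Hom A B) (g g' : Hom C D) (h h' : Hom X Y) (a : Hom2 f f')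
    (b : Hom2 g g') (c : Hom2 h h') (a' : Hom2 f' f) (b' : Hom2 g' g) (c' : Hom2 h' h) :
    dualEquiv₃ F f f' g g' h h' (a ⊗ₜ (b ⊗ₜ c)) (a' ⊗ₜ (b' ⊗ₜ c')) =
      pairing F f f' a a' * (pairing F g g' b b' * pairing F h h' c c') :=
  rfl

theorem pairing_comm (f g : Hom A B) (a : Hom2 f g) (b : Hom2 g f) :
    pairing F f g a b = pairing F g f b a := by
  rw [pairing_eq_tr, pairing_eq_tr, tr_comm]

/-- The coordinates of `w` dual to `alphaGamma`. -/
noncomputable def coordAlphaGamma (p : Hom A (Z ⊗ₒ M ⊗ₒ Y)) (u : Hom A (X ⊗ₒ Y))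
    (f : Hom X (Z ⊗ₒ M)) (r : Hom M (R ⊗ₒ S)) (k : Hom X (Z ⊗ₒ R ⊗ₒ S)) :
    Hom2 (p.comp ((r.rten Y).lten Z)) (rComp u k) →ₗ[F]
      Hom2 (lComp r f) k ⊗[F] Hom2 p (rComp u f) :=
  (dualEquiv₂ F _ _ _ _).symm.toLinearMap ∘ₗ
    (pairing F _ _).compl₂ (TensorProduct.lift (alphaGamma F p u f r k))

theorem dualEquiv₂_coordAlphaGamma (p : Hom A (Z ⊗ₒ M ⊗ₒ Y)) (u : Hom A (X ⊗ₒ Y))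
    (f : Hom X (Z ⊗ₒ M)) (r : Hom M (R ⊗ₒ S)) (k : Hom X (Z ⊗ₒ R ⊗ₒ S))
    (w : Hom2 (p.comp ((r.rten Y).lten Z)) (rComp u k)) (α' : Hom2 k (lComp r f))
    (γ' : Hom2 (rComp u f) p) :
    dualEquiv₂ F _ _ _ _ (coordAlphaGamma F p u f r k w) (α' ⊗ₜ γ') =
      pairing F _ _ w (alphaGamma F p u f r k α' γ') := by
  simp [coordAlphaGamma]

/-- The value of the trace is a separate argument, so that for a partial trace it can be given as
the full trace by `tr_lComp` or `tr_rComp`. -/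
theorem ptr_eq_smul (f : Hom A B) (h : Module.finrank F (Hom2 f f) = 1) (x : Hom2 f f) {c : F}
    (hc : tr F f x = c) : x = (c / dimMor F f) • Hom2.id f := by
  rw [← hc]; exact eq_smul_id F f h x

/-- The partial trace in `pairing_gammaAlpha` is a 2-morphism between distinct members of the basis.
-/
theorem coordAlphaGamma_gammaAlpha_of_ne {T : Finset (Hom X (Z ⊗ₒ M))} (hT : IsBasis F T)
    (p : Hom A (Z ⊗ₒ M ⊗ₒ Y)) (u : Hom A (X ⊗ₒ Y))
    (r : Hom M (R ⊗ₒ S)) (k : Hom X (Z ⊗ₒ R ⊗ₒ S)) {f f' : Hom X (Z ⊗ₒ M)} (hf : f ∈ T)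
    (hf' : f' ∈ T) (h : f ≠ f') (γ : Hom2 p (rComp u f)) (α : Hom2 (lComp r f) k) :
    coordAlphaGamma F p u f' r k (gammaAlpha F p u f r k γ α) = 0 := by
  apply (dualEquiv₂ F _ _ _ _).injective
  ext α' γ'
  change dualEquiv₂ F _ _ _ _ (coordAlphaGamma F p u f' r k (gammaAlpha F p u f r k γ α))
    (α' ⊗ₜ γ') = dualEquiv₂ F _ _ _ _ 0 (α' ⊗ₜ γ')
  rw [dualEquiv₂_coordAlphaGamma, pairing_gammaAlpha, hT.eq_zero f hf f' hf' h (ptrLComp _ _ _ _), map_zero,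
    ← rCompCellL_apply F, map_zero, vcomp_zero F, zero_vcomp F, map_zero]
  rfl

/-- For a simple `f` the partial trace of `α ⬝ α'` is the scalar `⟨α,α'⟩ / dim f`; what remains is
`⟨γ,γ'⟩`. -/
theorem coordAlphaGamma_gammaAlpha_self (p : Hom A (Z ⊗ₒ M ⊗ₒ Y)) (u : Hom A (X ⊗ₒ Y))
    (r : Hom M (R ⊗ₒ S)) (k : Hom X (Z ⊗ₒ R ⊗ₒ S)) (f : Hom X (Z ⊗ₒ M))
    (hf : Module.finrank F (Hom2 f f) = 1) (γ : Hom2 p (rComp u f)) (α : Hom2 (lComp r f) k) :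
    coordAlphaGamma F p u f r k (gammaAlpha F p u f r k γ α) =
      (dimMor F f)⁻¹ • (α ⊗ₜ[F] γ) := by
  apply (dualEquiv₂ F _ _ _ _).injective
  ext α' γ'
  change dualEquiv₂ F _ _ _ _ (coordAlphaGamma F p u f r k (gammaAlpha F p u f r k γ α))
    (α' ⊗ₜ γ') = dualEquiv₂ F _ _ _ _ ((dimMor F f)⁻¹ • (α ⊗ₜ[F] γ)) (α' ⊗ₜ γ')
  rw [dualEquiv₂_coordAlphaGamma, pairing_gammaAlpha, map_smul, LinearMap.smul_apply,
    dualEquiv₂_tmul, ptr_eq_smul F f hf (ptrLComp r f f (α.vcomp α')) (tr_lComp F r f _).symm,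
    ← pairing_eq_tr, ← rCompCellL_apply F, map_smul, rCompCellL_apply, rCompCell_id,
    VectLinear.vcomp_smul, Hom2.vcomp_id, map_smul, LinearMap.smul_apply]
  rw [← pairing_eq_tr F α α', smul_eq_mul, smul_eq_mul]
  ring

/-- The decomposition of 2-morphisms `p (Z ⊗ r ⊗ Y) ⇒ u (k ⊗ Y)` along the basis of
`Hom(X, Z ⊗ M)`. -/
theorem sum_gammaAlpha {T : Finset (Hom X (Z ⊗ₒ M))} (hT : IsBasis F T)
    (p : Hom A (Z ⊗ₒ M ⊗ₒ Y)) (u : Hom A (X ⊗ₒ Y))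
    (r : Hom M (R ⊗ₒ S)) (k : Hom X (Z ⊗ₒ R ⊗ₒ S))
    (w : Hom2 (p.comp ((r.rten Y).lten Z)) (rComp u k)) :
    ∑ f ∈ T, dimMor F f • TensorProduct.lift (gammaAlpha F p u f r k).flip
      (coordAlphaGamma F p u f r k w) = w := by
  -- Linearity reduces the identity to a generator. There orthogonality leaves one summand, whose
  -- weight `dim f` cancels the `1 / dim f` in its coordinates.
  have hw := mem_span_gammaAlpha F hT p u r k w
  induction hw using Submodule.span_induction with
  | zero => simp
  | add x y _ _ hx hy =>
    conv_rhs => rw [← hx, ← hy]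
    simp only [map_add, smul_add, Finset.sum_add_distrib]
  | smul c x _ hx =>
    conv_rhs => rw [← hx]
    simp only [map_smul, Finset.smul_sum, smul_comm c]
  | mem x hx =>
    obtain ⟨f, hf, γ, α, rfl⟩ := hx
    rw [Finset.sum_eq_single_of_mem f hf]
    · rw [coordAlphaGamma_gammaAlpha_self F p u r k f (hT.finrank_end f hf), map_smul, smul_smul,
        mul_inv_cancel₀ (dimMor_ne_zero F f (hT.finrank_end f hf)), one_smul]
      rfl
    · intro f' hf' h
      rw [coordAlphaGamma_gammaAlpha_of_ne F hT p u r k hf hf' h.symm, map_zero, smul_zero]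

end

/-! ### Underlying cells of the composites attached to a 4-simplex -/

section
variable {O : Type u} [TwoCatData.{u, v, w} O] [MonoidalData O] [SemistrictMonoidal O]
  {eij eik eil eim ejk ejl ejl' ejm ekl ekm elm : O}

@[simp] theorem mor_lComp₄ (fijk : Hom eik (ejk ⊗ₒ eij)) (fikl : Hom eil (ekl ⊗ₒ eik))
    (film : Hom eim (elm ⊗ₒ eil)) : (lComp₄ fijk fikl film).mor =
      film.mor ⨾ (elm ◁₁ fikl.mor) ⨾ (elm ◁₁ (ekl ◁₁ fijk.mor)) := rfl

@[simp] theorem mor_rComp₄ (fijm : Hom eim (ejm ⊗ₒ eij)) (fjkm : Hom ejm (ekm ⊗ₒ ejk))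
    (fklm : Hom ekm (elm ⊗ₒ ekl)) : (rComp₄ fijm fjkm fklm).mor =
      fijm.mor ⨾ (fjkm.mor ▷₁ eij) ⨾ (fklm.mor ▷₁ (ejk ⊗ₒ eij)) := rfl

variable (F : Type*) [Field F] [Preadditive2 O] [VectLinear F O]

theorem cell_epsGammaAlpha (fijk : Hom eik (ejk ⊗ₒ eij)) (fijl : Hom eil (ejl ⊗ₒ eij))
    (fijm : Hom eim (ejm ⊗ₒ eij)) (fikl : Hom eil (ekl ⊗ₒ eik)) (film : Hom eim (elm ⊗ₒ eil))
    (fjkl : Hom ejl (ekl ⊗ₒ ejk)) (fjkm : Hom ejm (ekm ⊗ₒ ejk)) (fjlm : Hom ejm (elm ⊗ₒ ejl))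
    (fklm : Hom ekm (elm ⊗ₒ ekl)) (α : TwoH fjkl fjkm fjlm fklm) (γ : TwoH fijl fijm film fjlm)
    (ε : TwoH fijk fijl fikl fjkl) :
    (epsGammaAlpha F fijk fijl fijm fikl film fjkl fjkm fjlm fklm (α ⊗ₜ (γ ⊗ₜ ε))).cell =
      ((idc film.mor ⊚ (elm ◁₂ ε.cell)) ⬝ (γ.cell ⊚ idc (elm ◁₁ (fjkl.mor ▷₁ eij)))) ⬝
        (idc fijm.mor ⊚ (α.cell ▷₂ eij)) := rfl

theorem cell_alphaGammaEps (fijk : Hom eik (ejk ⊗ₒ eij)) (fijl : Hom eil (ejl ⊗ₒ eij))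
    (fijm : Hom eim (ejm ⊗ₒ eij)) (fikl : Hom eil (ekl ⊗ₒ eik)) (film : Hom eim (elm ⊗ₒ eil))
    (fjkl : Hom ejl (ekl ⊗ₒ ejk)) (fjkm : Hom ejm (ekm ⊗ₒ ejk)) (fjlm : Hom ejm (elm ⊗ₒ ejl))
    (fklm : Hom ekm (elm ⊗ₒ ekl)) (α : TwoH' fjkl fjkm fjlm fklm)
    (γ : TwoH' fijl fijm film fjlm) (ε : TwoH' fijk fijl fikl fjkl) :
    (alphaGammaEps F fijk fijl fijm fikl film fjkl fjkm fjlm fklm (α ⊗ₜ (γ ⊗ₜ ε))).cell =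
      (idc fijm.mor ⊚ (α.cell ▷₂ eij)) ⬝ ((γ.cell ⊚ idc (elm ◁₁ (fjkl.mor ▷₁ eij))) ⬝
        (idc film.mor ⊚ (elm ◁₂ ε.cell))) := rfl

theorem cell_betaDelta (fijk : Hom eik (ejk ⊗ₒ eij)) (fijm : Hom eim (ejm ⊗ₒ eij))
    (fikl : Hom eil (ekl ⊗ₒ eik)) (fikm : Hom eim (ekm ⊗ₒ eik)) (film : Hom eim (elm ⊗ₒ eil))
    (fjkm : Hom ejm (ekm ⊗ₒ ejk)) (fklm : Hom ekm (elm ⊗ₒ ekl)) (β : TwoH fikl fikm film fklm)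
    (δ : TwoH fijk fijm fikm fjkm) :
    (betaDelta F fijk fijm fikl fikm film fjkm fklm (β ⊗ₜ δ)).cell =
      ((β.cell ⊚ idc (elm ◁₁ (ekl ◁₁ fijk.mor))) ⬝
        (idc fikm.mor ⊚ tensorator fklm.mor fijk.mor)) ⬝
        (δ.cell ⊚ idc (fklm.mor ▷₁ (ejk ⊗ₒ eij))) := rfl

theorem cell_deltaBeta (fijk : Hom eik (ejk ⊗ₒ eij)) (fijm : Hom eim (ejm ⊗ₒ eij))
    (fikl : Hom eil (ekl ⊗ₒ eik)) (fikm : Hom eim (ekm ⊗ₒ eik)) (film : Hom eim (elm ⊗ₒ eil))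
    (fjkm : Hom ejm (ekm ⊗ₒ ejk)) (fklm : Hom ekm (elm ⊗ₒ ekl)) (β : TwoH' fikl fikm film fklm)
    (δ : TwoH' fijk fijm fikm fjkm) :
    (deltaBeta F fijk fijm fikl fikm film fjkm fklm (β ⊗ₜ δ)).cell =
      ((δ.cell ⊚ idc (fklm.mor ▷₁ (ejk ⊗ₒ eij))) ⬝
        (idc fikm.mor ⊚ tensoratorInv fklm.mor fijk.mor)) ⬝
        (β.cell ⊚ idc (elm ◁₁ (ekl ◁₁ fijk.mor))) := rfl

end

/-! ### Cutting a loop -/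

section
variable {O : Type u} [TwoCatData.{u, v, w} O] [MonoidalData O] [DualData O]
  [SemistrictMonoidalDuals O] (F : Type*) [Field F] [Preadditive2 O] [VectLinear F O]

section
variable {A A1 A4 T1 T2 X X' Y Z : O}
  (c : Hom A (Z ⊗ₒ A4)) (d : Hom A (A1 ⊗ₒ Y)) (u : Hom A4 (X ⊗ₒ Y)) (u' : Hom A4 (X' ⊗ₒ Y))
  (t : Hom X (T1 ⊗ₒ T2)) (t' : Hom X' (T1 ⊗ₒ T2)) (s : Hom A1 (Z ⊗ₒ X)) (s' : Hom A1 (Z ⊗ₒ X'))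
  (γ : TwoH u d c s) (γ' : TwoH' u' d c s') (ξ : Hom2 (lComp t s) (lComp t' s'))
  (η : Hom2 (rComp u' t') (rComp u t))

/-- The 2-endomorphism of `c (Z ⊗ u)` in which the two strands `t' t*` pass through `ω`. -/
def loopCell (ω : Hom2 (t'.comp t.dual) (t'.comp t.dual)) : Hom2 (lComp u c) (lComp u c) :=
  Hom2.vcomp (g := (rComp d s').comp (((t'.comp t.dual).rten Y).lten Z))
    ⟨(idc (c.mor ⨾ (Z ◁₁ u.mor)) ⊚ (Z ◁₂ (iMor t.mor ▷₂ Y))) ⬝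
      ((γ.cell ⊚ idc (Z ◁₁ ((t.mor ⨾ t.mor⋆₁) ▷₁ Y))) ⬝
        (idc d.mor ⊚ ((ξ.cell ▷₂ Y) ⊚ idc (Z ◁₁ (t.mor⋆₁ ▷₁ Y))))),
      by simp (maxDischargeDepth := 20), by simp (maxDischargeDepth := 20)⟩
    ((γ'.hcomp ((ω.rten Y).lten Z)).vcomp
      ⟨(idc c.mor ⊚ ((Z ◁₂ η.cell) ⊚ idc (Z ◁₁ (t.mor⋆₁ ▷₁ Y)))) ⬝
        (idc (c.mor ⨾ (Z ◁₁ u.mor)) ⊚ (Z ◁₂ ((iMor t.mor)⋆₂ ▷₂ Y))),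
      by simp (maxDischargeDepth := 20), by simp (maxDischargeDepth := 20)⟩)

include F in
theorem loopCell_zero : loopCell c d u u' t t' s s' γ γ' ξ η 0 = 0 := by
  simp only [loopCell, zero_rten F, zero_lten F, hcomp_zero F, zero_vcomp F, vcomp_zero F]

/-- Linearity in `ω` is what allows the identity of `t' t*` to be replaced by zero or by its
factorisation through `1_X`. -/
theorem loopCell_smul (k : F) (ω : Hom2 (t'.comp t.dual) (t'.comp t.dual)) :
    loopCell c d u u' t t' s s' γ γ' ξ η (k • ω) =
      k • loopCell c d u u' t t' s s' γ γ' ξ η ω := by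
  simp only [loopCell, VectLinear.rten_smul, VectLinear.lten_smul, VectLinear.hcomp_smul,
    VectLinear.smul_vcomp, VectLinear.vcomp_smul]

/-- The strand `Z ⊗ t ⊗ Y` is closed up first; between `ξ` and `η` the strands are then `t' t*`, and
an identity may be inserted on them. -/
theorem trc_loop : trc F ((γ.cell ⊚ idc (Z ◁₁ (t.mor ▷₁ Y))) ⬝ ((idc d.mor ⊚ (ξ.cell ▷₂ Y)) ⬝
      ((γ'.cell ⊚ idc (Z ◁₁ (t'.mor ▷₁ Y))) ⬝ (idc c.mor ⊚ (Z ◁₂ η.cell))))) =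
    tr F (lComp u c) (loopCell c d u u' t t' s s' γ γ' ξ η (Hom2.id _)) := by
  have := trc_comp F (lComp u c) ((t.rten Y).lten Z)
    ⟨(γ.cell ⊚ idc (Z ◁₁ (t.mor ▷₁ Y))) ⬝ ((idc d.mor ⊚ (ξ.cell ▷₂ Y)) ⬝
      ((γ'.cell ⊚ idc (Z ◁₁ (t'.mor ▷₁ Y))) ⬝ (idc c.mor ⊚ (Z ◁₂ η.cell)))),
      by simp (maxDischargeDepth := 20), by simp (maxDischargeDepth := 20)⟩
  refine this.trans ?_
  rw [trc_cell]
  congr 1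
  ext1
  simp (maxDischargeDepth := 20) [cell_ptr, loopCell]

end

section
variable {A A1 A4 T1 T2 X Y Z : O}
  (c : Hom A (Z ⊗ₒ A4)) (d : Hom A (A1 ⊗ₒ Y)) (u : Hom A4 (X ⊗ₒ Y)) (u' : Hom A4 (X ⊗ₒ Y))
  (t : Hom X (T1 ⊗ₒ T2)) (s : Hom A1 (Z ⊗ₒ X)) (s' : Hom A1 (Z ⊗ₒ X))
  (γ : TwoH u d c s) (γ' : TwoH' u' d c s') (ξ : Hom2 (lComp t s) (lComp t s'))
  (η : Hom2 (rComp u' t) (rComp u t))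

/-- Counit followed by unit breaks the long loop into two, one around `ξ` and one around `η`; by
interchange each slides off `γ` and `γ'` and becomes a partial trace. -/
theorem loopCell_cut :
    loopCell c d u u' t t s s' γ γ' ξ η ((counitHom t).vcomp (unitHom t)) =
      (γ.vcomp (rCompCell (Hom2.id d) (ptrLComp t s s' ξ))).vcomp
        (γ'.vcomp (lCompCell (ptrRComp u' u t η) (Hom2.id c))) := by
  ext1
  have h1 := exchange γ.cell (Z ◁₂ (iMor t.mor ▷₂ Y)) (by simp (maxDischargeDepth := 20))
  have h2 := interchange (idc (d.mor ⨾ (s'.mor ▷₁ Y))) γ'.cell (Z ◁₂ ((iMor t.mor)⋆₂ ▷₂ Y))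
    (Z ◁₂ (iMor t.mor ▷₂ Y)) (by simp) (by simp) (by simp (maxDischargeDepth := 20))
  have h3 := interchange γ'.cell (idc (c.mor ⨾ (Z ◁₁ u'.mor))) (Z ◁₂ (idc (one X) ▷₂ Y))
    (Z ◁₂ (iMor t.mor ▷₂ Y)) (by simp) (by simp) (by simp (maxDischargeDepth := 20))
  simp (maxDischargeDepth := 20) at h1 h2 h3
  simp (maxDischargeDepth := 20) [cell_ptrLComp, cell_ptrRComp, loopCell]
  rw [h2, h3, vcomp_reassoc h1]
  all_goals simp (maxDischargeDepth := 20)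
end

end

/-! ### Orthogonality of the composites `εγα` and `αγε` -/

section
variable {O : Type u} [TwoCatData.{u, v, w} O] [MonoidalData O] [DualData O]
  [SemistrictMonoidalDuals O] (F : Type*) [Field F] [Preadditive2 O] [VectLinear F O]
  {eij eik eil eim ejk ejl ejl' ejm ekl ekm elm : O}
  (fijk : Hom eik (ejk ⊗ₒ eij)) (fijm : Hom eim (ejm ⊗ₒ eij)) (fikl : Hom eil (ekl ⊗ₒ eik))
  (film : Hom eim (elm ⊗ₒ eil)) (fjkm : Hom ejm (ekm ⊗ₒ ejk)) (fklm : Hom ekm (elm ⊗ₒ ekl))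

/-- Cyclicity moves `ε` to the end, next to `ε'`, while `α` and `α'` are already adjacent. The
result is a loop of `fjkl` around the two products, and the labels on the two sides may still
differ. -/
theorem pairing_epsGammaAlpha (fijl : Hom eil (ejl ⊗ₒ eij)) (fjkl : Hom ejl (ekl ⊗ₒ ejk))
    (fjlm : Hom ejm (elm ⊗ₒ ejl)) (fijl' : Hom eil (ejl' ⊗ₒ eij)) (fjkl' : Hom ejl' (ekl ⊗ₒ ejk))
    (fjlm' : Hom ejm (elm ⊗ₒ ejl')) (α : TwoH fjkl fjkm fjlm fklm) (γ : TwoH fijl fijm film fjlm)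
    (ε : TwoH fijk fijl fikl fjkl) (α' : TwoH' fjkl' fjkm fjlm' fklm)
    (γ' : TwoH' fijl' fijm film fjlm') (ε' : TwoH' fijk fijl' fikl fjkl') :
    pairing F _ _
      (epsGammaAlpha F fijk fijl fijm fikl film fjkl fjkm fjlm fklm (α ⊗ₜ (γ ⊗ₜ ε)))
      (alphaGammaEps F fijk fijl' fijm fikl film fjkl' fjkm fjlm' fklm (α' ⊗ₜ (γ' ⊗ₜ ε'))) =
    tr F (lComp fijl film) (loopCell film fijm fijl fijl' fjkl fjkl' fjlm fjlm' γ γ'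
      (α.vcomp α') (ε'.vcomp ε) (Hom2.id _)) := by
  have h := trc_comm F (epsL F fijk fijl fikl film fjkl ε)
    (((gammaL F fijl fijm film fjkl fjlm γ).vcomp (alphaL F fijm fjkl fjkm fjlm fklm α)).vcomp
      ((alphaL' F fijm fjkl' fjkm fjlm' fklm α').vcomp
        ((gammaL' F fijl' fijm film fjkl' fjlm' γ').vcomp (epsL' F fijk fijl' fikl film fjkl' ε'))))
  rw [← trc_loop, pairing_eq_tr, ← trc_cell]
  have h1 : ∀ c c' d d' : Cell O, c = c' → d = d' → trc F c' = trc F d' → trc F c = trc F d := by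
    rintro c _ d _ rfl rfl h; exact h
  refine h1 _ _ _ _ ?_ ?_ h
  · simp only [cell_vcomp, cell_epsGammaAlpha, cell_alphaGammaEps]
    change _ = (idc film.mor ⊚ (elm ◁₂ ε.cell)) ⬝
      ((γ.cell ⊚ idc (elm ◁₁ (fjkl.mor ▷₁ eij)) ⬝ (idc fijm.mor ⊚ (α.cell ▷₂ eij))) ⬝
      ((idc fijm.mor ⊚ (α'.cell ▷₂ eij)) ⬝ ((γ'.cell ⊚ idc (elm ◁₁ (fjkl'.mor ▷₁ eij))) ⬝
        (idc film.mor ⊚ (elm ◁₂ ε'.cell)))))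
    simp (maxDischargeDepth := 20)
  · change _ = ((γ.cell ⊚ idc (elm ◁₁ (fjkl.mor ▷₁ eij)) ⬝ (idc fijm.mor ⊚ (α.cell ▷₂ eij))) ⬝
      ((idc fijm.mor ⊚ (α'.cell ▷₂ eij)) ⬝ ((γ'.cell ⊚ idc (elm ◁₁ (fjkl'.mor ▷₁ eij))) ⬝
        (idc film.mor ⊚ (elm ◁₂ ε'.cell))))) ⬝ (idc film.mor ⊚ (elm ◁₂ ε.cell))
    simp (maxDischargeDepth := 20)

variable [NonDegenerate F O]

/-- The coordinates of a 2-morphism dual to `alphaGammaEps`. -/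
noncomputable def coordAlphaGammaEps (fijl : Hom eil (ejl ⊗ₒ eij)) (fjkl : Hom ejl (ekl ⊗ₒ ejk))
    (fjlm : Hom ejm (elm ⊗ₒ ejl)) : Hom2 (lComp₄ fijk fikl film) (rComp₄ fijm fjkm fklm) →ₗ[F]
      TwoH fjkl fjkm fjlm fklm ⊗[F] (TwoH fijl fijm film fjlm ⊗[F] TwoH fijk fijl fikl fjkl) :=
  (dualEquiv₃ F _ _ _ _ _ _).symm.toLinearMap ∘ₗ
    (pairing F (lComp₄ fijk fikl film) (rComp₄ fijm fjkm fklm)).compl₂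
      (alphaGammaEps F fijk fijl fijm fikl film fjkl fjkm fjlm fklm)

/-- The partition function sees its argument only through the composite `βδ`, so expanding `βδ` by
its coordinates yields the values of `Zplus`. -/
theorem Zplus_eq (fijl : Hom eil (ejl ⊗ₒ eij)) (fikm : Hom eim (ekm ⊗ₒ eik))
    (fjkl : Hom ejl (ekl ⊗ₒ ejk)) (fjlm : Hom ejm (elm ⊗ₒ ejl))
    (z : TwoH fikl fikm film fklm ⊗[F] TwoH fijk fijm fikm fjkm) :
    Zplus F fijk fijl fijm fikl fikm film fjkl fjkm fjlm fklm z =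
      coordAlphaGammaEps F fijk fijm fikl film fjkm fklm fijl fjkl fjlm
        (betaDelta F fijk fijm fikl fikm film fjkm fklm z) := rfl

theorem dualEquiv₃_coord (fijl : Hom eil (ejl ⊗ₒ eij)) (fjkl : Hom ejl (ekl ⊗ₒ ejk))
    (fjlm : Hom ejm (elm ⊗ₒ ejl)) (v : Hom2 (lComp₄ fijk fikl film) (rComp₄ fijm fjkm fklm))
    (y : TwoH' fjkl fjkm fjlm fklm ⊗[F]
      (TwoH' fijl fijm film fjlm ⊗[F] TwoH' fijk fijl fikl fjkl)) :
    dualEquiv₃ F _ _ _ _ _ _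
      (coordAlphaGammaEps F fijk fijm fikl film fjkm fklm fijl fjkl fjlm v) y =
      pairing F _ _ v (alphaGammaEps F fijk fijl fijm fikl film fjkl fjkm fjlm fklm y) := by
  simp [coordAlphaGammaEps]

theorem dualEquiv₃_ext {A B C D X Y : O} {f f' : Hom A B} {g g' : Hom C D} {h h' : Hom X Y}
    {x y : Hom2 f f' ⊗[F] (Hom2 g g' ⊗[F] Hom2 h h')}
    (hxy : ∀ a b c, dualEquiv₃ F f f' g g' h h' x (a ⊗ₜ (b ⊗ₜ c)) =
      dualEquiv₃ F f f' g g' h h' y (a ⊗ₜ (b ⊗ₜ c))) : x = y := by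
  apply (dualEquiv₃ F _ _ _ _ _ _).injective
  ext a b c
  exact hxy a b c

variable {F} {E : Finset O} (hE : FinitelySemisimple F E) {B : ∀ X Y : O, Finset (Hom X Y)}
  (hB : ∀ X Y, IsBasis F (B X Y))

/-- The identity in question sits inside the loop of `pairing_epsGammaAlpha`. This covers both
different objects `ejl`, `ejl'` and different basis elements `fjkl`, `fjkl'`. -/
theorem coord_epsGammaAlpha_eq_zero {fijl : Hom eil (ejl ⊗ₒ eij)} {fjkl : Hom ejl (ekl ⊗ₒ ejk)}
    {fjlm : Hom ejm (elm ⊗ₒ ejl)} {fijl' : Hom eil (ejl' ⊗ₒ eij)} {fjkl' : Hom ejl' (ekl ⊗ₒ ejk)}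
    {fjlm' : Hom ejm (elm ⊗ₒ ejl')}
    (h : Hom2.id (fjkl'.comp fjkl.dual) = 0)
    (α : TwoH fjkl fjkm fjlm fklm) (γ : TwoH fijl fijm film fjlm)
    (ε : TwoH fijk fijl fikl fjkl) :
    coordAlphaGammaEps F fijk fijm fikl film fjkm fklm fijl' fjkl' fjlm'
      (epsGammaAlpha F fijk fijl fijm fikl film fjkl fjkm fjlm fklm (α ⊗ₜ (γ ⊗ₜ ε))) = 0 := by
  refine dualEquiv₃_ext F fun α' γ' ε' => ?_
  rw [dualEquiv₃_coord, pairing_epsGammaAlpha, h, loopCell_zero F, map_zero, map_zero]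
  rfl

include hE in
-- The surgery formula is inserted into the loop. The other two labels may differ on the two sides,
-- so this serves both orthogonality and normalisation.
theorem coord_epsGammaAlpha {fijl : Hom eil (ejl ⊗ₒ eij)} {fjkl : Hom ejl (ekl ⊗ₒ ejk)}
    {fjlm : Hom ejm (elm ⊗ₒ ejl)} {fijl' : Hom eil (ejl ⊗ₒ eij)}
    {fjlm' : Hom ejm (elm ⊗ₒ ejl)} (hl : ejl ∈ E) (hjkl : Module.finrank F (Hom2 fjkl fjkl) = 1)
    (α : TwoH fjkl fjkm fjlm fklm) (γ : TwoH fijl fijm film fjlm)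
    (ε : TwoH fijk fijl fikl fjkl) (α' : TwoH' fjkl fjkm fjlm' fklm)
    (γ' : TwoH' fijl' fijm film fjlm') (ε' : TwoH' fijk fijl' fikl fjkl)  :
    dualEquiv₃ F _ _ _ _ _ _
    (coordAlphaGammaEps F fijk fijm fikl film fjkm fklm fijl' fjkl fjlm'
      (epsGammaAlpha F fijk fijl fijm fikl film fjkl fjkm fjlm fklm (α ⊗ₜ (γ ⊗ₜ ε))))
       (α' ⊗ₜ (γ' ⊗ₜ ε')) =
      (dimObj F ejl / dimMor F fjkl) * tr F _ ((γ.vcomp (rCompCell (Hom2.id fijm)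
        (ptrLComp fjkl fjlm fjlm' (α.vcomp α')))).vcomp
        (γ'.vcomp (lCompCell (ptrRComp fijl' fijl fjkl (ε'.vcomp ε)) (Hom2.id film)))) := by
  rw [dualEquiv₃_coord, pairing_epsGammaAlpha, hE.id_comp_dual_eq_smul hl fjkl hjkl,
    loopCell_smul F, map_smul, loopCell_cut, smul_eq_mul]

include hE hB in
-- The cut contributes `dim ejl / dim fjkl`, and the partial traces contribute `1 / dim fjlm` and `1
-- / dim fijl`; the product is the inverse of the weight in the sum over labels.
theorem coord_epsGammaAlpha_self {fijl : Hom eil (ejl ⊗ₒ eij)} {fjkl : Hom ejl (ekl ⊗ₒ ejk)}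
    {fjlm : Hom ejm (elm ⊗ₒ ejl)} (hl : ejl ∈ E) (h1 : fijl ∈ B _ _) (h2 : fjkl ∈ B _ _)
    (h3 : fjlm ∈ B _ _) (α : TwoH fjkl fjkm fjlm fklm) (γ : TwoH fijl fijm film fjlm)
    (ε : TwoH fijk fijl fikl fjkl) :
    coordAlphaGammaEps F fijk fijm fikl film fjkm fklm fijl fjkl fjlm
      (epsGammaAlpha F fijk fijl fijm fikl film fjkl fjkm fjlm fklm (α ⊗ₜ (γ ⊗ₜ ε))) =
    ((dimObj F ejl)⁻¹ * dimMor F fijl * dimMor F fjkl * dimMor F fjlm)⁻¹ •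
      (α ⊗ₜ (γ ⊗ₜ ε)) := by
  refine dualEquiv₃_ext F fun α' γ' ε' => ?_
  rw [coord_epsGammaAlpha fijk fijm fikl film fjkm fklm hE hl ((hB _ _).finrank_end _ h2),
    map_smul, LinearMap.smul_apply, dualEquiv₃_tmul,
    ptr_eq_smul F fjlm ((hB _ _).finrank_end _ h3) (ptrLComp fjkl fjlm fjlm (α.vcomp α'))
      (tr_lComp F _ _ _).symm,
    ptr_eq_smul F fijl ((hB _ _).finrank_end _ h1) (ptrRComp fijl fijl fjkl (ε'.vcomp ε))
      (tr_rComp F _ _ _).symm, ← rCompCellL_apply F, ← lCompCellL_apply F, map_smul, map_smul,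
      LinearMap.smul_apply, rCompCellL_apply, lCompCellL_apply, rCompCell_id, lCompCell_id]
  simp only [VectLinear.vcomp_smul, VectLinear.smul_vcomp, map_smul, Hom2.vcomp_id]
  rw [← pairing_eq_tr F α α', ← pairing_eq_tr F ε' ε, ← pairing_eq_tr F γ γ', pairing_comm F _ _ ε']
  simp only [smul_eq_mul, mul_inv, inv_inv, div_eq_mul_inv]
  ring

include hE hB in
-- One of the two partial traces left by the cut is a 2-morphism between distinct basis elements.
theorem coord_epsGammaAlpha_of_ne {fijl : Hom eil (ejl ⊗ₒ eij)} {fjkl : Hom ejl (ekl ⊗ₒ ejk)}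
    {fjlm : Hom ejm (elm ⊗ₒ ejl)} {fijl' : Hom eil (ejl ⊗ₒ eij)} {fjlm' : Hom ejm (elm ⊗ₒ ejl)}
    (hl : ejl ∈ E) (h1 : fijl ∈ B _ _) (h1' : fijl' ∈ B _ _) (h2 : fjkl ∈ B _ _)
    (h3 : fjlm ∈ B _ _) (h3' : fjlm' ∈ B _ _) (h : fijl ≠ fijl' ∨ fjlm ≠ fjlm')
    (α : TwoH fjkl fjkm fjlm fklm) (γ : TwoH fijl fijm film fjlm)
    (ε : TwoH fijk fijl fikl fjkl) :
    coordAlphaGammaEps F fijk fijm fikl film fjkm fklm fijl' fjkl fjlm'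
      (epsGammaAlpha F fijk fijl fijm fikl film fjkl fjkm fjlm fklm (α ⊗ₜ (γ ⊗ₜ ε))) = 0 := by
  refine dualEquiv₃_ext F fun α' γ' ε' => ?_
  rw [coord_epsGammaAlpha fijk fijm fikl film fjkm fklm hE hl ((hB _ _).finrank_end _ h2),
    map_zero, LinearMap.zero_apply]
  rcases h with h | h
  · rw [(hB _ _).eq_zero _ h1' _ h1 h.symm (ptrRComp _ _ _ _), ← lCompCellL_apply F, map_zero,
      LinearMap.zero_apply, vcomp_zero F, vcomp_zero F, map_zero, mul_zero]
  · rw [(hB _ _).eq_zero _ h3 _ h3' h (ptrLComp _ _ _ _), ← rCompCellL_apply F, map_zero,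
      vcomp_zero F, zero_vcomp F, map_zero, mul_zero]

end

/-! ### Spanning by the composites `εγα` -/

section
variable {O : Type u} [TwoCatData.{u, v, w} O] [MonoidalData O] [SemistrictMonoidal O]
  (F : Type*) [Field F] [Preadditive2 O] [VectLinear F O]
  {eij eik eil eim ejk ejl ejl' ejm ekl ekm elm : O}
  (fijk : Hom eik (ejk ⊗ₒ eij)) (fijm : Hom eim (ejm ⊗ₒ eij)) (fikl : Hom eil (ekl ⊗ₒ eik))
  (film : Hom eim (elm ⊗ₒ eil)) (fjkm : Hom ejm (ekm ⊗ₒ ejk)) (fklm : Hom ekm (elm ⊗ₒ ekl))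
  (E : Finset O) (B : ∀ X Y : O, Finset (Hom X Y))

/-- The span of the composites `εγα` over the labels in `E` and `B`. -/
def spanEpsGammaAlpha : Submodule F (Hom2 (lComp₄ fijk fikl film) (rComp₄ fijm fjkm fklm)) :=
  Submodule.span F {x | ∃ ejl ∈ E, ∃ fijl ∈ B eil (ejl ⊗ₒ eij), ∃ fjkl ∈ B ejl (ekl ⊗ₒ ejk),
    ∃ fjlm ∈ B ejm (elm ⊗ₒ ejl), ∃ α γ ε,
      x = epsGammaAlpha F fijk fijl fijm fikl film fjkl fjkm fjlm fklm (α ⊗ₜ (γ ⊗ₜ ε))}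

variable {B} (hB : ∀ X Y, IsBasis F (B X Y))
include hB

/-- Split `t` behind `ε`: the projections remain in `ε`, and the injections pass `γ` by exchange and
are absorbed by `α`. -/
theorem epsGammaAlpha_mem_of_mem_mem {X : O} (hX : X ∈ E) {u : Hom eil (X ⊗ₒ eij)}
    (hu : u ∈ B _ _) {s : Hom ejm (elm ⊗ₒ X)} (hs : s ∈ B _ _) (t : Hom X (ekl ⊗ₒ ejk))
    (α : TwoH t fjkm s fklm) (γ : TwoH u fijm film s) (ε : TwoH fijk u fikl t) :
    epsGammaAlpha F fijk u fijm fikl film t fjkm s fklm (α ⊗ₜ (γ ⊗ₜ ε)) ∈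
      spanEpsGammaAlpha F fijk fijm fikl film fjkm fklm E B := by
  obtain ⟨n, r, q, j, hr, hid⟩ := exists_decomposition F (hB _ _) t
  have hε : ε = ∑ i, (ε.vcomp (rCompCell (Hom2.id u) (q i))).vcomp (rCompCell (Hom2.id u) (j i)) := by
    simp only [Hom2.vcomp_assoc, ← rCompCell_id_vcomp]
    rw [← vcomp_sum F]
    simp only [← rCompCellL_apply F]
    rw [← map_sum, ← hid, rCompCellL_apply, rCompCell_id, Hom2.vcomp_id]
  rw [hε, TensorProduct.tmul_sum, TensorProduct.tmul_sum, map_sum]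
  refine Submodule.sum_mem _ fun i _ => Submodule.subset_span ⟨X, hX, u, hu, r i, hr i, s, hs,
    (lCompCell (j i) (Hom2.id s)).vcomp α, γ, ε.vcomp (rCompCell (Hom2.id u) (q i)), ?_⟩
  ext1
  have h1 := exchange γ.cell (elm ◁₂ ((j i).cell ▷₂ eij)) (by simp (maxDischargeDepth := 20))
  simp (maxDischargeDepth := 20) at h1
  simp (maxDischargeDepth := 20) [cell_epsGammaAlpha]
  rw [vcomp_reassoc h1]
  all_goals simp (maxDischargeDepth := 20)

/-- Split `s` behind `γ`: the injections are absorbed by `α`. -/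
theorem epsGammaAlpha_mem_of_mem {X : O} (hX : X ∈ E) {u : Hom eil (X ⊗ₒ eij)}
    (hu : u ∈ B _ _) (s : Hom ejm (elm ⊗ₒ X)) (t : Hom X (ekl ⊗ₒ ejk))
    (α : TwoH t fjkm s fklm) (γ : TwoH u fijm film s) (ε : TwoH fijk u fikl t) :
    epsGammaAlpha F fijk u fijm fikl film t fjkm s fklm (α ⊗ₜ (γ ⊗ₜ ε)) ∈
      spanEpsGammaAlpha F fijk fijm fikl film fjkm fklm E B := by
  obtain ⟨n, r, q, j, hr, hid⟩ := exists_decomposition F (hB _ _) s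
  have hγ : γ = ∑ i, (γ.vcomp (rCompCell (Hom2.id fijm) (q i))).vcomp
      (rCompCell (Hom2.id fijm) (j i)) := by
    simp only [Hom2.vcomp_assoc, ← rCompCell_id_vcomp]
    rw [← vcomp_sum F]
    simp only [← rCompCellL_apply F]
    rw [← map_sum, ← hid, rCompCellL_apply, rCompCell_id, Hom2.vcomp_id]
  rw [hγ, TensorProduct.sum_tmul, TensorProduct.tmul_sum, map_sum]
  refine Submodule.sum_mem _ fun i _ => ?_
  have : epsGammaAlpha F fijk u fijm fikl film t fjkm s fklm (α ⊗ₜ ((γ.vcomp (rCompCell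
      (Hom2.id fijm) (q i))).vcomp (rCompCell (Hom2.id fijm) (j i)) ⊗ₜ ε)) =
      epsGammaAlpha F fijk u fijm fikl film t fjkm (r i) fklm
        ((lCompCell (Hom2.id t) (j i)).vcomp α ⊗ₜ
          (γ.vcomp (rCompCell (Hom2.id fijm) (q i)) ⊗ₜ ε)) := by
    ext1
    simp (maxDischargeDepth := 20) [cell_epsGammaAlpha]
  rw [this]
  exact epsGammaAlpha_mem_of_mem_mem F fijk fijm fikl film fjkm fklm E hB hX hu (hr i) t _ _ _

/-- Split `u` in front of `γ`: the projections are absorbed by `ε`. -/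
theorem epsGammaAlpha_mem {X : O} (hX : X ∈ E) (u : Hom eil (X ⊗ₒ eij))
    (s : Hom ejm (elm ⊗ₒ X)) (t : Hom X (ekl ⊗ₒ ejk))
    (α : TwoH t fjkm s fklm) (γ : TwoH u fijm film s) (ε : TwoH fijk u fikl t) :
    epsGammaAlpha F fijk u fijm fikl film t fjkm s fklm (α ⊗ₜ (γ ⊗ₜ ε)) ∈
      spanEpsGammaAlpha F fijk fijm fikl film fjkm fklm E B := by
  obtain ⟨n, r, q, j, hr, hid⟩ := exists_decomposition F (hB _ _) u
  have hγ : γ = ∑ i, (lCompCell (q i) (Hom2.id film)).vcomp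
      ((lCompCell (j i) (Hom2.id film)).vcomp γ) := by
    simp only [← Hom2.vcomp_assoc, ← lCompCell_vcomp_id]
    rw [← sum_vcomp F]
    simp only [← lCompCellL_apply F]
    rw [← LinearMap.sum_apply, ← map_sum, ← hid, lCompCellL_apply, lCompCell_id, Hom2.id_vcomp]
  rw [hγ, TensorProduct.sum_tmul, TensorProduct.tmul_sum, map_sum]
  refine Submodule.sum_mem _ fun i _ => ?_
  have : epsGammaAlpha F fijk u fijm fikl film t fjkm s fklm (α ⊗ₜ
      ((lCompCell (q i) (Hom2.id film)).vcomp ((lCompCell (j i) (Hom2.id film)).vcomp γ) ⊗ₜ ε)) =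
      epsGammaAlpha F fijk (r i) fijm fikl film t fjkm s fklm
        (α ⊗ₜ ((lCompCell (j i) (Hom2.id film)).vcomp γ ⊗ₜ
          ε.vcomp (rCompCell (q i) (Hom2.id t)))) := by
    ext1
    simp (maxDischargeDepth := 20) [cell_epsGammaAlpha]
  rw [this]
  exact epsGammaAlpha_mem_of_mem F fijk fijm fikl film fjkm fklm E hB hX (hr i) s t _ _ _

variable {E}

theorem mem_spanEpsGammaAlpha (hE : FinitelySemisimple F E)
    (v : Hom2 (lComp₄ fijk fikl film) (rComp₄ fijm fjkm fklm)) :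
    v ∈ spanEpsGammaAlpha F fijk fijm fikl film fjkm fklm E B := by
  -- Semi-simplicity enters here: the identity of `ekl ⊗ ejk` splits into composites through objects
  -- of `E`, and whiskering `v` with this splitting does not change `v`.
  obtain ⟨n, r, hr, j, q, -, -, hid⟩ := hE.exists_sum _ _ (Hom.id (ekl ⊗ₒ ejk))
  -- Associativity of the tensor product is an equation and not definitional, so `v` is retyped with
  -- `ekl ⊗ ejk` as one factor.
  have hO : elm ⊗ₒ ekl ⊗ₒ ejk ⊗ₒ eij = elm ⊗ₒ (ekl ⊗ₒ ejk) ⊗ₒ eij := by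
    rw [tensor_assoc ekl ejk eij]
  let v' : Hom2 ((lComp₄ fijk fikl film).cast rfl hO) ((rComp₄ fijm fjkm fklm).cast rfl hO) :=
    ⟨v.cell, v.src_eq, v.tgt_eq⟩
  have h₁ : (((lComp₄ fijk fikl film).cast rfl hO).comp
      (((Hom.id (ekl ⊗ₒ ejk)).rten eij).lten elm)).mor = (lComp₄ fijk fikl film).mor := by
    simp (maxDischargeDepth := 20)
  have h₂ : (((rComp₄ fijm fjkm fklm).cast rfl hO).comp
      (((Hom.id (ekl ⊗ₒ ejk)).rten eij).lten elm)).mor = (rComp₄ fijm fjkm fklm).mor := by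
    simp (maxDischargeDepth := 20)
  have hv : v = ∑ i, castL F h₁ h₂ (v'.hcomp ((((q i).vcomp (j i)).rten eij).lten elm)) := by
    rw [← map_sum, ← hcomp_sum F, ← sum_lten F, ← sum_rten F, hid]
    ext1
    simp (maxDischargeDepth := 20) [cell_castL, v']
  rw [hv]
  refine Submodule.sum_mem _ fun i _ => ?_
  obtain ⟨X, hX, f, g, hfg⟩ := hr i
  have hm : (r i).mor = f.mor ⨾ g.mor := by rw [hfg]; rfl
  -- With `r i = f g`, the projection gives `ε`, `v` whiskered by `f` gives `γ`, and the injection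
  -- gives `α`. The labels are `a (f ⊗ eij)`, `g` and `b (elm ⊗ f)`, not yet basis elements.
  let a : Hom eil ((ekl ⊗ₒ ejk) ⊗ₒ eij) :=
    (lComp fijk fikl).cast rfl (tensor_assoc _ _ _).symm
  let b : Hom ejm (elm ⊗ₒ ekl ⊗ₒ ejk) := rComp fjkm fklm
  let ε : TwoH fijk (a.comp (f.rten eij)) fikl g :=
    ⟨idc a.mor ⊚ ((q i).cell ▷₂ eij), by simp [a], by simp (maxDischargeDepth := 20) [a, hm]⟩
  let γ : TwoH (a.comp (f.rten eij)) fijm film (b.comp (f.lten elm)) :=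
    ⟨v.cell ⊚ idc (elm ◁₁ (f.mor ▷₁ eij)), by simp (maxDischargeDepth := 20) [a],
      by simp (maxDischargeDepth := 20) [b]⟩
  let α : TwoH g fjkm (b.comp (f.lten elm)) fklm :=
    ⟨idc b.mor ⊚ (elm ◁₂ (j i).cell), by simp (maxDischargeDepth := 20) [b, hm],
      by simp [b]⟩
  have : castL F h₁ h₂ (v'.hcomp ((((q i).vcomp (j i)).rten eij).lten elm)) =
      epsGammaAlpha F fijk (a.comp (f.rten eij)) fijm fikl film g fjkm (b.comp (f.lten elm)) fklm
        (α ⊗ₜ (γ ⊗ₜ ε)) := by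
    ext1
    have h1 := interchange (idc (lComp₄ fijk fikl film).mor) v.cell (elm ◁₂ ((q i).cell ▷₂ eij))
      (elm ◁₂ ((j i).cell ▷₂ eij)) (by simp) (by simp) (by simp (maxDischargeDepth := 20))
    have h2 := interchange v.cell (idc (rComp₄ fijm fjkm fklm).mor) (idc (elm ◁₁ ((r i).mor ▷₁ eij)))
      (elm ◁₂ ((j i).cell ▷₂ eij)) (by simp) (by simp) (by simp (maxDischargeDepth := 20))
    simp (maxDischargeDepth := 20) [hm] at h1 h2
    simp (maxDischargeDepth := 20) [cell_epsGammaAlpha, cell_castL, hm, v', a, b, α, γ, ε]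
    rw [h1, h2]
  rw [this]
  exact epsGammaAlpha_mem F fijk fijm fikl film fjkm fklm E hB hX _ _ _ _ _ _

end

/-! ### Expansion along an edge and the three triangles at it -/

section
variable {O : Type u} [TwoCatData.{u, v, w} O] [MonoidalData O] [DualData O]
  [SemistrictMonoidalDuals O] {F : Type*} [Field F] [Preadditive2 O] [VectLinear F O]
  [NonDegenerate F O] {eij eik eil eim ejk ejl ejl' ejm ekl ekm elm : O}
  (fijk : Hom eik (ejk ⊗ₒ eij)) (fijm : Hom eim (ejm ⊗ₒ eij)) (fikl : Hom eil (ekl ⊗ₒ eik))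
  (film : Hom eim (elm ⊗ₒ eil)) (fjkm : Hom ejm (ekm ⊗ₒ ejk)) (fklm : Hom ekm (elm ⊗ₒ ekl))
  {E : Finset O} (hE : FinitelySemisimple F E) {B : ∀ X Y : O, Finset (Hom X Y)}
  (hB : ∀ X Y, IsBasis F (B X Y))
include hE hB

/-- The decomposition of 2-morphisms `f_{((ijk)l)m} ⇒ f_{i(j(klm))}` along `e_{jl}`. -/
theorem sum_epsGammaAlpha (v : Hom2 (lComp₄ fijk fikl film) (rComp₄ fijm fjkm fklm)) :
    ∑ ejl ∈ E, ∑ fijl ∈ B eil (ejl ⊗ₒ eij), ∑ fjkl ∈ B ejl (ekl ⊗ₒ ejk),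
      ∑ fjlm ∈ B ejm (elm ⊗ₒ ejl),
      ((dimObj F ejl)⁻¹ * dimMor F fijl * dimMor F fjkl * dimMor F fjlm) •
        epsGammaAlpha F fijk fijl fijm fikl film fjkl fjkm fjlm fklm
          (coordAlphaGammaEps F fijk fijm fikl film fjkm fklm fijl fjkl fjlm v) = v := by
  have hv := mem_spanEpsGammaAlpha F fijk fijm fikl film fjkm fklm hB hE v
  rw [spanEpsGammaAlpha] at hv
  induction hv using Submodule.span_induction with
  | zero => simp
  | add x y _ _ hx hy =>
    conv_rhs => rw [← hx, ← hy]
    simp only [map_add, smul_add, Finset.sum_add_distrib]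
  | smul c x _ hx =>
    conv_rhs => rw [← hx]
    simp only [map_smul, Finset.smul_sum, smul_comm c]
  | mem x hx =>
    obtain ⟨X, hX, u, hu, t, ht, s, hs, α, γ, ε, rfl⟩ := hx
    -- On a generator, orthogonality leaves only the summand with the same four labels, and
    -- `coord_epsGammaAlpha_self` makes its weight cancel.
    rw [Finset.sum_eq_single_of_mem X hX, Finset.sum_eq_single_of_mem u hu,
      Finset.sum_eq_single_of_mem t ht, Finset.sum_eq_single_of_mem s hs,
      coord_epsGammaAlpha_self fijk fijm fikl film fjkm fklm hE hB hX hu ht hs,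
      map_smul, smul_smul, mul_inv_cancel₀, one_smul]
    · have h1 := dimMor_ne_zero F _ ((hB _ _).finrank_end _ hu)
      have h2 := dimMor_ne_zero F _ ((hB _ _).finrank_end _ ht)
      have h3 := dimMor_ne_zero F _ ((hB _ _).finrank_end _ hs)
      have h4 : dimObj F X ≠ 0 := dimMor_ne_zero F _ (hE.finrank_id hX)
      positivity
    · intro s' hs' h
      rw [coord_epsGammaAlpha_of_ne fijk fijm fikl film fjkm fklm hE hB hX hu hu ht hs hs'
        (Or.inr h.symm), map_zero, smul_zero]
    · intro t' ht' h
      refine Finset.sum_eq_zero fun s' hs' => ?_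
      rw [coord_epsGammaAlpha_eq_zero fijk fijm fikl film fjkm fklm
        (hE.id_comp_dual_eq_zero hX t t' ((hB _ _).eq_zero _ ht' _ ht h)), map_zero, smul_zero]
    · intro u' hu' h
      refine Finset.sum_eq_zero fun t' ht' => Finset.sum_eq_zero fun s' hs' => ?_
      -- Here `t'` is still arbitrary: if it differs from `t` the loop vanishes before being cut,
      -- and otherwise the mismatch of `u` and `u'` kills a partial trace.
      by_cases htt : t' = t
      · subst htt
        rw [coord_epsGammaAlpha_of_ne fijk fijm fikl film fjkm fklm hE hB hX hu hu' ht hs hs'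
          (Or.inl h.symm), map_zero, smul_zero]
      · rw [coord_epsGammaAlpha_eq_zero fijk fijm fikl film fjkm fklm
          (hE.id_comp_dual_eq_zero hX t t' ((hB _ _).eq_zero _ ht' _ ht htt)), map_zero, smul_zero]
    · intro X' hX' h
      refine Finset.sum_eq_zero fun u' hu' => Finset.sum_eq_zero fun t' ht' =>
        Finset.sum_eq_zero fun s' hs' => ?_
      rw [coord_epsGammaAlpha_eq_zero fijk fijm fikl film fjkm fklm
          (hE.id_eq_zero hX' hX h (t'.comp t.dual)), map_zero, smul_zero]

end

/-! ### Contractions of Z(-) as partial traces -/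

section
variable {O : Type u} [TwoCatData.{u, v, w} O] [MonoidalData O] [DualData O]
  [SemistrictMonoidalDuals O] (F : Type*) [Field F] [Preadditive2 O] [VectLinear F O]
  {eij eik eil eim ejk ejl ejm ekl ekm elm : O}
  (fijk : Hom eik (ejk ⊗ₒ eij)) (fijm : Hom eim (ejm ⊗ₒ eij)) (fikl : Hom eil (ekl ⊗ₒ eik))
  (fikm : Hom eim (ekm ⊗ₒ eik))
  (film : Hom eim (elm ⊗ₒ eil)) (fjkm : Hom ejm (ekm ⊗ₒ ejk)) (fklm : Hom ekm (elm ⊗ₒ ekl))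
  (e : Hom2 (lComp₄ fijk fikl film) (rComp₄ fijm fjkm fklm))

/-- The element of `2H(ijkm)` that represents `δ ↦ ⟨δβ, e⟩`. -/
def betaContract (β : TwoH' fikl fikm film fklm) : TwoH fijk fijm fikm fjkm :=
  ptr (lComp fijk fikm) (rComp fijm fjkm) (fklm.rten (ejk ⊗ₒ eij))
    ⟨((idc fikm.mor ⊚ tensoratorInv fklm.mor fijk.mor) ⬝
        (β.cell ⊚ idc (elm ◁₁ (ekl ◁₁ fijk.mor)))) ⬝ e.cell,
      by simp (maxDischargeDepth := 20), by simp (maxDischargeDepth := 20)⟩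

/-- The element of `2H(iklm)` that represents `β ↦ ⟨δβ, e⟩`. -/
def deltaContract (δ : TwoH' fijk fijm fikm fjkm) : TwoH fikl fikm film fklm :=
  ptr (lComp fikl film) (rComp fikm fklm) ((fijk.lten ekl).lten elm)
    ⟨(e.cell ⬝ (δ.cell ⊚ idc (fklm.mor ▷₁ (ejk ⊗ₒ eij)))) ⬝
        (idc fikm.mor ⊚ tensoratorInv fklm.mor fijk.mor),
      by simp (maxDischargeDepth := 20), by simp (maxDischargeDepth := 20)⟩

theorem cell_betaContract (β : TwoH' fikl fikm film fklm) :
    (betaContract fijk fijm fikl fikm film fjkm fklm e β).cell =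
      (idc (lComp fijk fikm).mor ⊚ (iMor fklm.mor ▷₂ (ejk ⊗ₒ eij))) ⬝
      ((((idc fikm.mor ⊚ tensoratorInv fklm.mor fijk.mor) ⬝
        (β.cell ⊚ idc (elm ◁₁ (ekl ◁₁ fijk.mor)))) ⬝ e.cell) ⊚
          idc (fklm.mor⋆₁ ▷₁ (ejk ⊗ₒ eij))) ⬝
      (idc (rComp fijm fjkm).mor ⊚ ((iMor fklm.mor)⋆₂ ▷₂ (ejk ⊗ₒ eij))) := by
  simp (maxDischargeDepth := 20) [betaContract, cell_ptr]

theorem cell_deltaContract (δ : TwoH' fijk fijm fikm fjkm) :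
    (deltaContract fijk fijm fikl fikm film fjkm fklm e δ).cell =
      (idc (lComp fikl film).mor ⊚ (elm ◁₂ (ekl ◁₂ iMor fijk.mor))) ⬝
      (((e.cell ⬝ (δ.cell ⊚ idc (fklm.mor ▷₁ (ejk ⊗ₒ eij)))) ⬝
        (idc fikm.mor ⊚ tensoratorInv fklm.mor fijk.mor)) ⊚ idc (elm ◁₁ (ekl ◁₁ fijk.mor⋆₁))) ⬝
      (idc (rComp fikm fklm).mor ⊚ (elm ◁₂ (ekl ◁₂ (iMor fijk.mor)⋆₂))) := by
  simp (maxDischargeDepth := 20) [deltaContract, cell_ptr]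

/-- Rotate `δ` to the end and close up `fklm` first; its loop slides off `δ`, leaving a partial
trace that does not involve `δ`. -/
theorem pairing_betaContract (β : TwoH' fikl fikm film fklm) (δ : TwoH' fijk fijm fikm fjkm) :
    pairing F _ _ (betaContract fijk fijm fikl fikm film fjkm fklm e β) δ =
      pairing F _ _ (deltaBeta F fijk fijm fikl fikm film fjkm fklm (β ⊗ₜ δ)) e := by
  have h1 := trc_comp F (lComp fijk fikm) (fklm.rten (ejk ⊗ₒ eij))
    ⟨(((idc fikm.mor ⊚ tensoratorInv fklm.mor fijk.mor) ⬝
        (β.cell ⊚ idc (elm ◁₁ (ekl ◁₁ fijk.mor)))) ⬝ e.cell) ⬝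
        (δ.cell ⊚ idc (fklm.mor ▷₁ (ejk ⊗ₒ eij))),
      by simp (maxDischargeDepth := 20), by simp (maxDischargeDepth := 20)⟩
  have h2 := trc_comm F (deltaL' F fijk fijm fikm fjkm fklm δ)
    ((midInvHom fijk fikm fklm).vcomp ((betaL' F fijk fikl fikm film fklm β).vcomp e))
  have h3 := exchange δ.cell ((iMor fklm.mor)⋆₂ ▷₂ (ejk ⊗ₒ eij)) (by simp (maxDischargeDepth := 20))
  have e1 : (deltaL' F fijk fijm fikm fjkm fklm δ).cell =
    δ.cell ⊚ idc (fklm.mor ▷₁ (ejk ⊗ₒ eij)) := rfl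
  have e2 : (betaL' F fijk fikl fikm film fklm β).cell =
    β.cell ⊚ idc (elm ◁₁ (ekl ◁₁ fijk.mor)) := rfl
  have e3 : (midInvHom fijk fikm fklm).cell = idc fikm.mor ⊚ tensoratorInv fklm.mor fijk.mor := rfl
  rw [pairing_eq_tr, pairing_eq_tr, ← trc_cell, ← trc_cell]
  simp (maxDischargeDepth := 20) [e1, e2, e3, cell_ptr] at h1 h2 h3
  simp (maxDischargeDepth := 20) [cell_deltaBeta, cell_betaContract]
  rw [h2, h1, h3]

/-- The same argument with `β` at the end and the loop of `fijk`. -/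
theorem pairing_deltaContract (β : TwoH' fikl fikm film fklm) (δ : TwoH' fijk fijm fikm fjkm) :
    pairing F _ _ (deltaContract fijk fijm fikl fikm film fjkm fklm e δ) β =
      pairing F _ _ (deltaBeta F fijk fijm fikl fikm film fjkm fklm (β ⊗ₜ δ)) e := by
  have h1 := trc_comp F (lComp fikl film) ((fijk.lten ekl).lten elm)
    ⟨((e.cell ⬝ (δ.cell ⊚ idc (fklm.mor ▷₁ (ejk ⊗ₒ eij)))) ⬝
        (idc fikm.mor ⊚ tensoratorInv fklm.mor fijk.mor)) ⬝
        (β.cell ⊚ idc (elm ◁₁ (ekl ◁₁ fijk.mor))),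
      by simp (maxDischargeDepth := 20), by simp (maxDischargeDepth := 20)⟩
  have h2 := trc_comm F (((deltaL' F fijk fijm fikm fjkm fklm δ).vcomp
    (midInvHom fijk fikm fklm)).vcomp (betaL' F fijk fikl fikm film fklm β)) e
  have h3 := exchange β.cell (elm ◁₂ (ekl ◁₂ (iMor fijk.mor)⋆₂)) (by simp (maxDischargeDepth := 20))
  have e1 : (deltaL' F fijk fijm fikm fjkm fklm δ).cell =
    δ.cell ⊚ idc (fklm.mor ▷₁ (ejk ⊗ₒ eij)) := rfl
  have e2 : (betaL' F fijk fikl fikm film fklm β).cell =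
    β.cell ⊚ idc (elm ◁₁ (ekl ◁₁ fijk.mor)) := rfl
  have e3 : (midInvHom fijk fikm fklm).cell = idc fikm.mor ⊚ tensoratorInv fklm.mor fijk.mor := rfl
  rw [pairing_eq_tr, pairing_eq_tr, ← trc_cell, ← trc_cell]
  simp (maxDischargeDepth := 20) [e1, e2, e3, cell_ptr] at h1 h2 h3
  simp (maxDischargeDepth := 20) [cell_deltaBeta, cell_deltaContract]
  rw [h2, h1, h3]

end

/-! ### Sliding a tetrahedron past a triangle -/

section
variable {O : Type u} [TwoCatData.{u, v, w} O] [MonoidalData O]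
  [DualData O] [SemistrictMonoidalDuals O]
  {e01 e02 e03 e04 e05 e12 e13 e15 e23 e24 e25 e34 e35 e45 : O}
  {f012 : Hom e02 (e12 ⊗ₒ e01)} {f013 : Hom e03 (e13 ⊗ₒ e01)} {f015 : Hom e05 (e15 ⊗ₒ e01)}
  {f023 : Hom e03 (e23 ⊗ₒ e02)} {f024 : Hom e04 (e24 ⊗ₒ e02)} {f025 : Hom e05 (e25 ⊗ₒ e02)}
  {f034 : Hom e04 (e34 ⊗ₒ e03)} {f035 : Hom e05 (e35 ⊗ₒ e03)} {f045 : Hom e05 (e45 ⊗ₒ e04)}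
  {f123 : Hom e13 (e23 ⊗ₒ e12)} {f125 : Hom e15 (e25 ⊗ₒ e12)} {f135 : Hom e15 (e35 ⊗ₒ e13)}
  {f234 : Hom e24 (e34 ⊗ₒ e23)} {f235 : Hom e25 (e35 ⊗ₒ e23)} {f245 : Hom e25 (e45 ⊗ₒ e24)}
  {f345 : Hom e35 (e45 ⊗ₒ e34)}

/-- Naturality of the tensorator at `x2345` and `f012`: crossing `f012` with `f235` and `f345` after
`x2345` is replaced by crossing it with `f234` and `f245` before. The elements at 0245 and 0125
commute with what passes them by exchange. -/
theorem slide_left (x2345 : TwoH f234 f235 f245 f345) (x0245 : TwoH f024 f025 f045 f245)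
    (x0125 : TwoH f012 f015 f025 f125) :
    (x0245.cell ⊚ idc ((e45 ◁₁ (f234.mor ▷₁ e02)) ⨾ (e45 ◁₁ (e34 ◁₁ (e23 ◁₁ f012.mor))))) ⬝
      (idc f025.mor ⊚ (x2345.cell ▷₂ e02) ⊚ idc (e45 ◁₁ (e34 ◁₁ (e23 ◁₁ f012.mor)))) ⬝
      (idc (f025.mor ⨾ (f235.mor ▷₁ e02)) ⊚ tensorator f345.mor (e23 ◁₁ f012.mor)) ⬝
      (idc f025.mor ⊚ tensorator f235.mor f012.mor ⊚ idc (f345.mor ▷₁ (e23 ⊗ₒ e12 ⊗ₒ e01))) ⬝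
      (x0125.cell ⊚ idc ((f235.mor ▷₁ (e12 ⊗ₒ e01)) ⨾ (f345.mor ▷₁ (e23 ⊗ₒ e12 ⊗ₒ e01)))) =
    (idc (f045.mor ⨾ (e45 ◁₁ f024.mor)) ⊚ (e45 ◁₂ tensorator f234.mor f012.mor)) ⬝
      ((x0245.cell ⊚ idc ((e45 ◁₁ (e24 ◁₁ f012.mor)) ⨾ (e45 ◁₁ (f234.mor ▷₁ (e12 ⊗ₒ e01))))) ⬝
      (idc f025.mor ⊚ tensorator f245.mor f012.mor ⊚ idc (e45 ◁₁ (f234.mor ▷₁ (e12 ⊗ₒ e01)))) ⬝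
      (x0125.cell ⊚ idc ((f245.mor ▷₁ (e12 ⊗ₒ e01)) ⨾ (e45 ◁₁ (f234.mor ▷₁ (e12 ⊗ₒ e01))))) ⬝
      (idc (f015.mor ⨾ (f125.mor ▷₁ e01)) ⊚ (x2345.cell ▷₂ (e12 ⊗ₒ e01)))) := by
  have h1 := congrArg (idc f025.mor ⊚ ·) (tensorator_natural x2345.cell (idc f012.mor))
  have h2 := exchange x0245.cell (e45 ◁₂ tensorator f234.mor f012.mor)
    (by simp (maxDischargeDepth := 20))
  have h3 := exchange x0125.cell (x2345.cell ▷₂ (e12 ⊗ₒ e01)) (by simp (maxDischargeDepth := 20))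
  simp (maxDischargeDepth := 20) at h1 h2 h3
  simp (maxDischargeDepth := 20)
  have h4 := congrArg (· ⬝ (x0125.cell ⊚ idc (f235.mor ▷₁ (e12 ⊗ₒ e01) ⨾
    f345.mor ▷₁ (e23 ⊗ₒ e12 ⊗ₒ e01)))) h1
  simp (maxDischargeDepth := 20) at h4
  rw [h4, h3, vcomp_reassoc h2]
  all_goals simp (maxDischargeDepth := 20)

/-- A left inverse equals a right inverse. The laws for `tensoratorInv` follow in this way from
those of `tensorator`. -/
theorem eq_of_inverse {x p y : Cell O} {f g : Mor O} (h1 : x ⬝ p = idc f) (h2 : p ⬝ y = idc g)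
    (hf : src y = f) (hg : tgt x = g) (h3 : tgt x = src p) (h4 : tgt p = src y) : x = y := by
  rw [← vcomp_idc' g x hg, ← h2, ← vcomp_assoc _ _ _ h3 h4, h1, idc_vcomp' _ _ hf]

theorem tensoratorInv_comp_right {A B C D E : O} (f : Hom A B) (g : Hom C D) (g' : Hom D E) :
    tensoratorInv f.mor (g.mor ⨾ g'.mor) =
      (idc (A ◁₁ g.mor) ⊚ tensoratorInv f.mor g'.mor) ⬝
        (tensoratorInv f.mor g.mor ⊚ idc (B ◁₁ g'.mor)) := by
  have h1 := inv_tensorator' f (g.comp g')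
  have h2 := congrArg (· ⊚ idc (B ◁₁ g'.mor)) (tensorator_inv' f g)
  have h3 := congrArg (idc (A ◁₁ g.mor) ⊚ ·) (tensorator_inv' f g')
  simp (maxDischargeDepth := 20) [-tensorator_inv'] at h2 h3
  refine eq_of_inverse h1 (g := ((f.rten C).comp ((g.comp g').lten B)).mor) ?_ ?_ ?_ ?_ ?_
  · simp (maxDischargeDepth := 20)
    rw [vcomp_reassoc₁ h3, idc_vcomp', h2]
    all_goals simp (maxDischargeDepth := 20)
  all_goals simp (maxDischargeDepth := 20)

theorem tensoratorInv_rMor {A B C D : O} (f : Hom A B) (g : Hom C D) (X : O) :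
    tensoratorInv f.mor (g.mor ▷₁ X) = tensoratorInv f.mor g.mor ▷₂ X := by
  have h1 := inv_tensorator' f (g.rten X)
  have h2 := congrArg (· ▷₂ X) (tensorator_inv' f g)
  simp (maxDischargeDepth := 20) [-tensorator_inv'] at h1 h2
  refine eq_of_inverse h1 h2 ?_ ?_ ?_ ?_
  all_goals simp (maxDischargeDepth := 20)

theorem tensoratorInv_natural_right {A B C D : O} (f : Hom A B) {g g' : Hom C D} (y : Hom2 g g') :
    tensoratorInv f.mor g.mor ⬝ (idc (f.mor ▷₁ C) ⊚ (B ◁₂ y.cell)) =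
      ((A ◁₂ y.cell) ⊚ idc (f.mor ▷₁ D)) ⬝ tensoratorInv f.mor g'.mor := by
  have h1 := congrArg (fun c => tensoratorInv f.mor g.mor ⬝ (c ⬝ tensoratorInv f.mor g'.mor))
    (tensorator_natural (idc f.mor) y.cell)
  simp (maxDischargeDepth := 20) at h1
  rw [vcomp_reassoc₁ (inv_tensorator' f g)] at h1
  all_goals simp (maxDischargeDepth := 20) at h1 ⊢
  exact h1

/-- Naturality of the inverse tensorator at `y0123` and `f345`: crossings with `f012` and `f023`
after `y0123` become crossings with `f013` and `f123` before. -/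
theorem slide_right (y0345 : TwoH' f034 f035 f045 f345) (y1235 : TwoH' f123 f125 f135 f235)
    (y0135 : TwoH' f013 f015 f035 f135) (y0123 : TwoH' f012 f013 f023 f123) :
    (idc f015.mor ⊚ (y1235.cell ▷₂ e01) ⊚ idc (f345.mor ▷₁ (e23 ⊗ₒ e12 ⊗ₒ e01))) ⬝
      (y0135.cell ⊚ idc ((e35 ◁₁ (f123.mor ▷₁ e01)) ⨾ (f345.mor ▷₁ (e23 ⊗ₒ e12 ⊗ₒ e01)))) ⬝
      (idc f035.mor ⊚ (e35 ◁₂ y0123.cell) ⊚ idc (f345.mor ▷₁ (e23 ⊗ₒ e12 ⊗ₒ e01))) ⬝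
      (idc (f035.mor ⨾ (e35 ◁₁ f023.mor)) ⊚ tensoratorInv f345.mor (e23 ◁₁ f012.mor)) ⬝
      (idc f035.mor ⊚ tensoratorInv f345.mor f023.mor ⊚ idc (e45 ◁₁ (e34 ◁₁ (e23 ◁₁ f012.mor)))) ⬝
      (y0345.cell ⊚ idc ((e45 ◁₁ (e34 ◁₁ f023.mor)) ⨾ (e45 ◁₁ (e34 ◁₁ (e23 ◁₁ f012.mor))))) =
    (idc f015.mor ⊚ (y1235.cell ▷₂ e01) ⊚ idc (f345.mor ▷₁ (e23 ⊗ₒ e12 ⊗ₒ e01))) ⬝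
      (idc (f015.mor ⨾ (f135.mor ▷₁ e01)) ⊚ (tensoratorInv f345.mor f123.mor ▷₂ e01)) ⬝
      (y0135.cell ⊚ idc ((f345.mor ▷₁ (e13 ⊗ₒ e01)) ⨾ (e45 ◁₁ (e34 ◁₁ (f123.mor ▷₁ e01))))) ⬝
      (idc f035.mor ⊚ tensoratorInv f345.mor f013.mor ⊚ idc (e45 ◁₁ (e34 ◁₁ (f123.mor ▷₁ e01)))) ⬝
      (y0345.cell ⊚ idc ((e45 ◁₁ (e34 ◁₁ f013.mor)) ⨾ (e45 ◁₁ (e34 ◁₁ (f123.mor ▷₁ e01))))) ⬝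
      (idc (f045.mor ⨾ (e45 ◁₁ f034.mor)) ⊚ (e45 ◁₂ (e34 ◁₂ y0123.cell))) := by
  have h0 := tensoratorInv_natural_right f345 y0123
  have h5 := tensoratorInv_comp_right f345 f013 (f123.rten e01)
  have h6 := tensoratorInv_comp_right f345 f023 (f012.lten e23)
  have h7 := tensoratorInv_rMor f345 f123 e01
  simp only [mor_lten, mor_rten, h7] at h5 h6
  have h2 := exchange y0135.cell (tensoratorInv f345.mor f123.mor ▷₂ e01)
    (by simp (maxDischargeDepth := 20))
  have h3 := exchange y0345.cell (e45 ◁₂ (e34 ◁₂ y0123.cell)) (by simp (maxDischargeDepth := 20))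
  simp (maxDischargeDepth := 20) [h5, h6] at h0
  have h1 := congrArg (fun c => (idc f035.mor ⊚ c) ⬝ (y0345.cell ⊚
    idc ((e45 ◁₁ (e34 ◁₁ f023.mor)) ⨾ (e45 ◁₁ (e34 ◁₁ (e23 ◁₁ f012.mor)))))) h0
  simp (maxDischargeDepth := 20) at h1 h2 h3
  simp (maxDischargeDepth := 20)
  rw [← h1, h3, vcomp_reassoc h2]
  all_goals simp (maxDischargeDepth := 20)

end

/-! ### The left-hand side as a linear form of `βδ` -/

section
variable {O : Type u} [TwoCatData.{u, v, w} O] [MonoidalData O]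
  [DualData O] [SemistrictMonoidalDuals O] (F : Type*) [Field F] [Preadditive2 O] [VectLinear F O]
  {A B C : O}

theorem trc_vcomp_comm (a b : Cell O) (h1 : tgt a = src b) (h2 : tgt b = src a) :
    trc F (a ⬝ b) = trc F (b ⬝ a) :=
  trc_comm F (f := ⟨src a, rfl, rfl⟩) (g := ⟨tgt a, (dom_src_eq a).symm, (cod_src_eq a).symm⟩) ⟨a, rfl, rfl⟩
    ⟨b, h1.symm, h2⟩

/-- A partial trace inside a larger trace is reopened: `ptr_tensorator` pulls `b` into the loop of
`g`, the loop is extended over `y` by exchange, and `tr_comp` makes it part of the full trace. -/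
theorem trc_ptr_tensorator {A B C D E : O} (f f' : Hom A (B ⊗ₒ D)) (g : Hom B C) (b : Hom D E)
    (x : Hom2 (f.comp (g.rten D)) (f'.comp (g.rten D)))
    (y : Hom2 (f'.comp (b.lten B)) (f.comp (b.lten B))) :
    trc F (((ptr f f' (g.rten D) x).cell ⊚ idc (B ◁₁ b.mor)) ⬝ y.cell) =
      trc F ((((idc f.mor ⊚ tensoratorInv g.mor b.mor) ⬝ (x.cell ⊚ idc (C ◁₁ b.mor))) ⬝
        (idc f'.mor ⊚ tensorator g.mor b.mor)) ⬝ (y.cell ⊚ idc (g.mor ▷₁ E))) := by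
  have h1 := trc_comp F (f.comp (b.lten B)) (g.rten E)
    ⟨(((idc f.mor ⊚ tensoratorInv g.mor b.mor) ⬝ (x.cell ⊚ idc (C ◁₁ b.mor))) ⬝
        (idc f'.mor ⊚ tensorator g.mor b.mor)) ⬝ (y.cell ⊚ idc (g.mor ▷₁ E)),
      by simp (maxDischargeDepth := 20), by simp (maxDischargeDepth := 20)⟩
  have h2 := exchange y.cell ((iMor g.mor)⋆₂ ▷₂ E) (by simp (maxDischargeDepth := 20))
  dsimp only at h1
  rw [h1, ptr_tensorator]
  simp (maxDischargeDepth := 20) at h2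
  simp (maxDischargeDepth := 20) [cell_ptr]
  rw [h2]

variable
  {e01 e02 e03 e04 e05 e12 e13 e15 e23 e24 e25 e34 e35 e45 : O}
  {f012 : Hom e02 (e12 ⊗ₒ e01)} {f013 : Hom e03 (e13 ⊗ₒ e01)} {f015 : Hom e05 (e15 ⊗ₒ e01)}
  {f023 : Hom e03 (e23 ⊗ₒ e02)} {f024 : Hom e04 (e24 ⊗ₒ e02)} {f025 : Hom e05 (e25 ⊗ₒ e02)}
  {f034 : Hom e04 (e34 ⊗ₒ e03)} {f035 : Hom e05 (e35 ⊗ₒ e03)} {f045 : Hom e05 (e45 ⊗ₒ e04)}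
  {f123 : Hom e13 (e23 ⊗ₒ e12)} {f125 : Hom e15 (e25 ⊗ₒ e12)} {f135 : Hom e15 (e35 ⊗ₒ e13)}
  {f234 : Hom e24 (e34 ⊗ₒ e23)} {f235 : Hom e25 (e35 ⊗ₒ e23)} {f245 : Hom e25 (e45 ⊗ₒ e24)}
  {f345 : Hom e35 (e45 ⊗ₒ e34)}

section
variable (x2345 : TwoH f234 f235 f245 f345) (x0234 : TwoH f023 f024 f034 f234)
  (y0345 : TwoH' f034 f035 f045 f345) (y1235 : TwoH' f123 f125 f135 f235)
  (y0135 : TwoH' f013 f015 f035 f135) (y0123 : TwoH' f012 f013 f023 f123)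

/-- The part of `closingCell` that consists of `y1235`, `y0135` and `y0345`. -/
def closingCellMid : Hom2
    (⟨f015.mor ⨾ (f125.mor ▷₁ e01) ⨾ (f235.mor ▷₁ (e12 ⊗ₒ e01)) ⨾
      (f345.mor ▷₁ (e23 ⊗ₒ e12 ⊗ₒ e01)), by simp (maxDischargeDepth := 20),
      by simp (maxDischargeDepth := 20)⟩ : Hom e05 (e45 ⊗ₒ (e34 ⊗ₒ e23) ⊗ₒ (e12 ⊗ₒ e01)))
    ⟨f045.mor ⨾ (e45 ◁₁ f034.mor) ⨾ (e45 ◁₁ (e34 ◁₁ f013.mor)) ⨾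
      (e45 ◁₁ (e34 ◁₁ (f123.mor ▷₁ e01))), by simp (maxDischargeDepth := 20),
      by simp (maxDischargeDepth := 20)⟩ :=
  Hom2.vcomp (g := ⟨f015.mor ⨾ (f135.mor ▷₁ e01) ⨾ (f345.mor ▷₁ (e13 ⊗ₒ e01)) ⨾
      (e45 ◁₁ (e34 ◁₁ (f123.mor ▷₁ e01))), by simp (maxDischargeDepth := 20),
      by simp (maxDischargeDepth := 20)⟩)
    ⟨(idc f015.mor ⊚ (y1235.cell ▷₂ e01) ⊚ idc (f345.mor ▷₁ (e23 ⊗ₒ e12 ⊗ₒ e01))) ⬝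
      (idc (f015.mor ⨾ (f135.mor ▷₁ e01)) ⊚ (tensoratorInv f345.mor f123.mor ▷₂ e01)),
      by simp (maxDischargeDepth := 20), by simp (maxDischargeDepth := 20)⟩
    ⟨(y0135.cell ⊚ idc ((f345.mor ▷₁ (e13 ⊗ₒ e01)) ⨾ (e45 ◁₁ (e34 ◁₁ (f123.mor ▷₁ e01))))) ⬝
        (idc f035.mor ⊚ tensoratorInv f345.mor f013.mor ⊚
          idc (e45 ◁₁ (e34 ◁₁ (f123.mor ▷₁ e01)))) ⬝
        (y0345.cell ⊚ idc ((e45 ◁₁ (e34 ◁₁ f013.mor)) ⨾ (e45 ◁₁ (e34 ◁₁ (f123.mor ▷₁ e01))))),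
        by simp (maxDischargeDepth := 20), by simp (maxDischargeDepth := 20)⟩

/-- The part of `closingCell` that consists of `y1235`, `y0135`, `y0345` and `y0123`. -/
def closingCellRight : Hom2
    (⟨f015.mor ⨾ (f125.mor ▷₁ e01) ⨾ (f235.mor ▷₁ (e12 ⊗ₒ e01)) ⨾
      (f345.mor ▷₁ (e23 ⊗ₒ e12 ⊗ₒ e01)), by simp (maxDischargeDepth := 20),
      by simp (maxDischargeDepth := 20)⟩ : Hom e05 (e45 ⊗ₒ (e34 ⊗ₒ e23) ⊗ₒ (e12 ⊗ₒ e01)))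
    ⟨f045.mor ⨾ (e45 ◁₁ f034.mor) ⨾ (e45 ◁₁ (e34 ◁₁ f023.mor)) ⨾
      (e45 ◁₁ (e34 ◁₁ (e23 ◁₁ f012.mor))), by simp (maxDischargeDepth := 20),
      by simp (maxDischargeDepth := 20)⟩ :=
  (closingCellMid y0345 y1235 y0135).vcomp
    ⟨idc (f045.mor ⨾ (e45 ◁₁ f034.mor)) ⊚ (e45 ◁₂ (e34 ◁₂ y0123.cell)),
      by simp (maxDischargeDepth := 20), by simp (maxDischargeDepth := 20)⟩

/-- The 2-morphism against which `closingForm` pairs. -/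
def closingCell : Hom2
    ((rComp₄ f015 f125 f245).comp ((f234.rten (e12 ⊗ₒ e01)).lten e45))
    ((lComp₄ f012 f024 f045).comp ((f234.rten (e12 ⊗ₒ e01)).lten e45)) :=
  Hom2.vcomp
    ⟨idc (f015.mor ⨾ (f125.mor ▷₁ e01)) ⊚ (x2345.cell ▷₂ (e12 ⊗ₒ e01)),
      by simp (maxDischargeDepth := 20), by simp (maxDischargeDepth := 20)⟩
    ((closingCellRight y0345 y1235 y0135 y0123).vcomp
      ⟨(idc f045.mor ⊚ (e45 ◁₂ (x0234.cell ⊚ idc (e34 ◁₁ (e23 ◁₁ f012.mor))))) ⬝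
        (idc (f045.mor ⨾ (e45 ◁₁ f024.mor)) ⊚ (e45 ◁₂ tensorator f234.mor f012.mor)),
        by simp (maxDischargeDepth := 20), by simp (maxDischargeDepth := 20)⟩)

theorem closingCellRight_eq :
    ((alphaGammaEps F f012 f013 f015 f023 f035 f123 f125 f135 f235
        (y1235 ⊗ₜ (y0135 ⊗ₜ y0123))).cell ⊚ idc (f345.mor ▷₁ (e23 ⊗ₒ e12 ⊗ₒ e01))) ⬝
      ((idc (f035.mor ⨾ (e35 ◁₁ f023.mor)) ⊚ tensoratorInv f345.mor (e23 ◁₁ f012.mor)) ⬝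
      ((idc f035.mor ⊚ tensoratorInv f345.mor f023.mor ⊚ idc (e45 ◁₁ (e34 ◁₁ (e23 ◁₁ f012.mor)))) ⬝
      (y0345.cell ⊚ idc ((e45 ◁₁ (e34 ◁₁ f023.mor)) ⨾ (e45 ◁₁ (e34 ◁₁ (e23 ◁₁ f012.mor)))))))
    = (closingCellRight y0345 y1235 y0135 y0123).cell := by
  have h := slide_right y0345 y1235 y0135 y0123
  simp (maxDischargeDepth := 20) at h
  simp (maxDischargeDepth := 20) [cell_alphaGammaEps, closingCellRight, closingCellMid, h]

theorem slide_left_betaDelta (x0245 : TwoH f024 f025 f045 f245)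
    (x0125 : TwoH f012 f015 f025 f125) :
    (x0245.cell ⊚ idc ((e45 ◁₁ (f234.mor ▷₁ e02)) ⨾ (e45 ◁₁ (e34 ◁₁ (e23 ◁₁ f012.mor))))) ⬝
      ((idc f025.mor ⊚ (x2345.cell ▷₂ e02) ⊚ idc (e45 ◁₁ (e34 ◁₁ (e23 ◁₁ f012.mor)))) ⬝
      ((idc (f025.mor ⨾ (f235.mor ▷₁ e02)) ⊚ tensorator f345.mor (e23 ◁₁ f012.mor)) ⬝
      ((idc f025.mor ⊚ tensorator f235.mor f012.mor ⊚ idc (f345.mor ▷₁ (e23 ⊗ₒ e12 ⊗ₒ e01))) ⬝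
      (x0125.cell ⊚ idc ((f235.mor ▷₁ (e12 ⊗ₒ e01)) ⨾ (f345.mor ▷₁ (e23 ⊗ₒ e12 ⊗ₒ e01))))))) =
    (idc (f045.mor ⨾ (e45 ◁₁ f024.mor)) ⊚ (e45 ◁₂ tensorator f234.mor f012.mor)) ⬝
      (((betaDelta F f012 f015 f024 f025 f045 f125 f245 (x0245 ⊗ₜ x0125)).cell ⊚
        idc (e45 ◁₁ (f234.mor ▷₁ (e12 ⊗ₒ e01)))) ⬝
      (idc (f015.mor ⨾ (f125.mor ▷₁ e01)) ⊚ (x2345.cell ▷₂ (e12 ⊗ₒ e01)))) := by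
  have h := slide_left x2345 x0245 x0125
  simp (maxDischargeDepth := 20) at h
  simp (maxDischargeDepth := 20) [cell_betaDelta, h]

/-- The linear form on the 2-morphisms `f_{((012)4)5} ⇒ f_{0(1(245))}` that closes up the
remaining tetrahedra. -/
noncomputable def closingForm :
    Hom2 (lComp₄ f012 f024 f045) (rComp₄ f015 f125 f245) →ₗ[F] F :=
  (pairing F _ _).flip (closingCell x2345 x0234 y0345 y1235 y0135 y0123) ∘ₗ
    (hcompL F _ _ _ _).flip (Hom2.id ((f234.rten (e12 ⊗ₒ e01)).lten e45))

theorem closingForm_apply (v : Hom2 (lComp₄ f012 f024 f045) (rComp₄ f015 f125 f245)) :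
    closingForm F x2345 x0234 y0345 y1235 y0135 y0123 v =
      trc F ((v.cell ⊚ idc (e45 ◁₁ (f234.mor ▷₁ (e12 ⊗ₒ e01)))) ⬝
        (closingCell x2345 x0234 y0345 y1235 y0135 y0123).cell) := by
  refine (?_ : _ = pairing F _ _ (v.hcomp (Hom2.id ((f234.rten (e12 ⊗ₒ e01)).lten e45)))
    (closingCell x2345 x0234 y0345 y1235 y0135 y0123)).trans ?_
  · rfl
  · rw [pairing_eq_tr, ← trc_cell]; rfl

set_option maxHeartbeats 1000000 in
theorem closingForm_betaDelta (x0245 : TwoH f024 f025 f045 f245)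
    (x0125 : TwoH f012 f015 f025 f125) :
    pairing F _ _ (betaDelta F f012 f015 f023 f025 f035 f125 f235
      (betaContract f023 f025 f034 f035 f045 f235 f345 (epsGammaAlpha F f023 f024 f025 f034 f045
        f234 f235 f245 f345 (x2345 ⊗ₜ (x0245 ⊗ₜ x0234))) y0345 ⊗ₜ x0125))
      (alphaGammaEps F f012 f013 f015 f023 f035 f123 f125 f135 f235
        (y1235 ⊗ₜ (y0135 ⊗ₜ y0123))) =
    closingForm F x2345 x0234 y0345 y1235 y0135 y0123
      (betaDelta F f012 f015 f024 f025 f045 f125 f245 (x0245 ⊗ₜ x0125)) := by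
  -- The contraction with `y0345` is a partial trace over `f345`; it is reopened across the strand
  -- `e23 ⊗ f012`.
  have h1 := trc_ptr_tensorator F (lComp f023 f035) (rComp f025 f235) f345 (f012.lten e23)
    ⟨((idc f035.mor ⊚ tensoratorInv f345.mor f023.mor) ⬝
        (y0345.cell ⊚ idc (e45 ◁₁ (e34 ◁₁ f023.mor)))) ⬝ (epsGammaAlpha F f023 f024 f025 f034 f045
        f234 f235 f245 f345 (x2345 ⊗ₜ (x0245 ⊗ₜ x0234))).cell,
      by simp (maxDischargeDepth := 20), by simp (maxDischargeDepth := 20)⟩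
    ⟨((idc f025.mor ⊚ tensorator f235.mor f012.mor) ⬝
      (x0125.cell ⊚ idc (f235.mor ▷₁ (e12 ⊗ₒ e01)))) ⬝
      (alphaGammaEps F f012 f013 f015 f023 f035 f123 f125 f135 f235
        (y1235 ⊗ₜ (y0135 ⊗ₜ y0123))).cell,
      by simp (maxDischargeDepth := 20), by simp (maxDischargeDepth := 20)⟩
  have h2 : ∀ c, pairing F _ _ (betaDelta F f012 f015 f023 f025 f035 f125 f235
      (betaContract f023 f025 f034 f035 f045 f235 f345 (epsGammaAlpha F f023 f024 f025 f034 f045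
        f234 f235 f245 f345 (x2345 ⊗ₜ (x0245 ⊗ₜ x0234))) y0345 ⊗ₜ x0125))
      (alphaGammaEps F f012 f013 f015 f023 f035 f123 f125 f135 f235
        (y1235 ⊗ₜ (y0135 ⊗ₜ y0123))) = c ↔ trc F (((betaContract f023 f025 f034 f035 f045 f235 f345
        (epsGammaAlpha F f023 f024 f025 f034 f045
        f234 f235 f245 f345 (x2345 ⊗ₜ (x0245 ⊗ₜ x0234))) y0345).cell ⊚
          idc (e35 ◁₁ (e23 ◁₁ f012.mor))) ⬝ (((idc f025.mor ⊚ tensorator f235.mor f012.mor) ⬝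
      (x0125.cell ⊚ idc (f235.mor ▷₁ (e12 ⊗ₒ e01)))) ⬝
      (alphaGammaEps F f012 f013 f015 f023 f035 f123 f125 f135 f235
        (y1235 ⊗ₜ (y0135 ⊗ₜ y0123))).cell)) = c := by
    intro c
    rw [pairing_eq_tr, ← trc_cell]
    simp (maxDischargeDepth := 20) [cell_betaDelta]
  rw [closingForm_apply, h2]
  refine h1.trans ?_
  -- First rotation: it brings `y0345` behind the `αγε` composite, as needed for the slide of
  -- `y0123` past `f345`.
  have h5 := trc_vcomp_comm F ((idc (f035.mor ⨾ (e35 ◁₁ f023.mor)) ⊚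
      tensoratorInv f345.mor (e23 ◁₁ f012.mor)) ⬝
    ((idc f035.mor ⊚ tensoratorInv f345.mor f023.mor ⊚ idc (e45 ◁₁ (e34 ◁₁ (e23 ◁₁ f012.mor)))) ⬝
    ((y0345.cell ⊚ idc ((e45 ◁₁ (e34 ◁₁ f023.mor)) ⨾ (e45 ◁₁ (e34 ◁₁ (e23 ◁₁ f012.mor))))) ⬝
      (idc f045.mor ⊚ (e45 ◁₂ x0234.cell) ⊚ idc (e45 ◁₁ (e34 ◁₁ (e23 ◁₁ f012.mor)))))))
    ((idc (f045.mor ⨾ (e45 ◁₁ f024.mor)) ⊚ (e45 ◁₂ tensorator f234.mor f012.mor)) ⬝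
      (((betaDelta F f012 f015 f024 f025 f045 f125 f245 (x0245 ⊗ₜ x0125)).cell ⊚
        idc (e45 ◁₁ (f234.mor ▷₁ (e12 ⊗ₒ e01)))) ⬝
      ((idc (f015.mor ⨾ (f125.mor ▷₁ e01)) ⊚ (x2345.cell ▷₂ (e12 ⊗ₒ e01))) ⬝
      ((alphaGammaEps F f012 f013 f015 f023 f035 f123 f125 f135 f235
        (y1235 ⊗ₜ (y0135 ⊗ₜ y0123))).cell ⊚ idc (f345.mor ▷₁ (e23 ⊗ₒ e12 ⊗ₒ e01))))))
    (by simp (maxDischargeDepth := 20)) (by simp (maxDischargeDepth := 20))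
  -- Second rotation: the crossing of `f234` with `f012` created by `slide_left` moves to the end,
  -- where it is the last piece of `closingCell`.
  have h6 := trc_vcomp_comm F (idc (f045.mor ⨾ (e45 ◁₁ f024.mor)) ⊚
      (e45 ◁₂ tensorator f234.mor f012.mor))
    (((betaDelta F f012 f015 f024 f025 f045 f125 f245 (x0245 ⊗ₜ x0125)).cell ⊚
        idc (e45 ◁₁ (f234.mor ▷₁ (e12 ⊗ₒ e01)))) ⬝
      ((idc (f015.mor ⨾ (f125.mor ▷₁ e01)) ⊚ (x2345.cell ▷₂ (e12 ⊗ₒ e01))) ⬝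
      ((closingCellRight y0345 y1235 y0135 y0123).cell ⬝
        (idc f045.mor ⊚ (e45 ◁₂ x0234.cell) ⊚ idc (e45 ◁₁ (e34 ◁₁ (e23 ◁₁ f012.mor)))))))
    (by simp (maxDischargeDepth := 20)) (by simp (maxDischargeDepth := 20))
  have h7 := congrArg (· ⬝ ((alphaGammaEps F f012 f013 f015 f023 f035 f123 f125 f135 f235
        (y1235 ⊗ₜ (y0135 ⊗ₜ y0123))).cell ⊚ idc (f345.mor ▷₁ (e23 ⊗ₒ e12 ⊗ₒ e01))))
    (slide_left_betaDelta F x2345 x0245 x0125)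
  have h8 := congrArg (· ⬝ (idc f045.mor ⊚ (e45 ◁₂ x0234.cell) ⊚
    idc (e45 ◁₁ (e34 ◁₁ (e23 ◁₁ f012.mor))))) (closingCellRight_eq F y0345 y1235 y0135 y0123)
  clear h1 h2
  simp (maxDischargeDepth := 20) at h5 h6 h7 h8
  rw [h8, h6] at h5
  simp (maxDischargeDepth := 20) [cell_epsGammaAlpha, closingCell]
  rw [h7, h5]

end

end

/-! ### One term of the expansion as a linear form of an inner 2-morphism -/

section
variable {O : Type u} [TwoCatData.{u, v, w} O] [MonoidalData O]
  [DualData O] [SemistrictMonoidalDuals O] (F : Type*) [Field F] [Preadditive2 O] [VectLinear F O]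

/-- A partial trace over `k` on one tensor factor is reopened: its loop is extended by exchange over
`x` and `y`, after which `tr_comp` applies. -/
theorem trc_ptr_rten {A B C M Y : O} {s : Hom A (B ⊗ₒ Y)} (h : Hom A (M ⊗ₒ Y)) (g g' : Hom M B)
    (k : Hom B C) (n : Hom2 (g.comp k) (g'.comp k)) (x : Hom2 s (h.comp (g.rten Y)))
    (y : Hom2 (h.comp (g'.rten Y)) s) :
    trc F (x.cell ⬝ ((idc h.mor ⊚ ((ptr g g' k n).cell ▷₂ Y)) ⬝ y.cell)) =
      trc F ((x.cell ⊚ idc (k.mor ▷₁ Y)) ⬝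
        ((idc h.mor ⊚ (n.cell ▷₂ Y)) ⬝ (y.cell ⊚ idc (k.mor ▷₁ Y)))) := by
  have h1 := trc_comp F s (k.rten Y)
    ⟨(x.cell ⊚ idc (k.mor ▷₁ Y)) ⬝
        ((idc h.mor ⊚ (n.cell ▷₂ Y)) ⬝ (y.cell ⊚ idc (k.mor ▷₁ Y))),
      by simp (maxDischargeDepth := 20), by simp (maxDischargeDepth := 20)⟩
  have h2 := exchange y.cell ((iMor k.mor)⋆₂ ▷₂ Y) (by simp (maxDischargeDepth := 20))
  have h3 := exchange x.cell (iMor k.mor ▷₂ Y) (by simp (maxDischargeDepth := 20))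
  dsimp only at h1
  rw [h1]
  simp (maxDischargeDepth := 20) at h2 h3
  simp (maxDischargeDepth := 20) [cell_ptr]
  rw [h2, vcomp_reassoc h3.symm]
  all_goals simp (maxDischargeDepth := 20)

variable
  {e01 e02 e03 e04 e05 e12 e13 e14 e15 e23 e24 e25 e34 e35 e45 : O}
  {f012 : Hom e02 (e12 ⊗ₒ e01)} {f013 : Hom e03 (e13 ⊗ₒ e01)} {f014 : Hom e04 (e14 ⊗ₒ e01)}
  {f015 : Hom e05 (e15 ⊗ₒ e01)}
  {f023 : Hom e03 (e23 ⊗ₒ e02)} {f024 : Hom e04 (e24 ⊗ₒ e02)} {f025 : Hom e05 (e25 ⊗ₒ e02)}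
  {f034 : Hom e04 (e34 ⊗ₒ e03)} {f035 : Hom e05 (e35 ⊗ₒ e03)} {f045 : Hom e05 (e45 ⊗ₒ e04)}
  {f123 : Hom e13 (e23 ⊗ₒ e12)} {f124 : Hom e14 (e24 ⊗ₒ e12)} {f125 : Hom e15 (e25 ⊗ₒ e12)}
  {f134 : Hom e14 (e34 ⊗ₒ e13)} {f135 : Hom e15 (e35 ⊗ₒ e13)} {f145 : Hom e15 (e45 ⊗ₒ e14)}
  {f234 : Hom e24 (e34 ⊗ₒ e23)} {f235 : Hom e25 (e35 ⊗ₒ e23)} {f245 : Hom e25 (e45 ⊗ₒ e24)}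
  {f345 : Hom e35 (e45 ⊗ₒ e34)}
  (x2345 : TwoH f234 f235 f245 f345)
  (y0345 : TwoH' f034 f035 f045 f345) (y1235 : TwoH' f123 f125 f135 f235)
  (y0135 : TwoH' f013 f015 f035 f135)
  (a : TwoH f124 f125 f145 f245) (c : TwoH f014 f015 f045 f145)

/-- The 2-morphism against which `innerForm` pairs. -/
def innerCell : Hom2 (f045.comp ((rComp f014 (rComp f124 f234)).lten e45))
    (f045.comp (((lComp f013 f034).comp ((f123.rten e01).lten e34)).lten e45)) :=
  Hom2.vcomp (g := ⟨f015.mor ⨾ (f125.mor ▷₁ e01) ⨾ (f235.mor ▷₁ (e12 ⊗ₒ e01)) ⨾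
      (f345.mor ▷₁ (e23 ⊗ₒ e12 ⊗ₒ e01)), by simp (maxDischargeDepth := 20),
      by simp (maxDischargeDepth := 20)⟩)
    ⟨(c.cell ⊚ idc (e45 ◁₁ ((f124.mor ▷₁ e01) ⨾ (f234.mor ▷₁ (e12 ⊗ₒ e01))))) ⬝
      ((idc f015.mor ⊚ (a.cell ▷₂ e01) ⊚ idc (e45 ◁₁ (f234.mor ▷₁ (e12 ⊗ₒ e01)))) ⬝
      (idc (f015.mor ⨾ (f125.mor ▷₁ e01)) ⊚ (x2345.cell ▷₂ (e12 ⊗ₒ e01)))),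
      by simp (maxDischargeDepth := 20), by simp (maxDischargeDepth := 20)⟩
    ⟨(closingCellMid y0345 y1235 y0135).cell, by simp (maxDischargeDepth := 20),
      by simp (maxDischargeDepth := 20)⟩

/-- The linear form on the 2-morphisms `f_{034} (e_{34} ⊗ f_{013} (f_{123} ⊗ e_{01})) ⇒
f_{014} (f_{124} (f_{234} ⊗ e_{12}) ⊗ e_{01})` that closes up the remaining tetrahedra. -/
noncomputable def innerForm : Hom2 ((lComp f013 f034).comp ((f123.rten e01).lten e34))
    (rComp f014 (rComp f124 f234)) →ₗ[F] F :=
  (pairing F _ _).flip (innerCell x2345 y0345 y1235 y0135 a c) ∘ₗ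
    hcompL F _ _ _ _ (Hom2.id f045) ∘ₗ ltenL F e45 _ _

theorem innerForm_apply (w : Hom2 ((lComp f013 f034).comp ((f123.rten e01).lten e34))
    (rComp f014 (rComp f124 f234))) :
    innerForm F x2345 y0345 y1235 y0135 a c w =
      trc F ((idc f045.mor ⊚ (e45 ◁₂ w.cell)) ⬝
        (innerCell x2345 y0345 y1235 y0135 a c).cell) := by
  refine (?_ : _ = pairing F _ _ ((Hom2.id f045).hcomp (w.lten e45))
    (innerCell x2345 y0345 y1235 y0135 a c)).trans ?_
  · rfl
  · rw [pairing_eq_tr, ← trc_cell]; rfl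

set_option maxHeartbeats 1000000 in
-- Contracting Z(-(12345)) with `y1235` is a partial trace over `f123`. Once it is reopened, `p`
-- passes `c` by exchange and joins `q`, and the rest of the diagram no longer involves `f134`.
theorem innerForm_gammaAlpha (p : TwoH f123 f124 f134 f234) (q : TwoH f013 f014 f034 f134) :
    pairing F _ _ (deltaBeta F f013 f015 f034 f035 f045 f135 f345 (y0345 ⊗ₜ y0135))
      (epsGammaAlpha F f013 f014 f015 f034 f045 f134 f135 f145 f345
        (deltaContract f123 f125 f134 f135 f145 f235 f345
          (epsGammaAlpha F f123 f124 f125 f134 f145 f234 f235 f245 f345 (x2345 ⊗ₜ (a ⊗ₜ p)))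
            y1235 ⊗ₜ (c ⊗ₜ q))) =
    innerForm F x2345 y0345 y1235 y0135 a c
      (gammaAlpha F (lComp f013 f034) f014 f134 f123 (rComp f124 f234) q p) := by
  have h1 := trc_ptr_rten F (s := (lComp₄ f013 f034 f045).cast (Y := (e45 ⊗ₒ e34 ⊗ₒ e13) ⊗ₒ e01)
      rfl (by simp)) f015 (lComp f134 f145) (rComp f135 f345) ((f123.lten e34).lten e45)
    ⟨((epsGammaAlpha F f123 f124 f125 f134 f145 f234 f235 f245 f345 (x2345 ⊗ₜ (a ⊗ₜ p))).cell ⬝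
        (y1235.cell ⊚ idc (f345.mor ▷₁ (e23 ⊗ₒ e12)))) ⬝
        (idc f135.mor ⊚ tensoratorInv f345.mor f123.mor),
      by simp (maxDischargeDepth := 20), by simp (maxDischargeDepth := 20)⟩
    ⟨(idc f045.mor ⊚ (e45 ◁₂ q.cell)) ⬝ (c.cell ⊚ idc (e45 ◁₁ (f134.mor ▷₁ e01))),
      by simp (maxDischargeDepth := 20), by simp (maxDischargeDepth := 20)⟩
    ⟨(deltaBeta F f013 f015 f034 f035 f045 f135 f345 (y0345 ⊗ₜ y0135)).cell,
      by simp (maxDischargeDepth := 20), by simp (maxDischargeDepth := 20)⟩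
  rw [pairing_eq_tr, tr_comm, ← trc_cell, innerForm_apply]
  refine (congrArg (trc F) ?_).trans (h1.trans (congrArg (trc F) ?_))
  · change _ = ((idc f045.mor ⊚ (e45 ◁₂ q.cell)) ⬝ (c.cell ⊚ idc (e45 ◁₁ (f134.mor ▷₁ e01)))) ⬝
      ((idc f015.mor ⊚ ((deltaContract f123 f125 f134 f135 f145 f235 f345
        (epsGammaAlpha F f123 f124 f125 f134 f145 f234 f235 f245 f345 (x2345 ⊗ₜ (a ⊗ₜ p)))
          y1235).cell ▷₂ e01)) ⬝
        (deltaBeta F f013 f015 f034 f035 f045 f135 f345 (y0345 ⊗ₜ y0135)).cell)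
    clear h1
    simp (maxDischargeDepth := 20) [cell_epsGammaAlpha]
  · clear h1
    have h3 := exchange c.cell (e45 ◁₂ (p.cell ▷₂ e01)) (by simp (maxDischargeDepth := 20))
    simp (maxDischargeDepth := 20) at h3
    simp (maxDischargeDepth := 20) [cell_epsGammaAlpha, cell_gammaAlpha, cell_deltaBeta,
      innerCell, closingCellMid]
    rw [vcomp_reassoc h3]
    all_goals simp (maxDischargeDepth := 20)

variable (x0234 : TwoH f023 f024 f034 f234) (y0123 : TwoH' f012 f013 f023 f123)
  (e : TwoH f012 f014 f024 f124)

/-- The composite of `y0123`, `x0234` and `e`, whose coordinates are the contraction of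
`Z(+(01234))` with `y0123`. -/
noncomputable def innerCellArg : Hom2 ((lComp f013 f034).comp ((f123.rten e01).lten e34))
    (rComp f014 (rComp f124 f234)) :=
  Hom2.vcomp (g := (lComp₄ f012 f023 f034).cast
      (Y := e34 ⊗ₒ (e23 ⊗ₒ e12) ⊗ₒ e01) rfl (by simp))
    ⟨idc f034.mor ⊚ (e34 ◁₂ y0123.cell), by simp (maxDischargeDepth := 20),
      by simp (maxDischargeDepth := 20)⟩
    ⟨(betaDelta F f012 f014 f023 f024 f034 f124 f234 (x0234 ⊗ₜ e)).cell,
      by simp (maxDischargeDepth := 20), by simp (maxDischargeDepth := 20)⟩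

/-- Both sides are traces of the same cyclic word, opened at different places. -/
theorem innerForm_innerCellArg :
    innerForm F x2345 y0345 y1235 y0135 a c (innerCellArg F x0234 y0123 e) =
      closingForm F x2345 x0234 y0345 y1235 y0135 y0123
        (epsGammaAlpha F f012 f014 f015 f024 f045 f124 f125 f145 f245 (a ⊗ₜ (c ⊗ₜ e))) := by
  have h := trc_vcomp_comm F ((idc (f045.mor ⨾ (e45 ◁₁ f034.mor)) ⊚
      (e45 ◁₂ (e34 ◁₂ y0123.cell))) ⬝
    ((idc f045.mor ⊚ (e45 ◁₂ (x0234.cell ⊚ idc (e34 ◁₁ (e23 ◁₁ f012.mor))))) ⬝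
        (idc (f045.mor ⨾ (e45 ◁₁ f024.mor)) ⊚ (e45 ◁₂ tensorator f234.mor f012.mor))))
    (((epsGammaAlpha F f012 f014 f015 f024 f045 f124 f125 f145 f245 (a ⊗ₜ (c ⊗ₜ e))).cell ⊚
      idc (e45 ◁₁ (f234.mor ▷₁ (e12 ⊗ₒ e01)))) ⬝
      ((idc (f015.mor ⨾ (f125.mor ▷₁ e01)) ⊚ (x2345.cell ▷₂ (e12 ⊗ₒ e01))) ⬝
        (closingCellMid y0345 y1235 y0135).cell))
    (by simp (maxDischargeDepth := 20)) (by simp (maxDischargeDepth := 20))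
  rw [innerForm_apply, closingForm_apply]
  simp (maxDischargeDepth := 20) [cell_epsGammaAlpha] at h
  simp (maxDischargeDepth := 20) [cell_epsGammaAlpha, innerCellArg, innerCell, closingCell,
    closingCellRight, cell_betaDelta]
  exact h

/-- Rotating `y0123` to the end completes `α` and `γ` to an `αγε` composite. -/
theorem pairing_innerCellArg (α : TwoH' f123 f124 f134 f234) (γ : TwoH' f013 f014 f034 f134) :
    pairing F _ _ (innerCellArg F x0234 y0123 e)
      (alphaGamma F (lComp f013 f034) f014 f134 f123 (rComp f124 f234) α γ) =
    pairing F _ _ (betaDelta F f012 f014 f023 f024 f034 f124 f234 (x0234 ⊗ₜ e))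
      (alphaGammaEps F f012 f013 f014 f023 f034 f123 f124 f134 f234 (α ⊗ₜ (γ ⊗ₜ y0123))) := by
  have h := trc_vcomp_comm F (idc f034.mor ⊚ (e34 ◁₂ y0123.cell))
    ((betaDelta F f012 f014 f023 f024 f034 f124 f234 (x0234 ⊗ₜ e)).cell ⬝
      ((idc f014.mor ⊚ (α.cell ▷₂ e01)) ⬝ (γ.cell ⊚ idc (e34 ◁₁ (f123.mor ▷₁ e01)))))
    (by simp (maxDischargeDepth := 20)) (by simp (maxDischargeDepth := 20))
  rw [pairing_eq_tr, pairing_eq_tr, ← trc_cell, ← trc_cell]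
  simp (maxDischargeDepth := 20) at h
  simp (maxDischargeDepth := 20) [innerCellArg, cell_alphaGamma, cell_alphaGammaEps]
  exact h

end

/-! ### Contractions of iterated tensor products -/

section
open TensorProduct
variable {F : Type*} [Field F] {A B C D E G H M N P Q R X : Type*}
  [AddCommGroup A] [AddCommGroup B] [AddCommGroup C] [AddCommGroup D] [AddCommGroup E]
  [AddCommGroup G] [AddCommGroup H] [AddCommGroup M] [AddCommGroup N] [AddCommGroup P]
  [AddCommGroup Q] [AddCommGroup R] [AddCommGroup X]
  [Module F A] [Module F B] [Module F C] [Module F D] [Module F E] [Module F G] [Module F H]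
  [Module F M] [Module F N] [Module F P] [Module F Q] [Module F R] [Module F X]

/-- The tensor product of two linear forms. -/
noncomputable def formTensor (φ : M →ₗ[F] F) (ψ : N →ₗ[F] F) : M ⊗[F] N →ₗ[F] F :=
  LinearMap.mul' F F ∘ₗ TensorProduct.map φ ψ

@[simp] theorem formTensor_tmul (φ : M →ₗ[F] F) (ψ : N →ₗ[F] F) (m : M) (n : N) :
    formTensor φ ψ (m ⊗ₜ n) = φ m * ψ n := rfl

/-- Contraction of the first factor with a linear form. -/
noncomputable def contractFst (N : Type*) [AddCommGroup N] [Module F N] (φ : M →ₗ[F] F) :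
    M ⊗[F] N →ₗ[F] N :=
  (TensorProduct.lid F N).toLinearMap ∘ₗ LinearMap.rTensor N φ

@[simp] theorem contractFst_tmul (φ : M →ₗ[F] F) (m : M) (n : N) :
    contractFst N φ (m ⊗ₜ n) = φ m • n := rfl

/-- Contraction of the second factor with a linear form. -/
noncomputable def contractSnd (M : Type*) [AddCommGroup M] [Module F M] (ψ : N →ₗ[F] F) :
    M ⊗[F] N →ₗ[F] M :=
  (TensorProduct.rid F M).toLinearMap ∘ₗ LinearMap.lTensor M ψ

@[simp] theorem contractSnd_tmul (ψ : N →ₗ[F] F) (m : M) (n : N) :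
    contractSnd M ψ (m ⊗ₜ n) = ψ n • m := rfl

theorem form_contractFst (φ : M →ₗ[F] F) (ψ : N →ₗ[F] F) (z : M ⊗[F] N) :
    ψ (contractFst N φ z) = formTensor φ ψ z := by
  induction z with
  | zero => simp
  | tmul m n => simp
  | add x y hx hy => simp [hx, hy]

theorem form_contractSnd (φ : M →ₗ[F] F) (ψ : N →ₗ[F] F) (z : M ⊗[F] N) :
    φ (contractSnd M ψ z) = formTensor φ ψ z := by
  induction z with
  | zero => simp
  | tmul m n => simp [mul_comm]
  | add x y hx hy => simp [hx, hy]

theorem onThree_tmul (ψ : A ⊗[F] (B ⊗[F] C) →ₗ[F] M ⊗[F] N) (a : A) (b : B) (c : C) (r : R) :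
    onThree R ψ (a ⊗ₜ (b ⊗ₜ (c ⊗ₜ r))) =
      TensorProduct.assoc F M N R (ψ (a ⊗ₜ (b ⊗ₜ c)) ⊗ₜ r) := rfl

theorem onTwo_tmul (ζ : A ⊗[F] B →ₗ[F] M ⊗[F] (N ⊗[F] P)) (a : A) (b : B) (r : R) :
    onTwo R ζ (a ⊗ₜ (b ⊗ₜ r)) =
      LinearMap.lTensor M (LinearMap.lTensor N ((TensorProduct.mk F P R).flip r))
        (ζ (a ⊗ₜ b)) := by
  change LinearMap.lTensor M (TensorProduct.assoc F N P R).toLinearMap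
    (TensorProduct.assoc F M (N ⊗[F] P) R (ζ (a ⊗ₜ b) ⊗ₜ r)) = _
  induction ζ (a ⊗ₜ b) with
  | zero => simp
  | add x y hx hy => simp [TensorProduct.add_tmul, hx, hy]
  | tmul m w =>
    induction w with
    | zero => simp
    | add x y hx hy =>
      simp only [TensorProduct.tmul_add, TensorProduct.add_tmul, map_add, hx, hy]
    | tmul n p => rfl

theorem formTensor_idTensor_onThree (g : G →ₗ[F] F) (k : N →ₗ[F] F)
    (ψ : A ⊗[F] (B ⊗[F] C) →ₗ[F] G ⊗[F] M) (φ : M ⊗[F] R →ₗ[F] N)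
    (a : A) (b : B) (c : C) (r : R) :
    formTensor g k (idTensor G φ (onThree R ψ (a ⊗ₜ (b ⊗ₜ (c ⊗ₜ r))))) =
      k (φ (contractFst M g (ψ (a ⊗ₜ (b ⊗ₜ c))) ⊗ₜ r)) := by
  rw [onThree_tmul]
  induction ψ (a ⊗ₜ (b ⊗ₜ c)) with
  | zero => simp
  | add x y hx hy => simp only [TensorProduct.add_tmul, map_add, hx, hy]
  | tmul x y => simp [← TensorProduct.smul_tmul']

theorem formTensor_transpHead_onThree (g : G →ₗ[F] F) (n : N →ₗ[F] F) (h : H →ₗ[F] F)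
    (k : R →ₗ[F] F) (ψ : A ⊗[F] (B ⊗[F] C) →ₗ[F] G ⊗[F] H) (a : A) (b : B) (c : C) (r : R)
    (y : N) :
    formTensor g (formTensor n (formTensor h k)) (transpHead (H ⊗[F] R)
      (idTensor N (onThree R ψ) (y ⊗ₜ (a ⊗ₜ (b ⊗ₜ (c ⊗ₜ r)))))) =
    n y * formTensor g h (ψ (a ⊗ₜ (b ⊗ₜ c))) * k r := by
  rw [idTensor, LinearMap.lTensor_tmul, onThree_tmul]
  induction ψ (a ⊗ₜ (b ⊗ₜ c)) with
  | zero => simp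
  | add x y hx hy =>
    simp only [TensorProduct.tmul_add, TensorProduct.add_tmul, map_add, hx, hy, mul_add, add_mul]
  | tmul x y => simp; ring

variable (ψ : X ⊗[F] (A ⊗[F] P) →ₗ[F] M ⊗[F] N) (ψ' : M ⊗[F] (C ⊗[F] Q) →ₗ[F] G ⊗[F] H)
  (φ : D ⊗[F] E →ₗ[F] P ⊗[F] (Q ⊗[F] R))

theorem formTensor_onThree_onThree (g : G →ₗ[F] F) (n : N →ₗ[F] F) (h : H →ₗ[F] F)
    (k : R →ₗ[F] F) (x : X) (a : A) (p : P) (c : C) (q : Q) (r : R) :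
    formTensor g (formTensor n (formTensor h k)) (transpHead (H ⊗[F] R)
      (idTensor N (onThree R ψ') (transpHead (C ⊗[F] (Q ⊗[F] R))
        (onThree (C ⊗[F] (Q ⊗[F] R)) ψ (x ⊗ₜ (a ⊗ₜ (p ⊗ₜ (c ⊗ₜ (q ⊗ₜ r))))))))) =
    formTensor g h (ψ' (contractSnd M n (ψ (x ⊗ₜ (a ⊗ₜ p))) ⊗ₜ (c ⊗ₜ q))) * k r := by
  rw [onThree_tmul]
  induction ψ (x ⊗ₜ (a ⊗ₜ p)) with
  | zero => simp
  | add x y hx hy => simp only [TensorProduct.add_tmul, map_add, hx, hy, add_mul]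
  | tmul x y =>
    refine (formTensor_transpHead_onThree g n h k ψ' x c q r y).trans ?_
    simp [← TensorProduct.smul_tmul']

/-- The composite of the last three 4-simplices. -/
noncomputable def lastThree : X ⊗[F] (A ⊗[F] (C ⊗[F] (E ⊗[F] D))) →ₗ[F]
    G ⊗[F] (N ⊗[F] (H ⊗[F] R)) :=
  transpHead (H ⊗[F] R) ∘ₗ idTensor N (onThree R ψ') ∘ₗ transpHead (C ⊗[F] (Q ⊗[F] R)) ∘ₗ
    onThree (C ⊗[F] (Q ⊗[F] R)) ψ ∘ₗ
    idTensor X (idTensor A (transpHead (Q ⊗[F] R))) ∘ₗ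
    idTensor X (idTensor A (idTensor C φ)) ∘ₗ idTensor X (idTensor A (idTensor C transp))

/-- The two maps `ψ`, `ψ'` enter only through the bilinear form `K` that they induce on the first
two outputs of `φ`; here `K` will be `innerForm` of a `gammaAlpha` composite. -/
theorem formTensor_lastThree (g : G →ₗ[F] F) (n : N →ₗ[F] F) (h : H →ₗ[F] F)
    (k : R →ₗ[F] F) (x : X) (a : A) (c : C) (e : E) (d : D) (K : P ⊗[F] Q →ₗ[F] F)
    (hK : ∀ p q, formTensor g h (ψ' (contractSnd M n (ψ (x ⊗ₜ (a ⊗ₜ p))) ⊗ₜ (c ⊗ₜ q))) =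
      K (p ⊗ₜ q)) :
    formTensor g (formTensor n (formTensor h k))
      (lastThree ψ ψ' φ (x ⊗ₜ (a ⊗ₜ (c ⊗ₜ (e ⊗ₜ d))))) =
    K (LinearMap.lTensor P (contractSnd Q k) (φ (d ⊗ₜ e))) := by
  change formTensor g (formTensor n (formTensor h k)) (transpHead (H ⊗[F] R)
      (idTensor N (onThree R ψ') (transpHead (C ⊗[F] (Q ⊗[F] R))
        (onThree (C ⊗[F] (Q ⊗[F] R)) ψ
          (x ⊗ₜ (a ⊗ₜ (transpHead (Q ⊗[F] R) (c ⊗ₜ φ (d ⊗ₜ e)))))))))= _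
  induction φ (d ⊗ₜ e) with
  | zero => simp
  | add x y hx hy => simp only [TensorProduct.tmul_add, map_add, hx, hy]
  | tmul p w =>
    induction w with
    | zero => simp
    | add x y hx hy => simp only [TensorProduct.tmul_add, map_add, hx, hy]
    | tmul q r =>
      refine (formTensor_onThree_onThree ψ ψ' g n h k x a p c q r).trans ?_
      rw [hK]
      simp [mul_comm]

end

/-! ### Pairing the partition functions with dual elements -/

section
variable {O : Type u} [TwoCatData.{u, v, w} O] [MonoidalData O]
  [DualData O] [SemistrictMonoidalDuals O] (F : Type*) [Field F] [Preadditive2 O] [VectLinear F O]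
  [NonDegenerate F O]

/-- The linear form `⟨·, y⟩`. -/
noncomputable def pairForm {A B : O} {f g : Hom A B} (y : Hom2 g f) : Hom2 f g →ₗ[F] F :=
  (pairing F f g).flip y

theorem pairForm_apply {A B : O} {f g : Hom A B} (y : Hom2 g f) (x : Hom2 f g) :
    pairForm F y x = pairing F f g x y := rfl

theorem pairing_ext {A B : O} {f g : Hom A B} {x y : Hom2 f g}
    (h : ∀ z, pairing F f g x z = pairing F f g y z) : x = y :=
  (dualEquiv F f g).injective (LinearMap.ext h)

theorem formTensor_pairForm {A B C D : O} {f f' : Hom A B} {g g' : Hom C D} (y : Hom2 f' f)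
    (y' : Hom2 g' g) (z : Hom2 f f' ⊗[F] Hom2 g g') :
    formTensor (pairForm F y) (pairForm F y') z = dualEquiv₂ F f f' g g' z (y ⊗ₜ y') := by
  induction z with
  | zero => simp
  | tmul a b => rfl
  | add a b ha hb => simp only [map_add, ha, hb, LinearMap.add_apply]

theorem formTensor_pairForm₃ {A B C D X Y : O} {f f' : Hom A B} {g g' : Hom C D}
    {h h' : Hom X Y} (y : Hom2 f' f) (y' : Hom2 g' g) (y'' : Hom2 h' h)
    (z : Hom2 f f' ⊗[F] (Hom2 g g' ⊗[F] Hom2 h h')) :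
    formTensor (pairForm F y) (formTensor (pairForm F y') (pairForm F y'')) z =
      dualEquiv₃ F f f' g g' h h' z (y ⊗ₜ (y' ⊗ₜ y'')) := by
  induction z with
  | zero => simp
  | tmul a b =>
    rw [formTensor_tmul, formTensor_pairForm]; rfl
  | add a b ha hb => simp only [map_add, ha, hb, LinearMap.add_apply]

/-- Through the pairing, a tensor becomes a linear map from `Hom2 f' f` to `V`, whose values are the
contractions. -/
theorem eq_of_formTensor_eq {V : Type*} [AddCommGroup V] [Module F V] {A B : O} {f f' : Hom A B}
    {z z' : Hom2 f f' ⊗[F] V}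
    (h : ∀ (y : Hom2 f' f), contractFst V (pairForm F y) z = contractFst V (pairForm F y) z') :
    z = z' := by
  apply (TensorProduct.congr (dualEquiv F f f') (LinearEquiv.refl F V)).injective
  apply (dualTensorHomEquiv F (Hom2 f' f) V).injective
  ext y
  have key : ∀ w : Hom2 f f' ⊗[F] V, dualTensorHomEquiv F (Hom2 f' f) V
      (TensorProduct.congr (dualEquiv F f f') (LinearEquiv.refl F V) w) y =
      contractFst V (pairForm F y) w := by
    intro w
    induction w with
    | zero => simp
    | tmul a b => simp; rfl
    | add a b ha hb => simp only [map_add, LinearMap.add_apply, ha, hb]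
  rw [key, key, h]

section
variable {eij eik eil eim ejk ejl ejm ekl ekm elm : O}
  (fijk : Hom eik (ejk ⊗ₒ eij)) (fijl : Hom eil (ejl ⊗ₒ eij)) (fijm : Hom eim (ejm ⊗ₒ eij))
  (fikl : Hom eil (ekl ⊗ₒ eik)) (fikm : Hom eim (ekm ⊗ₒ eik)) (film : Hom eim (elm ⊗ₒ eil))
  (fjkl : Hom ejl (ekl ⊗ₒ ejk)) (fjkm : Hom ejm (ekm ⊗ₒ ejk)) (fjlm : Hom ejm (elm ⊗ₒ ejl))
  (fklm : Hom ekm (elm ⊗ₒ ekl))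
  (x : TwoH fjkl fjkm fjlm fklm ⊗[F] (TwoH fijl fijm film fjlm ⊗[F] TwoH fijk fijl fikl fjkl))

theorem formTensor_Zminus (β : TwoH' fikl fikm film fklm) (δ : TwoH' fijk fijm fikm fjkm) :
    formTensor (pairForm F β) (pairForm F δ)
      (Zminus F fijk fijl fijm fikl fikm film fjkl fjkm fjlm fklm x) =
    pairing F _ _ (deltaBeta F fijk fijm fikl fikm film fjkm fklm (β ⊗ₜ δ))
      (epsGammaAlpha F fijk fijl fijm fikl film fjkl fjkm fjlm fklm x) := by
  rw [formTensor_pairForm, Zminus]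
  simp

theorem contractFst_Zminus (β : TwoH' fikl fikm film fklm) :
    contractFst _ (pairForm F β) (Zminus F fijk fijl fijm fikl fikm film fjkl fjkm fjlm fklm x) =
      betaContract fijk fijm fikl fikm film fjkm fklm
        (epsGammaAlpha F fijk fijl fijm fikl film fjkl fjkm fjlm fklm x) β := by
  refine pairing_ext F fun δ => ?_
  rw [pairing_betaContract, ← formTensor_Zminus, ← form_contractFst]
  rfl

theorem contractSnd_Zminus (δ : TwoH' fijk fijm fikm fjkm) :
    contractSnd _ (pairForm F δ) (Zminus F fijk fijl fijm fikl fikm film fjkl fjkm fjlm fklm x) =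
      deltaContract fijk fijm fikl fikm film fjkm fklm
        (epsGammaAlpha F fijk fijl fijm fikl film fjkl fjkm fjlm fklm x) δ := by
  refine pairing_ext F fun β => ?_
  rw [pairing_deltaContract, ← formTensor_Zminus, ← form_contractSnd]
  rfl

theorem formTensor_Zplus (z : TwoH fikl fikm film fklm ⊗[F] TwoH fijk fijm fikm fjkm)
    (α : TwoH' fjkl fjkm fjlm fklm) (γ : TwoH' fijl fijm film fjlm)
    (ε : TwoH' fijk fijl fikl fjkl) :
    formTensor (pairForm F α) (formTensor (pairForm F γ) (pairForm F ε))
      (Zplus F fijk fijl fijm fikl fikm film fjkl fjkm fjlm fklm z) =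
    pairing F _ _ (betaDelta F fijk fijm fikl fikm film fjkm fklm z)
      (alphaGammaEps F fijk fijl fijm fikl film fjkl fjkm fjlm fklm (α ⊗ₜ (γ ⊗ₜ ε))) := by
  rw [formTensor_pairForm₃, Zplus_eq, dualEquiv₃_coord]

end

variable
  {e01 e02 e03 e04 e05 e12 e13 e14 e15 e23 e24 e25 e34 e35 e45 : O}
  {f012 : Hom e02 (e12 ⊗ₒ e01)} {f013 : Hom e03 (e13 ⊗ₒ e01)} {f014 : Hom e04 (e14 ⊗ₒ e01)}
  {f015 : Hom e05 (e15 ⊗ₒ e01)}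
  {f023 : Hom e03 (e23 ⊗ₒ e02)} {f024 : Hom e04 (e24 ⊗ₒ e02)} {f025 : Hom e05 (e25 ⊗ₒ e02)}
  {f034 : Hom e04 (e34 ⊗ₒ e03)} {f035 : Hom e05 (e35 ⊗ₒ e03)} {f045 : Hom e05 (e45 ⊗ₒ e04)}
  {f123 : Hom e13 (e23 ⊗ₒ e12)} {f124 : Hom e14 (e24 ⊗ₒ e12)} {f125 : Hom e15 (e25 ⊗ₒ e12)}
  {f135 : Hom e15 (e35 ⊗ₒ e13)} {f145 : Hom e15 (e45 ⊗ₒ e14)}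
  {f234 : Hom e24 (e34 ⊗ₒ e23)} {f235 : Hom e25 (e35 ⊗ₒ e23)} {f245 : Hom e25 (e45 ⊗ₒ e24)}
  {f345 : Hom e35 (e45 ⊗ₒ e34)}

/-- Tested on `α ⊗ γ`, both sides are the same trace. Thus the coefficients in the expansion along
`f134` are a contraction of the partition function of 01234. -/
theorem contract_Zplus (f134 : Hom e14 (e34 ⊗ₒ e13)) (x0234 : TwoH f023 f024 f034 f234)
    (e : TwoH f012 f014 f024 f124) (y0123 : TwoH' f012 f013 f023 f123) :
    LinearMap.lTensor _ (contractSnd _ (pairForm F y0123))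
      (Zplus F f012 f013 f014 f023 f024 f034 f123 f124 f134 f234 (x0234 ⊗ₜ e)) =
    coordAlphaGamma F (lComp f013 f034) f014 f134 f123 (rComp f124 f234)
      (innerCellArg F x0234 y0123 e) := by
  apply (dualEquiv₂ F _ _ _ _).injective
  ext α γ
  change dualEquiv₂ F _ _ _ _ _ (α ⊗ₜ γ) = dualEquiv₂ F _ _ _ _ _ (α ⊗ₜ γ)
  rw [dualEquiv₂_coordAlphaGamma, pairing_innerCellArg, ← formTensor_Zplus,
    ← formTensor_pairForm]
  induction Zplus F f012 f013 f014 f023 f024 f034 f123 f124 f134 f234 (x0234 ⊗ₜ e) with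
  | zero => simp
  | add x y hx hy => simp only [map_add, hx, hy]
  | tmul p w => simp [form_contractSnd]

variable (x2345 : TwoH f234 f235 f245 f345) (x0234 : TwoH f023 f024 f034 f234)
  (y0345 : TwoH' f034 f035 f045 f345) (y1235 : TwoH' f123 f125 f135 f235)
  (y0135 : TwoH' f013 f015 f035 f135) (y0123 : TwoH' f012 f013 f023 f123)

/-- For pure tensors the right-hand side is `innerForm` of an inner 2-morphism; expanding that
2-morphism along `f134` gives the left-hand side term by term. -/
theorem sum_formTensor_lastThree {T : Finset (Hom e14 (e34 ⊗ₒ e13))} (hT : IsBasis F T)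
    (z : TwoH f124 f125 f145 f245 ⊗[F] (TwoH f014 f015 f045 f145 ⊗[F] TwoH f012 f014 f024 f124)) :
    ∑ f134 ∈ T, dimMor F f134 • formTensor (pairForm F y0345) (formTensor (pairForm F y1235)
      (formTensor (pairForm F y0135) (pairForm F y0123)))
      (lastThree (Zminus F f123 f124 f125 f134 f135 f145 f234 f235 f245 f345)
        (Zminus F f013 f014 f015 f034 f035 f045 f134 f135 f145 f345)
        (Zplus F f012 f013 f014 f023 f024 f034 f123 f124 f134 f234)
        (x2345 ⊗ₜ LinearMap.lTensor _ (LinearMap.lTensor _ ((TensorProduct.mk F _ _).flip x0234))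
          z)) =
    closingForm F x2345 x0234 y0345 y1235 y0135 y0123
      (epsGammaAlpha F f012 f014 f015 f024 f045 f124 f125 f145 f245 z) := by
  induction z with
  | zero => simp
  | add x y hx hy =>
    simp only [map_add, TensorProduct.tmul_add, smul_add, Finset.sum_add_distrib, hx, hy]
  | tmul a w =>
    induction w with
    | zero => simp
    | add x y hx hy =>
      simp only [map_add, TensorProduct.tmul_add, smul_add, Finset.sum_add_distrib, hx, hy]
    | tmul c e =>
      rw [← innerForm_innerCellArg]
      conv_rhs => rw [← sum_gammaAlpha F hT (lComp f013 f034) f014 f123 (rComp f124 f234)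
        (innerCellArg F x0234 y0123 e)]
      rw [map_sum]
      refine Finset.sum_congr rfl fun f134 _ => ?_
      rw [map_smul]
      congr 1
      refine (formTensor_lastThree _ _ _ _ _ _ _ x2345 a c e x0234
        (innerForm F x2345 y0345 y1235 y0135 a c ∘ₗ TensorProduct.lift
          (gammaAlpha F (lComp f013 f034) f014 f134 f123 (rComp f124 f234)).flip) ?_).trans ?_
      · intro p q
        rw [contractSnd_Zminus, formTensor_Zminus, innerForm_gammaAlpha]
        rfl
      · rw [contract_Zplus]
        rfl

end

/-! ### Assembly of the two expansions -/

theorem tensor_ext₄ {F : Type*} [Field F] {A B C D E : Type*} [AddCommGroup A] [AddCommGroup B]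
    [AddCommGroup C] [AddCommGroup D] [AddCommGroup E] [Module F A] [Module F B] [Module F C]
    [Module F D] [Module F E] {f g : A ⊗[F] (B ⊗[F] (C ⊗[F] D)) →ₗ[F] E}
    (h : ∀ a b c d, f (a ⊗ₜ (b ⊗ₜ (c ⊗ₜ d))) = g (a ⊗ₜ (b ⊗ₜ (c ⊗ₜ d)))) : f = g := by
  ext a b c d
  exact h a b c d

section
variable {O : Type u} [TwoCatData.{u, v, w} O] [MonoidalData O]
  [DualData O] [SemistrictMonoidalDuals O] (F : Type*) [Field F] [Preadditive2 O] [VectLinear F O]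
  [NonDegenerate F O]

theorem eq_of_formTensor₄ {A B C D X Y Z W : O} {f f' : Hom A B} {g g' : Hom C D} {h h' : Hom X Y}
    {k k' : Hom Z W} {z z' : Hom2 f f' ⊗[F] (Hom2 g g' ⊗[F] (Hom2 h h' ⊗[F] Hom2 k k'))}
    (H : ∀ (y : Hom2 f' f) (y' : Hom2 g' g) (y'' : Hom2 h' h) (y''' : Hom2 k' k),
      formTensor (pairForm F y) (formTensor (pairForm F y')
        (formTensor (pairForm F y'') (pairForm F y'''))) z =
      formTensor (pairForm F y) (formTensor (pairForm F y')
        (formTensor (pairForm F y'') (pairForm F y'''))) z') : z = z' := by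
  refine eq_of_formTensor_eq F fun y => eq_of_formTensor_eq F fun y' =>
    eq_of_formTensor_eq F fun y'' => pairing_ext F fun y''' => ?_
  simp only [← pairForm_apply, form_contractFst, H]

end

end Spherical2

set_option maxHeartbeats 4000000 in
theorem lemma5p3 {F : Type*} [Field F] [CharZero F] {O : Type*} [TwoCatData O] [MonoidalData O]
    [DualData O] [PivotalData O] [SphericalData O] [SphericalTwoCategory O] [Preadditive2 O]
    [VectLinear F O] [NonDegenerate F O]
    (E : Finset O) (hE : FinitelySemisimple F E)
    (B : ∀ X Y : O, Finset (Hom X Y)) (hB : ∀ X Y, IsBasis F (B X Y))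
    {e01 e02 e03 e04 e05 e12 e13 e15 e23 e24 e25 e34 e35 e45 : O}
    (he : {e01, e02, e03, e04, e05, e12, e13, e15, e23, e24, e25, e34, e35, e45} ⊆ (E : Set O))
    {f012 : Hom e02 (e12 ⊗ₒ e01)} (h012 : f012 ∈ B _ _)
    {f013 : Hom e03 (e13 ⊗ₒ e01)} (h013 : f013 ∈ B _ _)
    {f015 : Hom e05 (e15 ⊗ₒ e01)} (h015 : f015 ∈ B _ _)
    {f023 : Hom e03 (e23 ⊗ₒ e02)} (h023 : f023 ∈ B _ _)
    {f024 : Hom e04 (e24 ⊗ₒ e02)} (h024 : f024 ∈ B _ _)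
    {f025 : Hom e05 (e25 ⊗ₒ e02)} (h025 : f025 ∈ B _ _)
    {f034 : Hom e04 (e34 ⊗ₒ e03)} (h034 : f034 ∈ B _ _)
    {f035 : Hom e05 (e35 ⊗ₒ e03)} (h035 : f035 ∈ B _ _)
    {f045 : Hom e05 (e45 ⊗ₒ e04)} (h045 : f045 ∈ B _ _)
    {f123 : Hom e13 (e23 ⊗ₒ e12)} (h123 : f123 ∈ B _ _)
    {f125 : Hom e15 (e25 ⊗ₒ e12)} (h125 : f125 ∈ B _ _)
    {f135 : Hom e15 (e35 ⊗ₒ e13)} (h135 : f135 ∈ B _ _)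
    {f234 : Hom e24 (e34 ⊗ₒ e23)} (h234 : f234 ∈ B _ _)
    {f235 : Hom e25 (e35 ⊗ₒ e23)} (h235 : f235 ∈ B _ _)
    {f245 : Hom e25 (e45 ⊗ₒ e24)} (h245 : f245 ∈ B _ _)
    {f345 : Hom e35 (e45 ⊗ₒ e34)} (h345 : f345 ∈ B _ _) :
    idTensor (TwoH f034 f035 f045 f345)
        (Zplus F f012 f013 f015 f023 f025 f035 f123 f125 f135 f235) ∘ₗ
      onThree (TwoH f012 f015 f025 f125)
        (Zminus F f023 f024 f025 f034 f035 f045 f234 f235 f245 f345) =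
    ∑ e14 ∈ E, ∑ f014 ∈ B e04 (e14 ⊗ₒ e01), ∑ f124 ∈ B e14 (e24 ⊗ₒ e12),
      ∑ f145 ∈ B e15 (e45 ⊗ₒ e14), ∑ f134 ∈ B e14 (e34 ⊗ₒ e13),
      ((dimObj F e14)⁻¹ * dimMor F f014 * dimMor F f124 * dimMor F f145 * dimMor F f134) •
        (transpHead (TwoH f013 f015 f035 f135 ⊗[F] TwoH f012 f013 f023 f123) ∘ₗ
          idTensor (TwoH f123 f125 f135 f235) (onThree (TwoH f012 f013 f023 f123)
            (Zminus F f013 f014 f015 f034 f035 f045 f134 f135 f145 f345)) ∘ₗ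
          transpHead (TwoH f014 f015 f045 f145 ⊗[F]
            (TwoH f013 f014 f034 f134 ⊗[F] TwoH f012 f013 f023 f123)) ∘ₗ
          onThree (TwoH f014 f015 f045 f145 ⊗[F]
              (TwoH f013 f014 f034 f134 ⊗[F] TwoH f012 f013 f023 f123))
            (Zminus F f123 f124 f125 f134 f135 f145 f234 f235 f245 f345) ∘ₗ
          idTensor (TwoH f234 f235 f245 f345) (idTensor (TwoH f124 f125 f145 f245)
            (transpHead (TwoH f013 f014 f034 f134 ⊗[F] TwoH f012 f013 f023 f123))) ∘ₗ
          idTensor (TwoH f234 f235 f245 f345) (idTensor (TwoH f124 f125 f145 f245)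
            (idTensor (TwoH f014 f015 f045 f145)
              (Zplus F f012 f013 f014 f023 f024 f034 f123 f124 f134 f234))) ∘ₗ
          idTensor (TwoH f234 f235 f245 f345) (idTensor (TwoH f124 f125 f145 f245)
            (idTensor (TwoH f014 f015 f045 f145) transp)) ∘ₗ
          idTensor (TwoH f234 f235 f245 f345) (onTwo (TwoH f023 f024 f034 f234)
            (Zplus F f012 f014 f015 f024 f025 f045 f124 f125 f145 f245)) ∘ₗ
          idTensor (TwoH f234 f235 f245 f345) (idTensor (TwoH f024 f025 f045 f245) transp)) := by
  refine tensor_ext₄ fun x2345 x0245 x0234 x0125 => eq_of_formTensor₄ F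
    fun y0345 y1235 y0135 y0123 => ?_
  refine (formTensor_idTensor_onThree _ _ _ _ x2345 x0245 x0234 x0125).trans ?_
  -- The left-hand number becomes `closingForm` of the composite of `x0245` and `x0125`.
  rw [contractFst_Zminus, formTensor_Zplus, closingForm_betaDelta]
  -- The expansion is taken for the 4-simplex 01245, with `e14` as the summed edge; this supplies
  -- all weights except `dim f134`.
  conv_lhs => rw [← sum_epsGammaAlpha f012 f015 f024 f045 f125 f245 hE hB
    (betaDelta F f012 f015 f024 f025 f045 f125 f245 (x0245 ⊗ₜ x0125))]
  simp only [LinearMap.sum_apply, map_sum, LinearMap.smul_apply, map_smul]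
  refine Finset.sum_congr rfl fun e14 _ => Finset.sum_congr rfl fun f014 _ =>
    Finset.sum_congr rfl fun f124 _ => Finset.sum_congr rfl fun f145 _ => ?_
  rw [← sum_formTensor_lastThree F x2345 x0234 y0345 y1235 y0135 y0123 (hB e14 (e34 ⊗ₒ e13)),
    Finset.smul_sum]
  refine Finset.sum_congr rfl fun f134 _ => ?_
  -- The coordinates of `βδ` are recognised as Z(+(01245)); the remaining composite is `lastThree`
  -- by definition.
  rw [smul_smul, ← Zplus_eq, ← onTwo_tmul]
  rfl
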